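/- Let $\varepsilon>0$, $L=\varepsilon^{-1/2}$, $R_\kappa>0$ and $F(\eta)=-\dfrac{\varepsilon}{R_\kappa-\varepsilon\eta}$. Consider the $\varepsilon$-Milne problem with geometric correction on $(\eta,\phi)\in[0,L]\times[-\pi,\pi)$ (the angle $\phi$ being understood modulo $2\pi$), $$\sin\phi\,\frac{\partial f}{\partial\eta}+F(\eta)\cos\phi\,\frac{\partial f}{\partial\phi}+f-\bar f=S(\eta,\phi),\qquad f(0,\phi)=h(\phi)\ \text{ for }\sin\phi>0,\qquad f(L,\phi)=f(L,-\phi),$$ where $\bar f(\eta)=\frac1{2\pi}\int_{-\pi}^{\pi}f(\eta,\phi)\,d\phi$, and $h$, $S$ are bounded Borel functions. A solution is a bounded Borel function $f$ that satisfies the two boundary conditions pointwise and the equation along characteristics: whenever $X'=\sin\Phi$, $\Phi'=F(X)\cos\Phi$ on $[a,b]$ with values $X\in[0,L]$, one has $f(X,\Phi)\big|_a^b=\int_a^b\big(\bar f(X)+S(X,\Phi)-f(X,\Phi)\big)\,ds$. Write $S_Q=\bar S$, $S_R=S-\bar S$, $\langle\sin\phi,S_R\rangle_\phi(\eta)=\int_{-\pi}^{\pi}\sin\phi\,S_R(\eta,\phi)\,d\phi$,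 and $$\|u\|_{L^2L^2}=\Big(\int_0^L\!\!\int_{-\pi}^{\pi}|u|^2\,d\phi\,d\eta\Big)^{1/2},\quad \|u\|_{L^\infty L^\infty}=\sup|u|,\quad \|h\|_{L^2_-}=\Big(\int_{\sin\phi>0}|h|^2\sin\phi\,d\phi\Big)^{1/2},\quad \|h\|_{L^\infty_-}=\sup_{\sin\phi>0}|h|,$$ where the supremum for $u$ is over $[0,L]\times[-\pi,\pi)$ without the two grazing points $(0,0)$ and $(0,-\pi)$, at which the problem does not determine $f$. **Theorem (exponential decay).** For every $R_{\min}>0$ there are $\varepsilon_0>0$, $K_{\max}>0$ and $C>0$, depending only on $R_{\min}$, such that for all $0<\varepsilon\le\varepsilon_0$, all $R_\kappa\ge R_{\min}$ and all $h,S$ as above, the problem has a solution $f$, unique away from the two grazing points, and there is $f_L\in\mathbb R$ with $$|f_L|\le C\Big(\|h\|_{L^2_-}+\|S\|_{L^2L^2}\Big)+C\Big|\int_0^L\langle\sin\phi,S_R\rangle_\phi(y)\,dy\Big|+C\Big|\int_0^L\!\!\int_\eta^L|S_Q(y)|\,dy\,d\eta\Big|$$ such that, for every $0<K_0\le K_{\max}$,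 $$\begin{aligned}\|e^{K_0\eta}(f-f_L)\|_{L^\infty L^\infty}\le{}& C\Big(\|h\|_{L^2_-}+\|e^{K_0\eta}S\|_{L^2L^2}+\|h\|_{L^\infty_-}+\|e^{K_0\eta}S\|_{L^\infty L^\infty}\Big)\\&+C\Big(\int_0^L e^{2K_0\eta}\Big(\int_\eta^L\langle\sin\phi,S_R\rangle_\phi(y)\,dy\Big)^2d\eta\Big)^{1/2}+C\Big|\int_0^L\langle\sin\phi,S_R\rangle_\phi(y)\,dy\Big|\\&+C\Big|\int_0^L\!\!\int_\eta^L|S_Q(y)|\,dy\,d\eta\Big|+C\Big(\int_0^L e^{2K_0\eta}\Big(\int_\eta^L|S_Q(y)|\,dy\Big)^2d\eta\Big)^{1/2}\\&+C\Big(\int_0^L e^{2K_0\eta}\Big(\int_\eta^L\!\!\int_y^L|S_Q(z)|\,dz\,dy\Big)^2d\eta\Big)^{1/2}.\end{aligned}$$ -/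

import Mathlib

open Real Set MeasureTheory

noncomputable section

namespace Milne

/-- The length `L = ε^{-1/2}` of the spatial interval. -/
def len (ε : ℝ) : ℝ := (√ε)⁻¹

/-- The force `F(η) = -ε / (R - ε η)`, where `R` is the radius of curvature. -/
def force (ε R η : ℝ) : ℝ := -(ε / (R - ε * η))

/-- The angular average `(1 / 2π) ∫_{-π}^{π} u(η, φ) dφ`. -/
def mean (u : ℝ → ℝ → ℝ) (η : ℝ) : ℝ := (2 * π)⁻¹ * ∫ φ in (-π)..π, u η φ

/-- The part `u - ū` of `u` with zero angular average. -/
def fluct (u : ℝ → ℝ → ℝ) (η φ : ℝ) : ℝ := u η φ - mean u η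

/-- The inner product `⟨sin φ, u⟩_φ(η) = ∫_{-π}^{π} sin φ u(η, φ) dφ`. -/
def sinMoment (u : ℝ → ℝ → ℝ) (η : ℝ) : ℝ := ∫ φ in (-π)..π, sin φ * u η φ

/-- The set `[0, L] × [-π, π)` without the two grazing points `(0, 0)` and `(0, -π)` of the in-flow
boundary. No characteristic in `[0, L]` leads to these two points, and the in-flow condition is not
imposed there, so the boundary value problem says nothing about the value of a solution at them. -/
def phaseSpace (L : ℝ) : Set (ℝ × ℝ) :=
  {p | p.1 ∈ Icc 0 L ∧ p.2 ∈ Ico (-π) π ∧ ¬ (p.1 = 0 ∧ sin p.2 = 0)}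

/-- The supremum norm in `(η, φ)`. -/
def supNorm (L : ℝ) (u : ℝ → ℝ → ℝ) : ℝ := ⨆ p : phaseSpace L, |u p.1.1 p.1.2|

/-- The `L²` norm in `(η, φ) ∈ [0, L] × [-π, π)`. -/
def l2Norm (L : ℝ) (u : ℝ → ℝ → ℝ) : ℝ := √(∫ η in (0 : ℝ)..L, ∫ φ in (-π)..π, |u η φ| ^ 2)

/-- The supremum norm on the in-flow set `sin φ > 0`, that is `0 < φ < π`. -/
def inflowSupNorm (h : ℝ → ℝ) : ℝ := ⨆ φ : Ioo (0 : ℝ) π, |h φ|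

/-- The `L²` norm on the in-flow set with weight `sin φ`. -/
def inflowL2Norm (h : ℝ → ℝ) : ℝ := √(∫ φ in (0 : ℝ)..π, |h φ| ^ 2 * sin φ)

/-- The function `e^{kη} u(η, φ)`. -/
def expWeight (k : ℝ) (u : ℝ → ℝ → ℝ) (η φ : ℝ) : ℝ := exp (k * η) * u η φ

/-- The weighted norm `(∫_0^L e^{2kη} w(η)² dη)^{1/2}`. -/
def expL2 (k L : ℝ) (w : ℝ → ℝ) : ℝ := √(∫ η in (0 : ℝ)..L, exp (2 * k * η) * w η ^ 2)

/-- Admissible data: Borel measurable and bounded in-flow data `h` on `sin φ > 0` and source `S` on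
`[0, L] × [-π, π)`. A function of the angle `φ ∈ [-π, π)` is regarded as a `2π`-periodic one. -/
structure IsData (L : ℝ) (h : ℝ → ℝ) (S : ℝ → ℝ → ℝ) : Prop where
  measurable_inflow : Measurable h
  bounded_inflow : ∃ M, ∀ φ ∈ Ioo 0 π, |h φ| ≤ M
  measurable_source : Measurable (Function.uncurry S)
  periodic_source : ∀ η ∈ Icc 0 L, Function.Periodic (S η) (2 * π)
  bounded_source : ∃ M, ∀ η ∈ Icc 0 L, ∀ φ, |S η φ| ≤ M

/-- `s ↦ (X s, Φ s)`, `a ≤ s ≤ b`, is an arc in `[0, L]` of a characteristic of the operator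
`sin φ ∂_η + F(η) cos φ ∂_φ`. -/
structure IsCharacteristic (ε R a b : ℝ) (X Φ : ℝ → ℝ) : Prop where
  mem : ∀ s ∈ Icc a b, X s ∈ Icc 0 (len ε)
  deriv_space : ∀ s ∈ Icc a b, HasDerivWithinAt X (sin (Φ s)) (Icc a b) s
  deriv_angle : ∀ s ∈ Icc a b,
    HasDerivWithinAt Φ (force ε R (X s) * cos (Φ s)) (Icc a b) s

/-- `f` is a bounded solution of the `ε`-Milne problem with geometric correction
`sin φ ∂_η f + F(η) cos φ ∂_φ f + f - f̄ = S` on `[0, L]`,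
`f(0, φ) = h(φ)` for `sin φ > 0`, `f(L, φ) = f(L, -φ)`.
The equation is understood along characteristics: `d/ds f(X, Φ) = f̄(X) + S(X, Φ) - f(X, Φ)`
in integrated form. -/
structure IsSolution (ε R : ℝ) (h : ℝ → ℝ) (S f : ℝ → ℝ → ℝ) : Prop where
  measurable : Measurable (Function.uncurry f)
  periodic : ∀ η ∈ Icc 0 (len ε), Function.Periodic (f η) (2 * π)
  bounded : ∃ M, ∀ η ∈ Icc 0 (len ε), ∀ φ, |f η φ| ≤ M
  transport : ∀ a b X Φ, a ≤ b → IsCharacteristic ε R a b X Φ →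
    f (X b) (Φ b) - f (X a) (Φ a)
      = ∫ s in a..b, (mean f (X s) + S (X s) (Φ s) - f (X s) (Φ s))
  inflow : ∀ φ ∈ Ioo 0 π, f 0 φ = h φ
  reflection : ∀ φ, f (len ε) φ = f (len ε) (-φ)

end Milne

end

noncomputable section

namespace Milne


/-! Put `A = R / ε`, `L = len ε`. In the plane with coordinates `t = -(A - η) sin φ`, `E = (A - η)
cos φ` the characteristics are the straight lines `E = const`, run through at unit speed, and phase
space is the annulus `A - L ≤ rad t E ≤ A`. The condition `f(L, φ) = f(L, -φ)` says that `f` takes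
the same value where a line enters the inner disc and where it leaves it, so the disc acts as a
void. The geometric force disappears, and a solution is one explicit integral along each chord of
the outer circle (`mild`, `IsSolution.planar_eq_mild`).

Existence and uniqueness: `f` is determined by its angular average through `mild`. A chord has
length at most `2A`, so the map from average to average contracts the supremum norm by `1 - exp
(-2A)` (`abs_mild_sub_le`). This factor is not uniform in `ε`, hence the estimates come from
elsewhere.

`L²` theory: Fubini in `(t, E)` and polar coordinates give a divergence theorem on `[η, L]`
(`AlongLines.divergence`), which is applied to three multipliers. Multiplied by `1` the equation
gives the flux, a tail integral of the averaged source. Multiplied by `sin φ / (A - η)` it gives the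
moment with weight `sin² φ`; the force enters only through `cos 2φ`, which has zero mean and
therefore sees only the fluctuation `f - f̄`. So `π f̄(η)` equals the constant `β = ∫ sin² φ f(L, φ)
dφ` up to the fluctuation and tails of the source, and the limit is `f_L = β / π`. Multiplied by
`e^{2Kη} (f - c)` it gives an energy identity in which the weighted fluctuation is coercive. Since
`A ≥ 6L` the force term costs no more than the fluctuation, and since `K` is small the energy
inequality closes (`Moments.weighted_q_le_of_energy`). The case `K = 0`, `c = 0` bounds `β` itself
(`Moments.abs_beta_le`); there the product of the two parts of the source needs an integration by
parts.

`L²` to `L^∞`: along a line `η` changes by at most the optical depth, so half of the attenuation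
pays for `e^{Kη}` and half is left over (`exp_mul_abs_sol_sub_le`). At angles away from grazing, the
nearby part of the line can be parametrised by `η`, so the average enters through its `L²` norm, and
the far part carries a small factor (`attenuated_le_of_le_abs`). Nearly grazing angles are few.
Averaging over `φ` bounds the supremum `M` of `e^{Kη} |f̄ - f_L|` by data plus `3M/4`, which is
absorbed (`exp_mul_abs_sub_le`). -/

/-! ### Functions with an integrated derivative and their product rule -/

/-- `u` is a primitive of the integrable function `u'` on `[a, b]`. -/
structure IsPrimitiveOn (u u' : ℝ → ℝ) (a b : ℝ) : Prop where
  integrable : IntervalIntegrable u' volume a b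
  sub_eq : ∀ t ∈ Icc a b, u t - u a = ∫ x in a..t, u' x

lemma IsPrimitiveOn.intervalIntegrable {u u' : ℝ → ℝ} {a b x y : ℝ} (hu : IsPrimitiveOn u u' a b)
    (hx : x ∈ Icc a b) (hy : y ∈ Icc a b) : IntervalIntegrable u' volume x y := by
  refine hu.integrable.mono_set ?_
  rw [uIcc_of_le (hx.1.trans hx.2)]
  exact uIcc_subset_Icc hx hy

lemma IsPrimitiveOn.sub_eq_integral {u u' : ℝ → ℝ} {a b x y : ℝ} (hu : IsPrimitiveOn u u' a b)
    (hx : x ∈ Icc a b) (hy : y ∈ Icc a b) : u y - u x = ∫ s in x..y, u' s := by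
  have ha : a ∈ Icc a b := left_mem_Icc.2 (hx.1.trans hx.2)
  have h := intervalIntegral.integral_add_adjacent_intervals
    (hu.intervalIntegrable ha hx) (hu.intervalIntegrable hx hy)
  linarith [hu.sub_eq x hx, hu.sub_eq y hy]

lemma IsPrimitiveOn.mono {u u' : ℝ → ℝ} {a b x y : ℝ} (hu : IsPrimitiveOn u u' a b)
    (hx : x ∈ Icc a b) (hy : y ∈ Icc a b) : IsPrimitiveOn u u' x y :=
  ⟨hu.intervalIntegrable hx hy, fun _ ht =>
    hu.sub_eq_integral hx ⟨hx.1.trans ht.1, ht.2.trans hy.2⟩⟩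

/-- A continuous function with a derivative off a countable set is a primitive of it. -/
lemma isPrimitiveOn_of_hasDerivAt {u u' : ℝ → ℝ} {a b : ℝ} {s : Set ℝ} (hs : s.Countable)
    (hc : ContinuousOn u (Icc a b)) (hd : ∀ x ∈ Ioo a b \ s, HasDerivAt u (u' x) x)
    (hi : IntervalIntegrable u' volume a b) : IsPrimitiveOn u u' a b := by
  refine ⟨hi, fun t ht => ?_⟩
  have hab := ht.1.trans ht.2
  refine (integral_eq_of_hasDerivAt_off_countable_of_le u u' ht.1 hs
    (hc.mono (Icc_subset_Icc_right ht.2)) (fun x hx => hd x ⟨⟨hx.1.1, hx.1.2.trans_le ht.2⟩, hx.2⟩)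
    (hi.mono_set ?_)).symm
  rw [uIcc_of_le hab, uIcc_of_le ht.1]
  exact Icc_subset_Icc_right ht.2

lemma IsPrimitiveOn.congr {u u' v v' : ℝ → ℝ} {a b : ℝ} (hu : IsPrimitiveOn u u' a b)
    (hab : a ≤ b) (h : ∀ t ∈ Icc a b, u t = v t) (h' : ∀ t ∈ Icc a b, u' t = v' t) :
    IsPrimitiveOn v v' a b := by
  refine ⟨hu.integrable.congr_ae ?_, fun t ht => ?_⟩
  · refine (ae_restrict_mem measurableSet_uIoc).mono fun x hx => ?_
    rw [uIoc_of_le hab] at hx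
    exact h' x ⟨hx.1.le, hx.2⟩
  · rw [← h t ht, ← h a (left_mem_Icc.2 hab), hu.sub_eq t ht]
    refine intervalIntegral.integral_congr fun x hx => ?_
    rw [uIcc_of_le ht.1] at hx
    exact h' x ⟨hx.1, hx.2.trans ht.2⟩

/-- The product rule. -/
lemma IsPrimitiveOn.mul {u u' v v' : ℝ → ℝ} {a b : ℝ} (hu : IsPrimitiveOn u u' a b)
    (hv : IsPrimitiveOn v v' a b) (hab : a ≤ b) :
    IsPrimitiveOn (fun t => u t * v t) (fun t => u' t * v t + u t * v' t) a b := by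
  -- The hypothesis says nothing outside `[a, b]`. Hence `w` is replaced by the integral function
  -- that it equals on `[a, b]`: this one is absolutely continuous, and differentiable almost
  -- everywhere by Lebesgue's theorem.
  have key : ∀ {w w' : ℝ → ℝ}, IsPrimitiveOn w w' a b → ∃ z : ℝ → ℝ, EqOn z w (Icc a b) ∧
      AbsolutelyContinuousOnInterval z a b ∧ ∀ᵐ x, x ∈ Ioc a b → HasDerivAt z (w' x) x := by
    intro w w' hw
    refine ⟨fun t => w a + ∫ x in a..t, w' x, fun t ht => ?_, ?_, ?_⟩
    · simp only [← hw.sub_eq t ht]; ring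
    · exact ((LipschitzWith.const (w a)).lipschitzOnWith.absolutelyContinuousOnInterval).fun_add
        (hw.integrable.absolutelyContinuousOnInterval_intervalIntegral (by simp))
    · filter_upwards [hw.integrable.ae_hasDerivAt_integral] with x hx hx'
      exact (hx (by rw [uIcc_of_le hab]; exact Ioc_subset_Icc_self hx') a (by simp)).const_add (w a)
  obtain ⟨y, hy0, hy1, hy2⟩ := key hu
  obtain ⟨z, hz0, hz1, hz2⟩ := key hv
  have hac := hy1.fun_mul hz1
  have hder : ∀ᵐ x, x ∈ Ioc a b → deriv (fun t => y t * z t) x = u' x * v x + u x * v' x := by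
    filter_upwards [hy2, hz2] with x h1 h2 hx
    rw [((h1 hx).fun_mul (h2 hx)).deriv, hy0 (Ioc_subset_Icc_self hx), hz0 (Ioc_subset_Icc_self hx)]
  refine ⟨?_, fun t ht => ?_⟩
  · refine hac.intervalIntegrable_deriv.congr_ae ?_
    rw [uIoc_of_le hab]
    exact (ae_restrict_iff' measurableSet_Ioc).2 hder
  · have hac' : AbsolutelyContinuousOnInterval (fun t => y t * z t) a t := hac.mono (by
      rw [uIcc_of_le hab, uIcc_of_le ht.1]; exact Icc_subset_Icc_right ht.2)
    rw [← hy0 ht, ← hz0 ht, ← hy0 (left_mem_Icc.2 hab), ← hz0 (left_mem_Icc.2 hab),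
      ← hac'.integral_deriv_eq_sub]
    refine intervalIntegral.integral_congr_ae ?_
    filter_upwards [hder] with x hx hx'
    rw [uIoc_of_le ht.1] at hx'
    exact hx ⟨hx'.1, hx'.2.trans ht.2⟩


/-! ### Straightening the characteristics into lines of the plane -/

/-- The distance of the point `(t, E)` of the plane from the origin. -/
def rad (t E : ℝ) : ℝ := √(t ^ 2 + E ^ 2)

/-- The function `u(η, φ)` in the coordinates `t = -(A - η) sin φ`, `E = (A - η) cos φ` of the
plane, in which the characteristics are the lines `E = const`. -/
def planar (A : ℝ) (u : ℝ → ℝ → ℝ) (t E : ℝ) : ℝ := u (A - rad t E) (Complex.arg ⟨E, -t⟩)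

lemma rad_nonneg (t E : ℝ) : 0 ≤ rad t E := sqrt_nonneg _

lemma rad_sq (t E : ℝ) : rad t E ^ 2 = t ^ 2 + E ^ 2 := sq_sqrt (by positivity)

lemma rad_neg (t E : ℝ) : rad (-t) E = rad t E := by simp [rad]

lemma norm_eq_rad (t E : ℝ) : ‖(⟨E, -t⟩ : ℂ)‖ = rad t E := by
  rw [Complex.norm_def, Complex.normSq_mk, rad]
  congr 1
  ring

lemma continuous_rad : Continuous fun p : ℝ × ℝ => rad p.1 p.2 := by
  unfold rad
  fun_prop

lemma continuous_rad_left (E : ℝ) : Continuous fun t => rad t E := by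
  unfold rad
  fun_prop

lemma measurable_angle : Measurable fun p : ℝ × ℝ => Complex.arg ⟨p.2, -p.1⟩ := by
  refine Complex.measurable_arg.comp ?_
  exact Complex.measurableEquivRealProd.symm.measurable.comp
    (measurable_snd.prodMk measurable_fst.neg)

lemma measurable_planar (A : ℝ) {u : ℝ → ℝ → ℝ} (hu : Measurable (Function.uncurry u)) :
    Measurable fun p : ℝ × ℝ => planar A u p.1 p.2 :=
  hu.comp ((measurable_const.sub continuous_rad.measurable).prodMk measurable_angle)

lemma measurable_planar_left (A : ℝ) {u : ℝ → ℝ → ℝ} (hu : Measurable (Function.uncurry u))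
    (E : ℝ) : Measurable fun t => planar A u t E :=
  (measurable_planar A hu).comp (measurable_id.prodMk measurable_const)

lemma rad_polar {ρ : ℝ} (hρ : 0 ≤ ρ) (φ : ℝ) : rad (-(ρ * sin φ)) (ρ * cos φ) = ρ := by
  rw [rad, show (-(ρ * sin φ)) ^ 2 + (ρ * cos φ) ^ 2 = ρ ^ 2 * (sin φ ^ 2 + cos φ ^ 2) by ring,
    sin_sq_add_cos_sq, mul_one, sqrt_sq hρ]

/-- `Complex.arg` returns the representative of the angle in `(-π, π]`, so periodicity is what makes
`planar` independent of the choice of `φ`. -/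
lemma planar_polar {A η : ℝ} {u : ℝ → ℝ → ℝ} (hη : η < A)
    (hu : Function.Periodic (u η) (2 * π)) (φ : ℝ) :
    planar A u (-((A - η) * sin φ)) ((A - η) * cos φ) = u η φ := by
  have hρ : 0 < A - η := sub_pos.2 hη
  rw [planar, rad_polar hρ.le, sub_sub_cancel]
  have h : (⟨(A - η) * cos φ, - -((A - η) * sin φ)⟩ : ℂ)
      = ((A - η : ℝ) : ℂ) * (Complex.cos φ + Complex.sin φ * Complex.I) := by
    apply Complex.ext <;> simp [← Complex.ofReal_cos, ← Complex.ofReal_sin, -Complex.ofReal_sub]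
  rw [h, Complex.arg_mul_cos_add_sin_mul_I_eq_toIocMod hρ, toIocMod]
  exact hu.sub_zsmul_eq _

lemma rad_mul_cos_arg {t E : ℝ} (h : 0 < rad t E) : rad t E * cos (Complex.arg ⟨E, -t⟩) = E := by
  rw [Complex.cos_arg, norm_eq_rad]
  · field_simp
  · rw [← norm_ne_zero_iff, norm_eq_rad]
    exact h.ne'

lemma rad_mul_sin_arg {t E : ℝ} (h : 0 < rad t E) : rad t E * sin (Complex.arg ⟨E, -t⟩) = -t := by
  rw [Complex.sin_arg, norm_eq_rad]
  field_simp

/-- The points of the annulus in polar coordinates. -/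
lemma exists_polar {t E : ℝ} (h : 0 < rad t E) :
    ∃ φ ∈ Ioc (-π) π, t = -(rad t E * sin φ) ∧ E = rad t E * cos φ :=
  ⟨_, Complex.arg_mem_Ioc _, by rw [rad_mul_sin_arg h, neg_neg], (rad_mul_cos_arg h).symm⟩

lemma hasDerivAt_rad {t E : ℝ} (h : 0 < rad t E) :
    HasDerivAt (fun t => rad t E) (t / rad t E) t := by
  have h1 : HasDerivAt (fun t : ℝ => t ^ 2 + E ^ 2) (2 * t) t := by
    simpa using (hasDerivAt_pow 2 t).add_const (E ^ 2)
  convert! h1.sqrt (sqrt_pos.1 h).ne' using 1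
  rw [rad]
  field_simp

/-- Measurable functions on `[0, L] × ℝ` that are bounded and `2π`-periodic in the angle. -/
structure Admissible (L : ℝ) (u : ℝ → ℝ → ℝ) : Prop where
  measurable : Measurable (Function.uncurry u)
  periodic : ∀ η ∈ Icc 0 L, Function.Periodic (u η) (2 * π)
  bounded : ∃ M, ∀ η ∈ Icc 0 L, ∀ φ, |u η φ| ≤ M

/-- `V` has the derivative `W` along the characteristics, which are followed as lines in the
plane. -/
def AlongLines (A L : ℝ) (V W : ℝ → ℝ → ℝ) : Prop :=
  ∀ E t₁ t₂, t₁ ≤ t₂ → (∀ t ∈ Icc t₁ t₂, rad t E ∈ Icc (A - L) A) →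
    planar A V t₂ E - planar A V t₁ E = ∫ t in t₁..t₂, planar A W t E

lemma Admissible.planar_le {A L M t E : ℝ} {u : ℝ → ℝ → ℝ}
    (hM : ∀ η ∈ Icc 0 L, ∀ φ, |u η φ| ≤ M) (h : rad t E ∈ Icc (A - L) A) :
    |planar A u t E| ≤ M :=
  hM _ ⟨by linarith [h.2], by linarith [h.1]⟩ _

lemma intervalIntegrable_of_bounded {u : ℝ → ℝ} {a b M : ℝ} (hu : Measurable u) (hab : a ≤ b)
    (hM : ∀ t ∈ Icc a b, |u t| ≤ M) : IntervalIntegrable u volume a b := by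
  rw [intervalIntegrable_iff_integrableOn_Icc_of_le hab]
  refine Measure.integrableOn_of_bounded (M := M) (by simp) hu.aestronglyMeasurable ?_
  exact (ae_restrict_iff' measurableSet_Icc).2 (.of_forall hM)

lemma Admissible.intervalIntegrable_planar {A L E t₁ t₂ : ℝ} {u : ℝ → ℝ → ℝ}
    (hu : Admissible L u) (ht : t₁ ≤ t₂) (h : ∀ t ∈ Icc t₁ t₂, rad t E ∈ Icc (A - L) A) :
    IntervalIntegrable (fun t => planar A u t E) volume t₁ t₂ := by
  obtain ⟨M, hM⟩ := hu.bounded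
  exact intervalIntegrable_of_bounded (measurable_planar_left A hu.measurable E) ht
    fun t h' => Admissible.planar_le hM (h t h')

lemma AlongLines.isPrimitiveOn {A L E t₁ t₂ : ℝ} {V W : ℝ → ℝ → ℝ} (h : AlongLines A L V W)
    (hW : Admissible L W) (ht : t₁ ≤ t₂) (hr : ∀ t ∈ Icc t₁ t₂, rad t E ∈ Icc (A - L) A) :
    IsPrimitiveOn (fun t => planar A V t E) (fun t => planar A W t E) t₁ t₂ :=
  ⟨hW.intervalIntegrable_planar ht hr, fun t h' =>
    h E t₁ t h'.1 fun s hs => hr s ⟨hs.1, hs.2.trans h'.2⟩⟩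

lemma AlongLines.mul {A L : ℝ} {V W V' W' : ℝ → ℝ → ℝ} (h : AlongLines A L V W)
    (h' : AlongLines A L V' W') (hW : Admissible L W) (hW' : Admissible L W') :
    AlongLines A L (fun η φ => V η φ * V' η φ)
      (fun η φ => W η φ * V' η φ + V η φ * W' η φ) := by
  intro E t₁ t₂ ht hr
  exact ((h.isPrimitiveOn hW ht hr).mul (h'.isPrimitiveOn hW' ht hr) ht).sub_eq t₂
    (right_mem_Icc.2 ht)

lemma AlongLines.sub_const {A L : ℝ} {V W : ℝ → ℝ → ℝ} (h : AlongLines A L V W) (c : ℝ) :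
    AlongLines A L (fun η φ => V η φ - c) W := by
  intro E t₁ t₂ ht hr
  rw [← h E t₁ t₂ ht hr]
  simp only [planar]
  ring

/-- The derivative along the characteristics of a differentiable function. -/
lemma alongLines_of_hasDerivAt {A L : ℝ} {V W : ℝ → ℝ → ℝ} (hW : Admissible L W)
    (h : ∀ t E, rad t E ∈ Icc (A - L) A →
      HasDerivAt (fun t => planar A V t E) (planar A W t E) t) : AlongLines A L V W := by
  intro E t₁ t₂ ht hr
  refine (isPrimitiveOn_of_hasDerivAt (u := fun t => planar A V t E) countable_empty ?_ ?_
    (hW.intervalIntegrable_planar ht hr)).sub_eq t₂ (right_mem_Icc.2 ht)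
  · exact fun t h' => (h t E (hr t h')).continuousAt.continuousWithinAt
  · exact fun t h' => h t E (hr t (Ioo_subset_Icc_self h'.1))

lemma force_eq {ε : ℝ} (R η : ℝ) (hε : 0 < ε) : force ε R η = -(1 / (R / ε - η)) := by
  rw [force]
  congr 1
  rw [show R - ε * η = ε * (R / ε - η) by field_simp]
  field_simp

/-- The characteristics are lines in the plane. -/
lemma IsCharacteristic.exists_line {ε R a b : ℝ} {X Φ : ℝ → ℝ} (hε : 0 < ε)
    (hL : len ε < R / ε) (h : IsCharacteristic ε R a b X Φ) :
    ∃ E t₀, ∀ s ∈ Icc a b, -((R / ε - X s) * sin (Φ s)) = t₀ + s ∧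
      (R / ε - X s) * cos (Φ s) = E := by
  have hf : ∀ η, force ε R η = -(1 / (R / ε - η)) := fun η => force_eq R η hε
  generalize R / ε = A at hL hf ⊢
  have hpos : ∀ s ∈ Icc a b, 0 < A - X s := fun s hs => by linarith [(h.mem s hs).2]
  have hconst : ∀ w : ℝ → ℝ, (∀ s ∈ Icc a b, HasDerivWithinAt w 0 (Icc a b) s) →
      ∀ s ∈ Icc a b, w s = w a := by
    intro w hw
    refine constant_of_has_deriv_right_zero (fun s hs => (hw s hs).continuousWithinAt) ?_
    intro s hs
    exact ((hw s (Ico_subset_Icc_self hs)).mono_of_mem_nhdsWithin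
      (Icc_mem_nhdsGE_of_mem hs))
  -- The first conserved quantity expresses unit speed along the line, the second is the angular
  -- momentum.
  have h1 := hconst (fun s => -((A - X s) * sin (Φ s)) - s) (fun s hs => by
    have h1 := ((((h.deriv_space s hs).const_sub A).mul (h.deriv_angle s hs).sin).neg).sub
      (hasDerivWithinAt_id s (Icc a b))
    convert! h1 using 1
    rw [hf]
    have := (hpos s hs).ne'
    field_simp
    linear_combination (-1) * sin_sq_add_cos_sq (Φ s))
  have h2 := hconst (fun s => (A - X s) * cos (Φ s)) (fun s hs => by
    have h1 := ((h.deriv_space s hs).const_sub A).mul (h.deriv_angle s hs).cos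
    convert! h1 using 1
    rw [hf]
    have := (hpos s hs).ne'
    field_simp
    ring)
  exact ⟨_, -((A - X a) * sin (Φ a)) - a, fun s hs => ⟨by linarith [h1 s hs], h2 s hs⟩⟩

/-- Every line segment in the annulus is a characteristic. -/
lemma exists_isCharacteristic {ε R E t₁ t₂ : ℝ} (hε : 0 < ε) (hL : len ε < R / ε)
    (hr : ∀ t ∈ Icc t₁ t₂, rad t E ∈ Icc (R / ε - len ε) (R / ε)) :
    ∃ Φ : ℝ → ℝ, IsCharacteristic ε R t₁ t₂ (fun t => R / ε - rad t E) Φ ∧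
      ∀ t ∈ Icc t₁ t₂, t = -(rad t E * sin (Φ t)) ∧ E = rad t E * cos (Φ t) := by
  have hpos : ∀ t ∈ Icc t₁ t₂, 0 < rad t E := fun t ht => by linarith [(hr t ht).1]
  rcases lt_or_ge t₂ t₁ with h12 | h12
  · exact ⟨0, ⟨by simp [Icc_eq_empty h12.not_ge], by simp [Icc_eq_empty h12.not_ge],
      by simp [Icc_eq_empty h12.not_ge]⟩, by simp [Icc_eq_empty h12.not_ge]⟩
  set z : ℝ → ℂ := fun t => ⟨E, -t⟩ with hz
  have hnz : ∀ t ∈ Icc t₁ t₂, z t ≠ 0 := fun t ht => by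
    rw [← norm_ne_zero_iff, norm_eq_rad]
    exact (hpos t ht).ne'
  have h1 := left_mem_Icc.2 h12
  -- A segment that avoids the origin turns by less than `π`. If the ratio were real and
  -- nonpositive, the two points would lie on opposite rays of a line through the origin; then `E =
  -- 0`, and the segment would contain the origin.
  have hslit : ∀ t ∈ Icc t₁ t₂, z t / z t₁ ∈ Complex.slitPlane := by
    intro t ht
    rw [Complex.mem_slitPlane_iff]
    by_contra! hcon
    have hmul : z t = z t / z t₁ * z t₁ := (div_mul_cancel₀ _ (hnz t₁ h1)).symm
    have hre := congrArg Complex.re hmul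
    have him := congrArg Complex.im hmul
    rw [Complex.mul_re, hcon.2] at hre
    rw [Complex.mul_im, hcon.2] at him
    simp only [hz, zero_mul, sub_zero, add_zero] at hre him hcon
    generalize ((⟨E, -t⟩ : ℂ) / ⟨E, -t₁⟩).re = l at hre him hcon
    have hE : E = 0 := by
      have h0 : E * (1 - l) = 0 := by linarith
      rcases mul_eq_zero.1 h0 with h | h
      · exact h
      · linarith [hcon.1]
    have ht1 : t₁ ≤ 0 := by
      by_contra! h
      nlinarith [ht.1, hcon.1]
    have h0 := hpos 0 ⟨ht1, le_trans (by nlinarith [hcon.1]) ht.2⟩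
    simp [rad, hE] at h0
  have hzd : ∀ t, HasDerivAt z (-Complex.I) t := by
    intro t
    have h2 : z = fun t : ℝ => (E : ℂ) - t * Complex.I := by
      funext t
      apply Complex.ext <;> simp [hz]
    rw [h2]
    simpa using ((Complex.ofRealCLM.hasDerivAt (x := t)).mul_const Complex.I).const_sub (E : ℂ)
  -- A smooth branch of the angle along the segment: `Complex.arg (z t)` may jump across the
  -- negative axis, whereas the logarithm of the ratio stays in the slit plane.
  refine ⟨fun t => Complex.arg (z t₁) + (Complex.log (z t / z t₁)).im, ?_⟩
  have key : ∀ t ∈ Icc t₁ t₂,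
      t = -(rad t E * sin (Complex.arg (z t₁) + (Complex.log (z t / z t₁)).im)) ∧
      E = rad t E * cos (Complex.arg (z t₁) + (Complex.log (z t / z t₁)).im) := by
    intro t ht
    have hexp : (rad t E : ℂ) * Complex.exp (((Complex.arg (z t₁)
        + (Complex.log (z t / z t₁)).im : ℝ) : ℂ) * Complex.I) = z t := by
      have h2 := Complex.norm_mul_exp_arg_mul_I (z t₁)
      have h3 := Complex.norm_mul_exp_arg_mul_I (z t / z t₁)
      rw [Complex.log_im]
      push_cast
      rw [add_mul, Complex.exp_add, ← norm_eq_rad]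
      have h4 : ‖z t‖ = ‖z t / z t₁‖ * ‖z t₁‖ := by
        rw [norm_div, div_mul_cancel₀ _ (norm_ne_zero_iff.2 (hnz t₁ h1))]
      change (‖z t‖ : ℂ) * _ = _
      rw [h4]
      push_cast
      calc _ = (‖z t₁‖ * Complex.exp (Complex.arg (z t₁) * Complex.I)) *
            (‖z t / z t₁‖ * Complex.exp (Complex.arg (z t / z t₁) * Complex.I)) := by ring
        _ = z t := by rw [h2, h3, mul_div_cancel₀ _ (hnz t₁ h1)]
    have hre := congrArg Complex.re hexp
    have him := congrArg Complex.im hexp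
    rw [Complex.re_ofReal_mul, Complex.exp_ofReal_mul_I_re] at hre
    rw [Complex.im_ofReal_mul, Complex.exp_ofReal_mul_I_im] at him
    exact ⟨by rw [him]; simp [hz], hre.symm⟩
  refine ⟨⟨fun t ht => ?_, fun t ht => ?_, fun t ht => ?_⟩, key⟩
  · exact ⟨by linarith [(hr t ht).2], by linarith [(hr t ht).1]⟩
  · have h2 := (hasDerivAt_rad (hpos t ht)).const_sub (R / ε)
    convert! h2.hasDerivWithinAt using 1
    have := hpos t ht
    field_simp
    linarith [(key t ht).1]
  · have h2 := (Complex.imCLM.hasFDerivAt.comp_hasDerivAt t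
      (((hzd t).div_const (z t₁)).clog_real (hslit t ht))).const_add (Complex.arg (z t₁))
    convert! h2.hasDerivWithinAt using 1
    have hE := (key t ht).2
    have hr0 := hpos t ht
    -- The derivative of `log z` is `z' / z` with `z' = -i`; its imaginary part is `-E / rad²`,
    -- which is the force times `cos Φ`.
    have h3 : -Complex.I / z t₁ / (z t / z t₁) = -Complex.I / z t := by
      have := hnz t₁ h1
      have := hnz t ht
      field_simp
    have h4 : (-Complex.I / z t).im = -(E / rad t E ^ 2) := by
      rw [Complex.div_im, Complex.normSq_eq_norm_sq, norm_eq_rad]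
      simp [hz]
      ring
    rw [h3, Complex.imCLM_apply, h4, force_eq R _ hε, sub_sub_cancel]
    have hc : cos (Complex.arg (z t₁) + (Complex.log (z t / z t₁)).im) = E / rad t E := by
      rw [eq_div_iff hr0.ne']
      linarith
    rw [hc]
    field_simp


/-! ### Chords, optical depth and integration along lines -/

lemma rad_le_iff {t E ρ : ℝ} (hρ : 0 ≤ ρ) (hE : |E| ≤ ρ) : rad t E ≤ ρ ↔ |t| ≤ √(ρ ^ 2 - E ^ 2) := by
  have h1 : E ^ 2 ≤ ρ ^ 2 := sq_le_sq.2 (by rwa [abs_of_nonneg hρ])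
  rw [rad, sqrt_le_left hρ, le_sqrt (abs_nonneg t) (sub_nonneg.2 h1), sq_abs]
  constructor <;> intro h <;> linarith

lemma le_rad_iff {t E ρ : ℝ} (hρ : 0 ≤ ρ) : ρ ≤ rad t E ↔ √(ρ ^ 2 - E ^ 2) ≤ |t| := by
  rw [rad, le_sqrt hρ (by positivity), sqrt_le_left (abs_nonneg t), sq_abs]
  constructor <;> intro h <;> linarith

lemma abs_le_of_rad_le {t E ρ : ℝ} (h : rad t E ≤ ρ) : |E| ≤ ρ := by
  refine le_trans ?_ h
  rw [rad, ← sqrt_sq_eq_abs]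
  exact sqrt_le_sqrt (by nlinarith)

/-- Half the length of the chord at height `E` of the circle of radius `ρ`, and `0` if there is
none. -/
def chord (ρ E : ℝ) : ℝ := √(ρ ^ 2 - E ^ 2)

lemma chord_nonneg (ρ E : ℝ) : 0 ≤ chord ρ E := sqrt_nonneg _

lemma chord_le {ρ : ℝ} (hρ : 0 ≤ ρ) (E : ℝ) : chord ρ E ≤ ρ := by
  rw [chord, sqrt_le_left hρ]
  nlinarith

lemma chord_mono {ρ ρ' : ℝ} (hρ : 0 ≤ ρ) (h : ρ ≤ ρ') (E : ℝ) : chord ρ E ≤ chord ρ' E :=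
  sqrt_le_sqrt (by nlinarith)

lemma measurable_chord (ρ : ℝ) : Measurable (chord ρ) := by
  unfold chord
  fun_prop

lemma rad_chord {ρ E : ℝ} (hρ : 0 ≤ ρ) (hE : |E| ≤ ρ) : rad (chord ρ E) E = ρ := by
  have h1 : E ^ 2 ≤ ρ ^ 2 := sq_le_sq.2 (by rwa [abs_of_nonneg hρ])
  rw [rad, chord, sq_sqrt (by linarith), sub_add_cancel, sqrt_sq hρ]

/-- The part of a line in the annulus consists of two symmetric pieces that the inner chord
separates. They touch at `t = 0` when the line misses the interior of the inner disc, where `chord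
(A - L) E = 0`. -/
lemma mem_annulus_iff {A L t E : ℝ} (hL : 0 ≤ L) (hA : L < A) (hE : |E| ≤ A) :
    rad t E ∈ Icc (A - L) A ↔ chord (A - L) E ≤ |t| ∧ |t| ≤ chord A E := by
  rw [mem_Icc, le_rad_iff (by linarith), rad_le_iff (by linarith) hE]
  rfl

/-- The signed length of the part of `[0, t]` outside the chord at height `E` of the circle of
radius `ρ`. -/
def depth (ρ t E : ℝ) : ℝ := max (t - chord ρ E) 0 + min (t + chord ρ E) 0

lemma depth_of_le {ρ t E : ℝ} (h : chord ρ E ≤ t) : depth ρ t E = t - chord ρ E := by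
  rw [depth, max_eq_left (by linarith), min_eq_right (by linarith [chord_nonneg ρ E]), add_zero]

lemma depth_of_le_neg {ρ t E : ℝ} (h : t ≤ -chord ρ E) : depth ρ t E = t + chord ρ E := by
  rw [depth, max_eq_right (by linarith [chord_nonneg ρ E]), min_eq_left (by linarith), zero_add]

lemma depth_of_abs_le {ρ t E : ℝ} (h : |t| ≤ chord ρ E) : depth ρ t E = 0 := by
  rw [abs_le] at h
  rw [depth, max_eq_right (by linarith), min_eq_right (by linarith), add_zero]

lemma continuous_depth (ρ E : ℝ) : Continuous fun t => depth ρ t E := by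
  unfold depth
  fun_prop

lemma measurable_depth (ρ : ℝ) : Measurable fun p : ℝ × ℝ => depth ρ p.1 p.2 := by
  unfold depth
  have := measurable_chord ρ
  fun_prop

lemma depth_mono (ρ E : ℝ) : Monotone fun t => depth ρ t E := fun s t h => by
  change max _ _ + min _ _ ≤ max _ _ + min _ _
  gcongr

lemma abs_depth_le (ρ t E : ℝ) : |depth ρ t E| ≤ |t| := by
  rcases le_total |t| (chord ρ E) with h | h
  · rw [depth_of_abs_le h, abs_zero]
    exact abs_nonneg t
  · have h0 := chord_nonneg ρ E
    rcases le_abs'.1 h with h' | h'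
    · rw [depth_of_le_neg h', abs_of_nonpos (by linarith), abs_of_nonpos (by linarith)]
      linarith
    · rw [depth_of_le h', abs_of_nonneg (by linarith), abs_of_nonneg (by linarith)]
      linarith

/-- The indicator function of the annulus. -/
def ann (A L t E : ℝ) : ℝ := (Icc (A - L) A).indicator 1 (rad t E)

lemma ann_of_mem {A L t E : ℝ} (h : rad t E ∈ Icc (A - L) A) : ann A L t E = 1 := by
  simp [ann, h]

lemma ann_of_notMem {A L t E : ℝ} (h : rad t E ∉ Icc (A - L) A) : ann A L t E = 0 :=
  indicator_of_notMem h _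

lemma ann_nonneg (A L t E : ℝ) : 0 ≤ ann A L t E :=
  indicator_nonneg (by simp) _

lemma measurable_ann (A L : ℝ) : Measurable fun p : ℝ × ℝ => ann A L p.1 p.2 :=
  (measurable_const.indicator measurableSet_Icc).comp continuous_rad.measurable

lemma measurable_ann_left (A L E : ℝ) : Measurable fun t => ann A L t E :=
  (measurable_ann A L).comp (measurable_id.prodMk measurable_const)

lemma abs_ann_mul_planar_le {A L M : ℝ} {u : ℝ → ℝ → ℝ} (hM0 : 0 ≤ M)
    (hM : ∀ η ∈ Icc 0 L, ∀ φ, |u η φ| ≤ M) (t E : ℝ) :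
    |ann A L t E * planar A u t E| ≤ M := by
  by_cases h : rad t E ∈ Icc (A - L) A
  · rw [ann_of_mem h, one_mul]
    exact Admissible.planar_le hM h
  · rw [ann_of_notMem h, zero_mul, abs_zero]
    exact hM0

lemma Admissible.exists_bound {L : ℝ} {u : ℝ → ℝ → ℝ} (hu : Admissible L u) :
    ∃ M, 0 ≤ M ∧ ∀ η ∈ Icc 0 L, ∀ φ, |u η φ| ≤ M := by
  obtain ⟨M, hM⟩ := hu.bounded
  exact ⟨|M|, abs_nonneg M, fun η hη φ => (hM η hη φ).trans (le_abs_self M)⟩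

/-- Integrability of an attenuated source along a line. -/
lemma Admissible.intervalIntegrable_ann {A L E k a b : ℝ} {u : ℝ → ℝ → ℝ} (hu : Admissible L u)
    (ρ : ℝ) : IntervalIntegrable
      (fun s => exp (k * depth ρ s E) * (ann A L s E * planar A u s E)) volume a b := by
  obtain ⟨M, hM0, hM⟩ := hu.exists_bound
  refine IntervalIntegrable.continuousOn_mul ?_ (Continuous.continuousOn ?_)
  · rw [intervalIntegrable_iff]
    refine Measure.integrableOn_of_bounded (M := M) (by simp) ?_
      (.of_forall fun s => abs_ann_mul_planar_le hM0 hM s E)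
    exact ((measurable_ann_left A L E).mul
      (measurable_planar_left A hu.measurable E)).aestronglyMeasurable
  · have := continuous_depth ρ E
    fun_prop

lemma admissible_const (L c : ℝ) : Admissible L fun _ _ => c :=
  ⟨measurable_const, fun _ _ => fun _ => rfl, |c|, fun _ _ _ => le_rfl⟩

/-- Along a line `depth` has slope `1` in the annulus and slope `0` in the void, so its derivative
is `ann` except at the two kinks `±chord (A - L) E`. This makes `exp (k * depth)` the integrating
factor. -/
lemma isPrimitiveOn_exp_depth {A L E : ℝ} (hL : 0 ≤ L) (hA : L < A) (hE : |E| ≤ A) (k : ℝ) :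
    IsPrimitiveOn (fun t => exp (k * depth (A - L) t E))
      (fun t => k * (exp (k * depth (A - L) t E) * ann A L t E)) (-chord A E) (chord A E) := by
  refine isPrimitiveOn_of_hasDerivAt (s := {chord (A - L) E, -chord (A - L) E})
    (by simp) ?_ ?_ ?_
  · have := continuous_depth (A - L) E
    fun_prop
  · rintro t ⟨ht, hs⟩
    simp only [mem_insert_iff, mem_singleton_iff, not_or] at hs
    have hd : HasDerivAt (fun t => depth (A - L) t E) (ann A L t E) t := by
      have hle : |t| ≤ chord A E := abs_le.2 ⟨ht.1.le, ht.2.le⟩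
      rcases lt_or_ge |t| (chord (A - L) E) with h | h
      · rw [ann_of_notMem (fun hm => by linarith [((mem_annulus_iff hL hA hE).1 hm).1])]
        refine (hasDerivAt_const t (0 : ℝ)).congr_of_eventuallyEq ?_
        filter_upwards [Ioo_mem_nhds (abs_lt.1 h).1 (abs_lt.1 h).2] with s hs
        exact depth_of_abs_le (abs_le.2 ⟨hs.1.le, hs.2.le⟩)
      · rw [ann_of_mem ((mem_annulus_iff hL hA hE).2 ⟨h, hle⟩)]
        rcases le_abs'.1 h with h' | h'
        · refine ((hasDerivAt_id t).add_const (chord (A - L) E)).congr_of_eventuallyEq ?_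
          filter_upwards [Iio_mem_nhds (lt_of_le_of_ne h' hs.2)] with s hs
          exact depth_of_le_neg (le_of_lt hs)
        · refine ((hasDerivAt_id t).sub_const (chord (A - L) E)).congr_of_eventuallyEq ?_
          filter_upwards [Ioi_mem_nhds (lt_of_le_of_ne h' (Ne.symm hs.1))] with s hs
          exact depth_of_le (le_of_lt hs)
    convert! (hd.const_mul k).exp using 1
    ring
  · have h := (admissible_const L 1).intervalIntegrable_ann (A := A) (E := E) (k := k)
      (a := -chord A E) (b := chord A E) (A - L)
    simp only [planar, mul_one] at h
    exact h.const_mul k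

/-- The solution of the transport equation with source `u - f` along the lines of the plane that
takes the value `h` at the outer circle. The inner disc is void. -/
def mild (A L : ℝ) (h : ℝ → ℝ) (u : ℝ → ℝ → ℝ) (t E : ℝ) : ℝ :=
  exp (-depth (A - L) t E) * (exp (depth (A - L) (-chord A E) E) * h (arccos (E / A))
    + ∫ s in Ioc (-chord A E) t, exp (depth (A - L) s E) * (ann A L s E * planar A u s E))

lemma measurable_mild (A L : ℝ) {h : ℝ → ℝ} {u : ℝ → ℝ → ℝ} (hh : Measurable h)
    (hu : Measurable (Function.uncurry u)) :
    Measurable fun p : ℝ × ℝ => mild A L h u p.1 p.2 := by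
  have hd := measurable_depth (A - L)
  have hc := measurable_chord A
  have h1 : Measurable fun p : ℝ × ℝ => depth (A - L) (-chord A p.2) p.2 :=
    hd.comp ((hc.comp measurable_snd).neg.prodMk measurable_snd)
  have h2 : Measurable fun p : ℝ × ℝ => ∫ s in Ioc (-chord A p.2) p.1,
      exp (depth (A - L) s p.2) * (ann A L s p.2 * planar A u s p.2) := by
    have hset : MeasurableSet {z : (ℝ × ℝ) × ℝ | z.2 ∈ Ioc (-chord A z.1.2) z.1.1} :=
      (measurableSet_lt (hc.comp (measurable_snd.comp measurable_fst)).neg measurable_snd).inter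
        (measurableSet_le measurable_snd (measurable_fst.comp measurable_fst))
    have hpr : Measurable fun z : (ℝ × ℝ) × ℝ => (z.2, z.1.2) :=
      measurable_snd.prodMk (measurable_snd.comp measurable_fst)
    have hint : Measurable fun z : (ℝ × ℝ) × ℝ => exp (depth (A - L) z.2 z.1.2) *
        (ann A L z.2 z.1.2 * planar A u z.2 z.1.2) :=
      (measurable_exp.comp (hd.comp hpr)).mul
        (((measurable_ann A L).comp hpr).mul ((measurable_planar A hu).comp hpr))
    have := (hint.indicator hset).stronglyMeasurable.integral_prod_right' (ν := volume)
    convert! this.measurable using 2 with p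
    rw [← integral_indicator measurableSet_Ioc]
    rfl
  unfold mild
  exact (measurable_exp.comp hd.neg).mul (((measurable_exp.comp h1).mul
    (hh.comp (measurable_arccos.comp (measurable_snd.div_const A)))).add h2)

/-- `mild` is defined with an integral over `Ioc`, whose indicator is jointly measurable in `(t,
E)`. On the chord this is the interval integral, which has a calculus. -/
lemma mild_eq {A L t E : ℝ} {h : ℝ → ℝ} {u : ℝ → ℝ → ℝ} (ht : -chord A E ≤ t) :
    mild A L h u t E = exp (-depth (A - L) t E) *
      (exp (depth (A - L) (-chord A E) E) * h (arccos (E / A))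
      + ∫ s in (-chord A E)..t, exp (depth (A - L) s E) * (ann A L s E * planar A u s E)) := by
  rw [mild, intervalIntegral.integral_of_le ht]

/-- Variation of constants: the product rule for the integrating factor and the integrated source.
-/
lemma isPrimitiveOn_mild {A L E : ℝ} (hL : 0 ≤ L) (hA : L < A) (hE : |E| ≤ A) (h : ℝ → ℝ)
    {u : ℝ → ℝ → ℝ} (hu : Admissible L u) :
    IsPrimitiveOn (fun t => mild A L h u t E)
      (fun t => ann A L t E * (planar A u t E - mild A L h u t E))
      (-chord A E) (chord A E) := by
  have hb := chord_nonneg A E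
  have h1 := isPrimitiveOn_exp_depth hL hA hE (-1)
  have hi := hu.intervalIntegrable_ann (A := A) (E := E) (k := 1)
      (a := -chord A E) (b := chord A E) (A - L)
  simp only [one_mul] at hi
  have h3 : IsPrimitiveOn (fun t => exp (depth (A - L) (-chord A E) E) * h (arccos (E / A))
      + ∫ s in (-chord A E)..t, exp (depth (A - L) s E) * (ann A L s E * planar A u s E))
      (fun s => exp (depth (A - L) s E) * (ann A L s E * planar A u s E))
      (-chord A E) (chord A E) := by
    refine ⟨hi, fun t _ => ?_⟩
    simp
  refine (h1.mul h3 (by linarith)).congr (by linarith) (fun t ht => ?_) (fun t ht => ?_)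
  · rw [mild_eq ht.1, neg_one_mul]
  · have he : exp (-depth (A - L) t E) * exp (depth (A - L) t E) = 1 := by
      rw [← exp_add, neg_add_cancel, exp_zero]
    rw [mild_eq ht.1]
    simp only [neg_one_mul]
    linear_combination (ann A L t E * planar A u t E) * he

/-- An attenuated source of size at most `m` contributes at most `m (1 - e^{-τ})`. -/
lemma abs_integral_attenuated_le {A L t E m k : ℝ} (hL : 0 ≤ L) (hA : L < A) (hE : |E| ≤ A)
    (ht : t ∈ Icc (-chord A E) (chord A E)) (hk : 0 < k) {w : ℝ → ℝ}
    (hw : ∀ s ∈ Icc (-chord A E) t, rad s E ∈ Icc (A - L) A → |w s| ≤ m) :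
    |∫ s in (-chord A E)..t, exp (k * depth (A - L) s E) * (ann A L s E * w s)| ≤
      m / k * (exp (k * depth (A - L) t E) - exp (k * depth (A - L) (-chord A E) E)) := by
  have h1 := isPrimitiveOn_exp_depth hL hA hE k
  have hm : IntervalIntegrable (fun s => m / k * (k * (exp (k * depth (A - L) s E) *
      ann A L s E))) volume (-chord A E) t :=
    (h1.intervalIntegrable (left_mem_Icc.2 (ht.1.trans ht.2)) ht).const_mul _
  rw [h1.sub_eq t ht, ← intervalIntegral.integral_const_mul, ← norm_eq_abs]
  refine intervalIntegral.norm_integral_le_of_norm_le ht.1 (.of_forall fun s hs => ?_) hm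
  have h0 := ann_nonneg A L s E
  rw [norm_eq_abs, abs_mul, abs_mul, abs_exp, abs_of_nonneg h0]
  have : m / k * (k * (exp (k * depth (A - L) s E) * ann A L s E))
      = exp (k * depth (A - L) s E) * (ann A L s E * m) := by
    field_simp
  rw [this]
  refine mul_le_mul_of_nonneg_left ?_ (exp_pos _).le
  by_cases h : rad s E ∈ Icc (A - L) A
  · exact mul_le_mul_of_nonneg_left (hw s (Ioc_subset_Icc_self hs) h) h0
  · simp [ann_of_notMem h]


/-! ### Solutions are integrals along lines -/

lemma len_pos {ε : ℝ} (hε : 0 < ε) : 0 < len ε := inv_pos.2 (sqrt_pos.2 hε)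

lemma IsSolution.admissible {ε R : ℝ} {h : ℝ → ℝ} {S f : ℝ → ℝ → ℝ} (hf : IsSolution ε R h S f) :
    Admissible (len ε) f := ⟨hf.measurable, hf.periodic, hf.bounded⟩

lemma IsData.admissible {L : ℝ} {h : ℝ → ℝ} {S : ℝ → ℝ → ℝ} (hS : IsData L h S) :
    Admissible L S := ⟨hS.measurable_source, hS.periodic_source, hS.bounded_source⟩

lemma measurable_mean {u : ℝ → ℝ → ℝ} (hu : Measurable (Function.uncurry u)) :
    Measurable (mean u) := by
  unfold mean
  refine measurable_const.mul ?_
  simp only [intervalIntegral.integral_of_le (neg_le_self pi_pos.le)]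
  exact (hu.stronglyMeasurable.integral_prod_right'
    (ν := volume.restrict (Ioc (-π) π))).measurable

lemma abs_mean_le_of_ae {u : ℝ → ℝ → ℝ} {η M : ℝ}
    (hM : ∀ᵐ φ, φ ∈ uIoc (-π) π → |u η φ| ≤ M) : |mean u η| ≤ M := by
  have h : ‖∫ φ in (-π)..π, u η φ‖ ≤ M * |π - -π| :=
    intervalIntegral.norm_integral_le_of_norm_le_const_ae hM
  rw [norm_eq_abs, show π - -π = 2 * π by ring, abs_of_pos two_pi_pos] at h
  rw [mean, abs_mul, abs_of_pos (inv_pos.2 two_pi_pos), inv_mul_le_iff₀ two_pi_pos]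
  linarith

lemma abs_mean_le {u : ℝ → ℝ → ℝ} {η M : ℝ} (hM : ∀ φ, |u η φ| ≤ M) : |mean u η| ≤ M :=
  abs_mean_le_of_ae (.of_forall fun φ _ => hM φ)

lemma Admissible.add {L : ℝ} {u v : ℝ → ℝ → ℝ} (hu : Admissible L u) (hv : Admissible L v) :
    Admissible L fun η φ => u η φ + v η φ := by
  refine ⟨hu.measurable.add hv.measurable, fun η hη => (hu.periodic η hη).add (hv.periodic η hη),
    ?_⟩
  obtain ⟨M, hM⟩ := hu.bounded
  obtain ⟨N, hN⟩ := hv.bounded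
  exact ⟨M + N, fun η hη φ => (abs_add_le _ _).trans (add_le_add (hM η hη φ) (hN η hη φ))⟩

lemma Admissible.mul {L : ℝ} {u v : ℝ → ℝ → ℝ} (hu : Admissible L u) (hv : Admissible L v) :
    Admissible L fun η φ => u η φ * v η φ := by
  refine ⟨hu.measurable.mul hv.measurable, fun η hη => (hu.periodic η hη).mul (hv.periodic η hη),
    ?_⟩
  obtain ⟨M, hM⟩ := hu.bounded
  obtain ⟨N, hN⟩ := hv.bounded
  refine ⟨M * N, fun η hη φ => ?_⟩
  rw [abs_mul]
  exact mul_le_mul (hM η hη φ) (hN η hη φ) (abs_nonneg _) ((abs_nonneg _).trans (hM η hη φ))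

lemma Admissible.const_mul {L : ℝ} {u : ℝ → ℝ → ℝ} (hu : Admissible L u) (c : ℝ) :
    Admissible L fun η φ => c * u η φ := (admissible_const L c).mul hu

lemma Admissible.sub {L : ℝ} {u v : ℝ → ℝ → ℝ} (hu : Admissible L u) (hv : Admissible L v) :
    Admissible L fun η φ => u η φ - v η φ := by
  have := hu.add (hv.const_mul (-1))
  simpa [sub_eq_add_neg] using this

lemma admissible_of_fst {L M : ℝ} {q : ℝ → ℝ} (hq : Measurable q)
    (hM : ∀ η ∈ Icc 0 L, |q η| ≤ M) : Admissible L fun η _ => q η :=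
  ⟨hq.comp measurable_fst, fun _ _ _ => rfl, M, fun η hη _ => hM η hη⟩

lemma admissible_of_snd {L M : ℝ} {q : ℝ → ℝ} (hq : Measurable q)
    (hp : Function.Periodic q (2 * π)) (hM : ∀ φ, |q φ| ≤ M) : Admissible L fun _ φ => q φ :=
  ⟨hq.comp measurable_snd, fun _ _ => hp, M, fun _ _ φ => hM φ⟩

lemma Admissible.mean {L : ℝ} {u : ℝ → ℝ → ℝ} (hu : Admissible L u) :
    Admissible L fun η _ => mean u η := by
  obtain ⟨M, hM⟩ := hu.bounded
  exact admissible_of_fst (measurable_mean hu.measurable) fun η hη => abs_mean_le (hM η hη)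

lemma planar_polar_rad {A t E φ : ℝ} {u : ℝ → ℝ → ℝ} (hr : 0 < rad t E)
    (hu : Function.Periodic (u (A - rad t E)) (2 * π))
    (hφ : t = -(rad t E * sin φ) ∧ E = rad t E * cos φ) :
    planar A u t E = u (A - rad t E) φ := by
  have h := planar_polar (by linarith : A - rad t E < A) hu φ
  rwa [sub_sub_cancel, ← hφ.1, ← hφ.2] at h

/-- The transport equation along lines of the plane. -/
lemma IsSolution.alongLines {ε R : ℝ} {h : ℝ → ℝ} {S f : ℝ → ℝ → ℝ} (hε : 0 < ε)
    (hL : len ε < R / ε) (hf : IsSolution ε R h S f) (hS : Admissible (len ε) S) :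
    AlongLines (R / ε) (len ε) f (fun η φ => mean f η + S η φ - f η φ) := by
  intro E t₁ t₂ ht hr
  obtain ⟨Φ, hΦ, hk⟩ := exists_isCharacteristic hε hL hr
  have hmem : ∀ t ∈ Icc t₁ t₂, R / ε - rad t E ∈ Icc 0 (len ε) := hΦ.mem
  have hpl : ∀ u : ℝ → ℝ → ℝ, Admissible (len ε) u → ∀ t ∈ Icc t₁ t₂,
      planar (R / ε) u t E = u (R / ε - rad t E) (Φ t) := fun u hu t h' =>
    planar_polar_rad (by linarith [(hr t h').1]) (hu.periodic _ (hmem t h')) (hk t h')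
  rw [hpl f hf.admissible _ (left_mem_Icc.2 ht), hpl f hf.admissible _ (right_mem_Icc.2 ht),
    hf.transport t₁ t₂ _ Φ ht hΦ]
  refine intervalIntegral.integral_congr fun t h' => ?_
  rw [uIcc_of_le ht] at h'
  rw [hpl _ ((hf.admissible.mean.add hS).sub hf.admissible) t h']

/-- The chord enters the outer circle where `sin φ > 0` and `A cos φ = E`, that is at the angle
`arccos (E / A)`. Strictness of `|E| < A` keeps this angle away from the grazing values `0` and `π`.
-/
lemma IsSolution.planar_chord {ε R E : ℝ} {h : ℝ → ℝ} {S f : ℝ → ℝ → ℝ} (hε : 0 < ε)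
    (hL : len ε < R / ε) (hf : IsSolution ε R h S f) (hE : |E| < R / ε) :
    planar (R / ε) f (-chord (R / ε) E) E = h (arccos (E / (R / ε))) := by
  have hp := hf.periodic 0 (left_mem_Icc.2 (len_pos hε).le)
  have hA : 0 < R / ε := (len_pos hε).trans hL
  generalize R / ε = A at *
  have hE' := abs_lt.1 hE
  have h1 : -1 < E / A := by rw [lt_div_iff₀ hA]; linarith
  have h2 : E / A < 1 := by rw [div_lt_one hA]; linarith
  have hφ : arccos (E / A) ∈ Ioo 0 π := by
    refine ⟨arccos_pos.2 h2, lt_of_le_of_ne (arccos_le_pi _) fun h => ?_⟩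
    have := arccos_eq_pi.1 h
    linarith
  have hpol := planar_polar hA hp (arccos (E / A))
  rw [sub_zero, cos_arccos h1.le h2.le, sin_arccos, mul_div_cancel₀ _ hA.ne'] at hpol
  rw [← hf.inflow _ hφ, ← hpol]
  congr 2
  rw [chord, ← sqrt_sq hA.le, ← sqrt_mul (sq_nonneg _), sqrt_sq hA.le]
  congr 1
  field_simp

/-- The reflection `φ ↦ -φ` is `t ↦ -t` in the plane, so the boundary condition at `η = L`
transports the value of `f` across the void. -/
lemma IsSolution.planar_gap {ε R E : ℝ} {h : ℝ → ℝ} {S f : ℝ → ℝ → ℝ} (hε : 0 < ε)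
    (hL : len ε < R / ε) (hf : IsSolution ε R h S f) :
    planar (R / ε) f (chord (R / ε - len ε) E) E
      = planar (R / ε) f (-chord (R / ε - len ε) E) E := by
  rcases (chord_nonneg (R / ε - len ε) E).eq_or_lt with h0 | h0
  · rw [← h0, neg_zero]
  have hp := hf.periodic (len ε) (right_mem_Icc.2 (len_pos hε).le)
  have hpos : 0 < R / ε - len ε := by linarith
  have hr : rad (chord (R / ε - len ε) E) E = R / ε - len ε := by
    refine rad_chord hpos.le (abs_le_of_sq_le_sq ?_ hpos.le)
    have := sqrt_pos.1 h0
    linarith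
  obtain ⟨φ, -, h1, h2⟩ := exists_polar (t := chord (R / ε - len ε) E) (E := E) (by rw [hr]; exact hpos)
  rw [hr] at h1 h2
  have e1 := planar_polar hL hp φ
  have e2 := planar_polar hL hp (-φ)
  rw [← h1, ← h2] at e1
  rw [sin_neg, mul_neg, neg_neg, cos_neg, ← h2, show (R / ε - len ε) * sin φ
    = -chord (R / ε - len ε) E by linarith] at e2
  rw [e1, hf.reflection φ, e2]

/-- Solutions are given by integration along the lines of the plane. -/
lemma IsSolution.planar_eq_mild {ε R t E : ℝ} {h : ℝ → ℝ} {S f : ℝ → ℝ → ℝ} (hε : 0 < ε)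
    (hL : len ε < R / ε) (hf : IsSolution ε R h S f) (hS : Admissible (len ε) S)
    (hE : |E| < R / ε) (ht : rad t E ∈ Icc (R / ε - len ε) (R / ε)) :
    planar (R / ε) f t E = mild (R / ε) (len ε) h (fun η φ => mean f η + S η φ) t E := by
  have hal := hf.alongLines hε hL hS
  have hin := hf.planar_chord hε hL hE
  have hgap := hf.planar_gap (E := E) hε hL
  have hf' := hf.admissible
  have hl := len_pos hε
  have hu : Admissible (len ε) (fun η φ => mean f η + S η φ) := hf'.mean.add hS
  generalize R / ε = A at *
  generalize len ε = L at *
  set b := chord A E with hb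
  set c := chord (A - L) E with hc
  have hcb : c ≤ b := chord_mono (by linarith) (by linarith) E
  have hc0 : 0 ≤ c := chord_nonneg _ _
  have hE' := hE.le
  set g : ℝ → ℝ := fun s => exp (depth (A - L) s E) *
    (ann A L s E * planar A (fun η φ => mean f η + S η φ) s E) with hg
  have hgi : ∀ x y, IntervalIntegrable g volume x y := fun x y => by
    have := hu.intervalIntegrable_ann (A := A) (E := E) (k := 1) (a := x) (b := y) (A - L)
    simpa only [one_mul] using this
  -- On a segment inside the annulus the integrating factor removes the absorption term and leaves
  -- the source `g`.
  have piece : ∀ x y, x ≤ y → -b ≤ x → y ≤ b → (∀ s ∈ Icc x y, rad s E ∈ Icc (A - L) A) →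
      exp (depth (A - L) y E) * planar A f y E - exp (depth (A - L) x E) * planar A f x E
        = ∫ s in x..y, g s := by
    intro x y hxy hx hy hr
    have h1 := hal.isPrimitiveOn (hu.sub hf') hxy hr
    have h2 := (isPrimitiveOn_exp_depth hl.le hL hE' 1).mono (x := x) (y := y)
      ⟨hx, hxy.trans hy⟩ ⟨hx.trans hxy, hy⟩
    have h3 := (h2.mul h1 hxy).congr (v := fun s => exp (depth (A - L) s E) * planar A f s E)
      (v' := g) hxy (fun s _ => by simp only [one_mul]) (fun s hs => by
        simp only [one_mul, hg, ann_of_mem (hr s hs)]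
        simp only [planar]
        ring)
    exact h3.sub_eq y (right_mem_Icc.2 hxy)
  obtain ⟨hct, htb⟩ := (mem_annulus_iff hl.le hL hE').1 ht
  have hneg : ∀ y, y ≤ -c → ∀ s ∈ Icc (-b) y, rad s E ∈ Icc (A - L) A := by
    intro y hy s hs
    rw [mem_annulus_iff hl.le hL hE', abs_of_nonpos (by linarith [hs.2])]
    exact ⟨by linarith [hs.2], by linarith [hs.1]⟩
  have key : exp (depth (A - L) t E) * planar A f t E
      = exp (depth (A - L) (-b) E) * h (arccos (E / A)) + ∫ s in (-b)..t, g s := by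
    rw [← hin]
    -- The point lies before or behind the void. In the second case two pieces are glued at `∓c`,
    -- where the depth is zero and the values of `f` agree by `hgap`.
    rcases le_abs'.1 hct with h' | h'
    · have := piece (-b) t (by linarith [(abs_le.1 htb).1]) le_rfl (by linarith)
        (hneg t h')
      linarith
    · have e1 := piece (-b) (-c) (by linarith) le_rfl (by linarith) (hneg _ le_rfl)
      have e2 := piece c t h' (by linarith) (abs_le.1 htb).2 fun s hs => by
        rw [mem_annulus_iff hl.le hL hE', abs_of_nonneg (by linarith [hs.1])]
        exact ⟨hs.1, hs.2.trans (abs_le.1 htb).2⟩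
      have e3 : ∫ s in (-c)..c, g s = 0 := by
        rw [intervalIntegral.integral_of_le (by linarith), integral_Ioc_eq_integral_Ioo]
        refine setIntegral_eq_zero_of_forall_eq_zero fun s hs => ?_
        have : ann A L s E = 0 := ann_of_notMem fun hm =>
          absurd ((mem_annulus_iff hl.le hL hE').1 hm).1 (not_le.2 (abs_lt.2 hs))
        simp [hg, this]
      have d1 : depth (A - L) c E = 0 := depth_of_abs_le (abs_of_nonneg hc0).le
      have d2 : depth (A - L) (-c) E = 0 := depth_of_abs_le (by rw [abs_neg, abs_of_nonneg hc0])
      rw [← intervalIntegral.integral_add_adjacent_intervals (hgi (-b) c) (hgi c t),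
        ← intervalIntegral.integral_add_adjacent_intervals (hgi (-b) (-c)) (hgi (-c) c), e3]
      rw [d1, hgap] at e2
      rw [d2] at e1
      linarith
  rw [mild_eq (by linarith [(abs_le.1 htb).1] : -chord A E ≤ t), ← key, ← mul_assoc, ← exp_add,
    neg_add_cancel, exp_zero, one_mul]


/-! ### Uniqueness and existence by contraction on the angular average -/

lemma mem_chord_of_mem {A L t E : ℝ} (hL : 0 ≤ L) (hA : L < A)
    (ht : rad t E ∈ Icc (A - L) A) : t ∈ Icc (-chord A E) (chord A E) :=
  abs_le.1 ((mem_annulus_iff hL hA (abs_le_of_rad_le ht.2)).1 ht).2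

lemma depth_sub_le {A L t E : ℝ} (hL : 0 ≤ L) (hA : L < A) (ht : rad t E ∈ Icc (A - L) A) :
    depth (A - L) t E - depth (A - L) (-chord A E) E ≤ 2 * A := by
  have h1 := mem_chord_of_mem hL hA ht
  have h2 := (abs_le.1 (abs_depth_le (A - L) t E)).2
  have h3 := (abs_le.1 (abs_depth_le (A - L) (-chord A E) E)).1
  have h4 := chord_le (by linarith : 0 ≤ A) E
  have h5 : |t| ≤ A := (abs_le.2 h1).trans h4
  rw [abs_neg, abs_of_nonneg (chord_nonneg A E)] at h3
  linarith

/-- The inflow terms cancel, and a source of size `m` seen through optical depth `τ` contributes at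
most `(1 - e^{-τ}) m`. Here `τ ≤ 2A` by `depth_sub_le`. -/
lemma abs_mild_sub_le {A L m t E : ℝ} (hL : 0 ≤ L) (hA : L < A) (h : ℝ → ℝ) {u v : ℝ → ℝ → ℝ}
    (hu : Admissible L u) (hv : Admissible L v) (hm0 : 0 ≤ m)
    (hm : ∀ η ∈ Icc 0 L, ∀ φ, |u η φ - v η φ| ≤ m) (ht : rad t E ∈ Icc (A - L) A) :
    |mild A L h u t E - mild A L h v t E| ≤ (1 - exp (-(2 * A))) * m := by
  have hE := abs_le_of_rad_le ht.2
  have htb := mem_chord_of_mem hL hA ht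
  have hi : ∀ w, Admissible L w → IntervalIntegrable (fun s => exp (depth (A - L) s E) *
      (ann A L s E * planar A w s E)) volume (-chord A E) t := fun w hw => by
    have := hw.intervalIntegrable_ann (A := A) (E := E) (k := 1) (a := -chord A E) (b := t) (A - L)
    simpa only [one_mul] using this
  have h1 : mild A L h u t E - mild A L h v t E = exp (-depth (A - L) t E) *
      ∫ s in (-chord A E)..t, exp (1 * depth (A - L) s E) *
        (ann A L s E * (planar A u s E - planar A v s E)) := by
    rw [mild_eq htb.1, mild_eq htb.1, ← mul_sub, add_sub_add_left_eq_sub,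
      ← intervalIntegral.integral_sub (hi u hu) (hi v hv)]
    congr 2
    funext s
    rw [one_mul]
    ring
  have h2 := abs_integral_attenuated_le hL hA hE htb one_pos (m := m)
    (w := fun s => planar A u s E - planar A v s E)
    (fun s _ hs => hm _ ⟨by linarith [hs.2], by linarith [hs.1]⟩ _)
  rw [h1, abs_mul, abs_exp]
  refine (mul_le_mul_of_nonneg_left h2 (exp_pos _).le).trans ?_
  rw [div_one, one_mul, one_mul]
  have e1 : exp (-depth (A - L) t E) * (m * (exp (depth (A - L) t E)
      - exp (depth (A - L) (-chord A E) E))) =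
      m * (1 - exp (-(depth (A - L) t E - depth (A - L) (-chord A E) E))) := by
    rw [neg_sub, sub_eq_add_neg (depth (A - L) (-chord A E) E), exp_add]
    have : exp (-depth (A - L) t E) * exp (depth (A - L) t E) = 1 := by
      rw [← exp_add, neg_add_cancel, exp_zero]
    linear_combination m * this
  rw [e1, mul_comm]
  refine mul_le_mul_of_nonneg_right ?_ hm0
  have := exp_le_exp.2 (neg_le_neg (depth_sub_le hL hA ht))
  linarith

/-- The function on phase space given by integration along the lines of the plane. -/
def sol (A L : ℝ) (h : ℝ → ℝ) (u : ℝ → ℝ → ℝ) (η φ : ℝ) : ℝ :=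
  mild A L h u (-((A - η) * sin φ)) ((A - η) * cos φ)

lemma rad_polar_mem {A L η : ℝ} (hA : L < A) (hη : η ∈ Icc 0 L) (φ : ℝ) :
    rad (-((A - η) * sin φ)) ((A - η) * cos φ) ∈ Icc (A - L) A := by
  rw [rad_polar (by linarith [hη.2])]
  exact ⟨by linarith [hη.2], by linarith [hη.1]⟩

/-- Only the tangent lines `|E| = A` of the outer circle carry no inflow datum, and they meet the
annulus exactly at the two grazing points. -/
lemma abs_polar_lt {A L η φ : ℝ} (hA : L < A) (hη : η ∈ Icc 0 L) (h : ¬ (η = 0 ∧ sin φ = 0)) :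
    |(A - η) * cos φ| < A := by
  rw [abs_mul, abs_of_pos (by linarith [hη.2])]
  rcases hη.1.eq_or_lt with h0 | h0
  · have hs : sin φ ≠ 0 := fun hs => h ⟨h0.symm, hs⟩
    have hc : |cos φ| < 1 := by
      rw [← sq_lt_one_iff_abs_lt_one]
      have := sin_sq_add_cos_sq φ
      have := sq_pos_of_ne_zero hs
      linarith
    rw [← h0, sub_zero]
    exact mul_lt_of_lt_one_right (by linarith [hη.2]) hc
  · have := mul_le_of_le_one_right (by linarith [hη.2] : 0 ≤ A - η) (abs_cos_le_one φ)
    linarith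

lemma IsSolution.eq_sol {ε R η φ : ℝ} {h : ℝ → ℝ} {S f : ℝ → ℝ → ℝ} (hε : 0 < ε)
    (hL : len ε < R / ε) (hf : IsSolution ε R h S f) (hS : Admissible (len ε) S)
    (hη : η ∈ Icc 0 (len ε)) (hg : ¬ (η = 0 ∧ sin φ = 0)) :
    f η φ = sol (R / ε) (len ε) h (fun η φ => mean f η + S η φ) η φ := by
  rw [sol, ← hf.planar_eq_mild hε hL hS (abs_polar_lt hL hη hg) (rad_polar_mem hL hη φ),
    planar_polar (hη.2.trans_lt hL) (hf.periodic η hη)]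

/-- The grazing angles form a null set, so the undetermined values of `f` there do not affect its
average. -/
lemma ae_sin_ne_zero : ∀ᵐ φ : ℝ, φ ∈ uIoc (-π) π → sin φ ≠ 0 := by
  have h : ∀ᵐ φ : ℝ, φ ∉ ({0, π} : Set ℝ) :=
    (Set.Countable.ae_notMem (by simp) volume)
  filter_upwards [h] with φ h1 h2 h3
  simp only [mem_insert_iff, mem_singleton_iff, not_or] at h1
  rw [uIoc_of_le (neg_le_self pi_pos.le)] at h2
  exact h1.1 ((sin_eq_zero_iff_of_lt_of_lt h2.1 (lt_of_le_of_ne h2.2 h1.2)).1 h3)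

lemma mean_sub {L η : ℝ} {u v : ℝ → ℝ → ℝ} (hu : Admissible L u) (hv : Admissible L v)
    (hη : η ∈ Icc 0 L) : mean u η - mean v η = mean (fun η φ => u η φ - v η φ) η := by
  have hi : ∀ w, Admissible L w → IntervalIntegrable (w η) volume (-π) π := fun w hw => by
    obtain ⟨M, hM⟩ := hw.bounded
    exact intervalIntegrable_of_bounded (hw.measurable.comp (measurable_const.prodMk measurable_id))
      (neg_le_self pi_pos.le) fun φ _ => hM η hη φ
  rw [mean, mean, mean, intervalIntegral.integral_sub (hi u hu) (hi v hv), mul_sub]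

lemma exp_contraction {A : ℝ} (hA : 0 < A) :
    0 ≤ 1 - exp (-(2 * A)) ∧ 1 - exp (-(2 * A)) < 1 := by
  have h1 : exp (-(2 * A)) ≤ 1 := exp_le_one_iff.2 (by linarith)
  have h2 := exp_pos (-(2 * A))
  constructor <;> linarith

/-- Uniqueness away from the grazing points. -/
theorem IsSolution.unique {ε R : ℝ} {h : ℝ → ℝ} {S f g : ℝ → ℝ → ℝ} (hε : 0 < ε)
    (hL : len ε < R / ε) (hf : IsSolution ε R h S f) (hg : IsSolution ε R h S g)
    (hS : Admissible (len ε) S) {p : ℝ × ℝ} (hp : p ∈ phaseSpace (len ε)) :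
    g p.1 p.2 = f p.1 p.2 := by
  have hl := len_pos hε
  obtain ⟨hθ0, hθ1⟩ := exp_contraction (hl.trans hL)
  set θ := 1 - exp (-(2 * (R / ε)))
  have step : ∀ m, 0 ≤ m → (∀ η ∈ Icc 0 (len ε), |mean f η - mean g η| ≤ m) →
      ∀ η ∈ Icc 0 (len ε), ∀ φ, ¬ (η = 0 ∧ sin φ = 0) → |f η φ - g η φ| ≤ θ * m := by
    intro m hm0 hm η hη φ hφ
    rw [hf.eq_sol hε hL hS hη hφ, hg.eq_sol hε hL hS hη hφ]
    refine abs_mild_sub_le hl.le hL h (hf.admissible.mean.add hS) (hg.admissible.mean.add hS) hm0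
      (fun η hη φ => ?_) (rad_polar_mem hL hη φ)
    rw [add_sub_add_right_eq_sub]
    exact hm η hη
  obtain ⟨M, hM0, hM⟩ := (hf.admissible.sub hg.admissible).exists_bound
  have iter : ∀ n : ℕ, ∀ η ∈ Icc 0 (len ε), |mean f η - mean g η| ≤ θ ^ n * M := by
    intro n
    induction n with
    | zero =>
      intro η hη
      rw [mean_sub hf.admissible hg.admissible hη, pow_zero, one_mul]
      exact abs_mean_le (hM η hη)
    | succ n ih =>
      intro η hη
      rw [mean_sub hf.admissible hg.admissible hη, pow_succ', mul_assoc]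
      refine abs_mean_le_of_ae ?_
      filter_upwards [ae_sin_ne_zero] with φ h1 h2
      exact step _ (by positivity) ih η hη φ fun h3 => h1 h2 h3.2
  have hzero : ∀ η ∈ Icc 0 (len ε), |mean f η - mean g η| ≤ 0 := fun η hη => by
    have h0 := (tendsto_pow_atTop_nhds_zero_of_lt_one hθ0 hθ1).mul_const M
    rw [zero_mul] at h0
    exact ge_of_tendsto' h0 fun n => iter n η hη
  have := step 0 le_rfl hzero p.1 hp.1 p.2 hp.2.2
  rw [mul_zero, abs_nonpos_iff, sub_eq_zero] at this
  exact this.symm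

lemma measurable_sol (A L : ℝ) {h : ℝ → ℝ} {u : ℝ → ℝ → ℝ} (hh : Measurable h)
    (hu : Measurable (Function.uncurry u)) : Measurable (Function.uncurry (sol A L h u)) := by
  refine (measurable_mild A L hh hu).comp (g := fun p : ℝ × ℝ => _)
    (f := fun p : ℝ × ℝ => (-((A - p.1) * sin p.2), (A - p.1) * cos p.2)) ?_
  fun_prop

lemma admissible_sol {A L : ℝ} (hL : 0 ≤ L) (hA : L < A) {h : ℝ → ℝ} {u : ℝ → ℝ → ℝ}
    (hh : Measurable h) (hb : ∃ M, ∀ φ ∈ Ioo 0 π, |h φ| ≤ M) (hu : Admissible L u) :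
    Admissible L (sol A L h u) := by
  refine ⟨measurable_sol A L hh hu.measurable, fun η _ φ => ?_, ?_⟩
  · rw [sol, sol, sin_add_two_pi, cos_add_two_pi]
  obtain ⟨M, hM⟩ := hb
  obtain ⟨N, hN0, hN⟩ := hu.exists_bound
  -- The bound of `h` holds on `(0, π)` only, but `arccos` also takes the values `0` and `π`, so
  -- these two values of `h` are included.
  set H := |M| + |h 0| + |h π| with hH
  have hH' : ∀ x, |h (arccos x)| ≤ H := by
    intro x
    rcases (arccos_nonneg x).eq_or_lt with h0 | h0
    · rw [← h0]
      linarith [abs_nonneg M, abs_nonneg (h π)]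
    rcases (arccos_le_pi x).eq_or_lt with h1 | h1
    · rw [h1]
      linarith [abs_nonneg M, abs_nonneg (h 0)]
    · linarith [hM _ ⟨h0, h1⟩, le_abs_self M, abs_nonneg (h 0), abs_nonneg (h π)]
  obtain ⟨hθ0, hθ1⟩ := exp_contraction (hL.trans_lt hA)
  refine ⟨H + (1 - exp (-(2 * A))) * N, fun η hη φ => ?_⟩
  have hr := rad_polar_mem hA hη φ
  rw [sol]
  generalize -((A - η) * sin φ) = t at hr ⊢
  generalize (A - η) * cos φ = E at hr ⊢
  have h1 := abs_mild_sub_le hL hA h hu (admissible_const L 0) hN0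
    (fun η hη φ => by simpa using hN η hη φ) hr
  have htb := mem_chord_of_mem hL hA hr
  have h2 : |mild A L h (fun _ _ => 0) t E| ≤ H := by
    rw [mild]
    simp only [planar, mul_zero, integral_zero, add_zero]
    rw [← mul_assoc, ← exp_add, abs_mul, abs_exp]
    have : exp (-depth (A - L) t E + depth (A - L) (-chord A E) E) ≤ 1 :=
      exp_le_one_iff.2 (by linarith [depth_mono (A - L) E htb.1])
    calc _ ≤ 1 * H := mul_le_mul this (hH' _) (abs_nonneg _) zero_le_one
      _ = H := one_mul H
  have := abs_sub_abs_le_abs_sub (mild A L h u t E) (mild A L h (fun _ _ => 0) t E)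
  linarith

/-- A function given by integration along lines is a solution if the source is consistent. -/
lemma isSolution_sol {ε R : ℝ} {h q : ℝ → ℝ} {S : ℝ → ℝ → ℝ} (hε : 0 < ε)
    (hL : len ε < R / ε) (hd : IsData (len ε) h S)
    (hu : Admissible (len ε) (fun η φ => q η + S η φ))
    (hq : ∀ η ∈ Icc 0 (len ε),
      mean (sol (R / ε) (len ε) h (fun η φ => q η + S η φ)) η = q η) :
    IsSolution ε R h S (sol (R / ε) (len ε) h (fun η φ => q η + S η φ)) := by
  have hl := len_pos hε
  have hadm := admissible_sol hl.le hL hd.measurable_inflow hd.bounded_inflow hu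
  refine ⟨hadm.measurable, hadm.periodic, hadm.bounded, ?_, ?_, ?_⟩
  · intro a b X Φ hab hc
    -- The converse direction: a given characteristic runs along one line at unit speed, so the
    -- equation follows from that of `mild` after a shift of the parameter by `t₀`.
    obtain ⟨E, t₀, hline⟩ := hc.exists_line hε hL
    have hmem := hc.mem
    clear hc
    generalize R / ε = A at *
    generalize len ε = L at *
    have hrad : ∀ s ∈ Icc a b, rad (t₀ + s) E = A - X s := fun s hs => by
      rw [← (hline s hs).1, ← (hline s hs).2, rad_polar (by linarith [(hmem s hs).2])]
    have hr : ∀ s ∈ Icc a b, rad (t₀ + s) E ∈ Icc (A - L) A := fun s hs => by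
      rw [hrad s hs]
      exact ⟨by linarith [(hmem s hs).2], by linarith [(hmem s hs).1]⟩
    have ha := left_mem_Icc.2 hab
    have hb := right_mem_Icc.2 hab
    have hE := abs_le_of_rad_le (hr a ha).2
    have hsol : ∀ s ∈ Icc a b, sol A L h (fun η φ => q η + S η φ) (X s) (Φ s)
        = mild A L h (fun η φ => q η + S η φ) (t₀ + s) E := fun s hs => by
      rw [sol, (hline s hs).1, (hline s hs).2]
    have hpr := (isPrimitiveOn_mild hl.le hL hE h hu).sub_eq_integral
      (mem_chord_of_mem hl.le hL (hr a ha)) (mem_chord_of_mem hl.le hL (hr b hb))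
    rw [hsol a ha, hsol b hb, hpr, ← intervalIntegral.integral_comp_add_left
      (fun t => ann A L t E * (planar A (fun η φ => q η + S η φ) t E
        - mild A L h (fun η φ => q η + S η φ) t E))]
    refine intervalIntegral.integral_congr fun s hs => ?_
    rw [uIcc_of_le hab] at hs
    have hX : A - rad (t₀ + s) E = X s := by rw [hrad s hs]; ring
    simp only [ann_of_mem (hr s hs), one_mul, hsol s hs, hq _ (hmem s hs)]
    rw [planar_polar_rad (φ := Φ s) (by linarith [(hr s hs).1]), hX]
    · rw [hX]
      exact hu.periodic _ (hmem s hs)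
    · rw [hrad s hs, (hline s hs).1, (hline s hs).2]
      exact ⟨rfl, rfl⟩
  · intro φ hφ
    have hA : 0 < R / ε := hl.trans hL
    have hs := sin_pos_of_pos_of_lt_pi hφ.1 hφ.2
    have hc : chord (R / ε) (R / ε * cos φ) = R / ε * sin φ := by
      rw [chord, show (R / ε) ^ 2 - (R / ε * cos φ) ^ 2 = (R / ε * sin φ) ^ 2 by
        rw [mul_pow, mul_pow, sin_sq]; ring, sqrt_sq (by positivity)]
    rw [sol, sub_zero, mild_eq (by rw [hc]), ← hc, intervalIntegral.integral_same, add_zero,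
      ← mul_assoc, ← exp_add, neg_add_cancel, exp_zero, one_mul, mul_div_cancel_left₀ _ hA.ne',
      arccos_cos hφ.1.le hφ.2.le]
  · intro φ
    generalize R / ε = A at *
    generalize len ε = L at *
    have hpos : 0 < A - L := by linarith
    set E := (A - L) * cos φ with hEdef
    have hc : chord (A - L) E = |(A - L) * sin φ| := by
      rw [chord, show (A - L) ^ 2 - E ^ 2 = ((A - L) * sin φ) ^ 2 by
        rw [hEdef, mul_pow, mul_pow, sin_sq]; ring, sqrt_sq_eq_abs]
    have hr : ∀ s, |s| = chord (A - L) E → rad s E ∈ Icc (A - L) A := by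
      intro s hs
      have hE : |E| ≤ A - L := by
        rw [hEdef, abs_mul, abs_of_pos hpos]
        exact mul_le_of_le_one_right hpos.le (abs_cos_le_one φ)
      have : rad s E = A - L := by
        rw [← rad_chord hpos.le hE, ← hs, rad, rad, sq_abs]
      rw [this]
      exact ⟨le_rfl, by linarith⟩
    have hE := abs_le_of_rad_le (hr _ (abs_of_nonneg (chord_nonneg _ _))).2
    -- The derivative of `mild` vanishes in the void, so the values at the two ends of the inner
    -- chord agree. This is the reflection condition.
    have hgap : mild A L h (fun η φ => q η + S η φ) (chord (A - L) E) E
        = mild A L h (fun η φ => q η + S η φ) (-chord (A - L) E) E := by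
      have h0 := chord_nonneg (A - L) E
      have := (isPrimitiveOn_mild hl.le hL hE h hu).sub_eq_integral
        (mem_chord_of_mem hl.le hL (hr (-chord (A - L) E) (by rw [abs_neg, abs_of_nonneg h0])))
        (mem_chord_of_mem hl.le hL (hr (chord (A - L) E) (abs_of_nonneg h0)))
      rw [intervalIntegral.integral_of_le (by linarith), integral_Ioc_eq_integral_Ioo,
        setIntegral_eq_zero_of_forall_eq_zero] at this
      · linarith
      · intro s hs
        rw [ann_of_notMem fun hm => absurd ((mem_annulus_iff hl.le hL hE).1 hm).1
          (not_le.2 (abs_lt.2 hs)), zero_mul]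
    rw [sol, sol, sin_neg, cos_neg, mul_neg, neg_neg, ← hEdef]
    rcases abs_cases ((A - L) * sin φ) with ⟨h1, -⟩ | ⟨h1, -⟩
    · rw [h1] at hc
      rw [← hc, hgap]
    · rw [h1] at hc
      rw [show (A - L) * sin φ = -chord (A - L) E by linarith, neg_neg, hgap]

/-- Existence by Picard iteration on the angular average. -/
theorem exists_isSolution {ε R : ℝ} {h : ℝ → ℝ} {S : ℝ → ℝ → ℝ} (hε : 0 < ε)
    (hL : len ε < R / ε) (hd : IsData (len ε) h S) : ∃ f, IsSolution ε R h S f := by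
  have hl := len_pos hε
  set A := R / ε with hA
  set L := len ε with hLdef
  obtain ⟨hθ0, hθ1⟩ := exp_contraction (hl.trans hL)
  set θ := 1 - exp (-(2 * A))
  set src : (ℝ → ℝ) → ℝ → ℝ → ℝ := fun q η φ => q η + S η φ with hsrc
  -- The indicator makes iterates bounded on all of `ℝ`, so that the contraction and the pointwise
  -- limit can be taken without restricting `η`.
  set T : (ℝ → ℝ) → ℝ → ℝ := fun q => (Icc 0 L).indicator (mean (sol A L h (src q))) with hT
  set P : (ℝ → ℝ) → Prop := fun q => Measurable q ∧ ∃ M, ∀ η, |q η| ≤ M with hP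
  have hadm : ∀ q, P q → Admissible L (src q) := fun q hq => by
    obtain ⟨M, hM⟩ := hq.2
    exact (admissible_of_fst hq.1 fun η _ => hM η).add hd.admissible
  have hsol : ∀ q, P q → Admissible L (sol A L h (src q)) := fun q hq =>
    admissible_sol hl.le hL hd.measurable_inflow hd.bounded_inflow (hadm q hq)
  have hPT : ∀ q, P q → P (T q) := fun q hq => by
    obtain ⟨M, hM0, hM⟩ := (hsol q hq).exists_bound
    refine ⟨(measurable_mean (hsol q hq).measurable).indicator measurableSet_Icc, M, fun η => ?_⟩
    by_cases hη : η ∈ Icc 0 L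
    · rw [hT]
      simp only [indicator_of_mem hη]
      exact abs_mean_le (hM η hη)
    · rw [hT]
      simpa only [indicator_of_notMem hη, abs_zero] using hM0
  have hTc : ∀ q q' m, P q → P q' → 0 ≤ m → (∀ η, |q η - q' η| ≤ m) →
      ∀ η, |T q η - T q' η| ≤ θ * m := by
    intro q q' m hq hq' hm0 hm η
    by_cases hη : η ∈ Icc 0 L
    · rw [hT]
      simp only [indicator_of_mem hη]
      rw [mean_sub (hsol q hq) (hsol q' hq') hη]
      refine abs_mean_le fun φ => abs_mild_sub_le hl.le hL h (hadm q hq) (hadm q' hq') hm0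
        (fun η _ φ => ?_) (rad_polar_mem hL hη φ)
      rw [hsrc]
      simp only [add_sub_add_right_eq_sub]
      exact hm η
    · rw [hT]
      simp only [indicator_of_notMem hη, sub_zero, abs_zero]
      positivity
  set a : ℕ → ℝ → ℝ := fun n => T^[n] 0 with ha
  have hPa : ∀ n, P (a n) := by
    intro n
    induction n with
    | zero => exact ⟨measurable_const, 0, fun η => by simp [ha]⟩
    | succ n ih =>
      rw [ha]
      simp only [Function.iterate_succ_apply']
      exact hPT _ ih
  have hsucc : ∀ n, a (n + 1) = T (a n) := fun n => Function.iterate_succ_apply' _ _ _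
  obtain ⟨M, hM⟩ := (hPa 1).2
  have hM0 : 0 ≤ M := (abs_nonneg _).trans (hM 0)
  have hgeo : ∀ n η, dist (a n η) (a (n + 1) η) ≤ M * θ ^ n := by
    intro n
    induction n with
    | zero =>
      intro η
      rw [pow_zero, mul_one, dist_comm, dist_eq]
      simpa [ha] using hM η
    | succ n ih =>
      intro η
      rw [dist_eq, hsucc (n + 1), hsucc n, show M * θ ^ (n + 1) = θ * (M * θ ^ n) by ring]
      refine hTc _ _ _ (hPa n) (hsucc n ▸ hPa (n + 1)) (by positivity) (fun η => ?_) η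
      rw [← hsucc n, ← dist_eq]
      exact ih η
  have hlim : ∀ η, ∃ y, Filter.Tendsto (fun n => a n η) Filter.atTop (nhds y) := fun η =>
    cauchySeq_tendsto_of_complete (cauchySeq_of_le_geometric θ M hθ1 fun n => hgeo n η)
  choose q hq using hlim
  have hdist : ∀ n η, |a n η - q η| ≤ M * θ ^ n / (1 - θ) := fun n η => by
    rw [← dist_eq]
    exact dist_le_of_le_geometric_of_tendsto θ M hθ1 (fun n => hgeo n η) (hq η) n
  have hPq : P q := by
    refine ⟨measurable_of_tendsto_metrizable (fun n => (hPa n).1) (tendsto_pi_nhds.2 hq),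
      M * θ ^ 0 / (1 - θ), fun η => ?_⟩
    simpa [ha] using hdist 0 η
  have hfix : ∀ η, T q η = q η := by
    intro η
    have h1 : Filter.Tendsto (fun n => a (n + 1) η) Filter.atTop (nhds (T q η)) := by
      rw [tendsto_iff_dist_tendsto_zero]
      have h2 : Filter.Tendsto (fun n : ℕ => θ * (M * θ ^ n / (1 - θ))) Filter.atTop (nhds 0) := by
        have := (tendsto_pow_atTop_nhds_zero_of_lt_one hθ0 hθ1).const_mul (θ * (M / (1 - θ)))
        rw [mul_zero] at this
        refine this.congr fun n => ?_
        ring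
      refine squeeze_zero (fun _ => dist_nonneg) (fun n => ?_) h2
      rw [hsucc, dist_eq]
      have h1θ : 0 < 1 - θ := by linarith
      exact hTc _ _ _ (hPa n) hPq (by positivity) (hdist n) η
    exact tendsto_nhds_unique h1 ((Filter.tendsto_add_atTop_iff_nat 1).2 (hq η))
  refine ⟨_, isSolution_sol hε hL hd (hadm q hPq) fun η hη => ?_⟩
  exact (indicator_of_mem hη _).symm.trans (hfix η)


/-! ### The divergence theorem in the annulus -/

/-- The substitution `E = ρ cos φ`. -/
lemma integral_cos_subst {ρ : ℝ} (hρ : 0 < ρ) (g : ℝ → ℝ) :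
    ∫ E in Ioo (-ρ) ρ, g E = ∫ φ in (0 : ℝ)..π, ρ * sin φ * g (ρ * cos φ) := by
  have himg : (fun φ => ρ * cos φ) '' Ioo 0 π = Ioo (-ρ) ρ := by
    ext E
    constructor
    · rintro ⟨φ, hφ, rfl⟩
      have h1 : cos φ < 1 := by
        have := cos_lt_cos_of_nonneg_of_le_pi le_rfl hφ.2.le hφ.1
        rwa [cos_zero] at this
      have h2 : -1 < cos φ := by
        have := cos_lt_cos_of_nonneg_of_le_pi hφ.1.le le_rfl hφ.2
        rwa [cos_pi] at this
      exact ⟨by nlinarith, by nlinarith⟩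
    · rintro ⟨h1, h2⟩
      have h3 : -1 < E / ρ := by rw [lt_div_iff₀ hρ]; linarith
      have h4 : E / ρ < 1 := by rw [div_lt_one hρ]; exact h2
      refine ⟨arccos (E / ρ), ⟨arccos_pos.2 h4, lt_of_le_of_ne (arccos_le_pi _) fun h => ?_⟩, ?_⟩
      · linarith [arccos_eq_pi.1 h]
      · simp only [cos_arccos h3.le h4.le]
        field_simp
  have hinj : InjOn (fun φ => ρ * cos φ) (Ioo 0 π) := fun x hx y hy h =>
    injOn_cos (Ioo_subset_Icc_self hx) (Ioo_subset_Icc_self hy) (mul_left_cancel₀ hρ.ne' h)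
  rw [← himg, integral_image_eq_integral_abs_deriv_smul measurableSet_Ioo
    (fun φ _ => ((hasDerivAt_cos φ).const_mul ρ).hasDerivWithinAt) hinj,
    intervalIntegral.integral_of_le pi_pos.le, integral_Ioc_eq_integral_Ioo]
  refine setIntegral_congr_fun measurableSet_Ioo fun φ hφ => ?_
  have := sin_pos_of_pos_of_lt_pi hφ.1 hφ.2
  simp only [mul_neg, abs_neg, smul_eq_mul]
  rw [abs_of_pos (by positivity)]

lemma Admissible.intervalIntegrable_angle {L η : ℝ} {u : ℝ → ℝ → ℝ} (hu : Admissible L u)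
    (hη : η ∈ Icc 0 L) (a b : ℝ) : IntervalIntegrable (u η) volume a b := by
  obtain ⟨M, hM⟩ := hu.bounded
  have hm : Measurable (u η) := hu.measurable.comp (measurable_const.prodMk measurable_id)
  rcases le_total a b with h | h
  · exact intervalIntegrable_of_bounded hm h fun φ _ => hM η hη φ
  · exact (intervalIntegrable_of_bounded hm h fun φ _ => hM η hη φ).symm

/-- The jump of `V` between the two end points of the chord at height `E` of the circle of radius
`ρ`. -/
def jump (A : ℝ) (V : ℝ → ℝ → ℝ) (ρ E : ℝ) : ℝ :=
  planar A V (chord ρ E) E - planar A V (-chord ρ E) E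

lemma chord_polar {ρ φ : ℝ} (hρ : 0 ≤ ρ) (hφ : 0 ≤ sin φ) : chord ρ (ρ * cos φ) = ρ * sin φ := by
  rw [chord, show ρ ^ 2 - (ρ * cos φ) ^ 2 = (ρ * sin φ) ^ 2 by
    rw [mul_pow, mul_pow, sin_sq]; ring, sqrt_sq (by positivity)]

lemma chord_of_le {ρ E : ℝ} (hρ : 0 ≤ ρ) (h : ρ ≤ |E|) : chord ρ E = 0 := by
  refine sqrt_eq_zero_of_nonpos ?_
  have : ρ ^ 2 ≤ E ^ 2 := sq_le_sq.2 (by rwa [abs_of_nonneg hρ])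
  linarith

lemma jump_of_le {A ρ E : ℝ} {V : ℝ → ℝ → ℝ} (hρ : 0 ≤ ρ) (h : ρ ≤ |E|) : jump A V ρ E = 0 := by
  rw [jump, chord_of_le hρ h, neg_zero, sub_self]

lemma measurable_jump (A ρ : ℝ) {V : ℝ → ℝ → ℝ} (hV : Measurable (Function.uncurry V)) :
    Measurable (jump A V ρ) := by
  have hc := measurable_chord ρ
  have hp := measurable_planar A hV
  exact (hp.comp (hc.prodMk measurable_id)).sub (hp.comp (hc.neg.prodMk measurable_id))

lemma integrableOn_jump {A L η : ℝ} {V : ℝ → ℝ → ℝ} (hA : L < A) (hV : Admissible L V)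
    (hη : η ∈ Icc 0 L) {s : Set ℝ} (hs : volume s < ⊤) :
    IntegrableOn (jump A V (A - η)) s := by
  obtain ⟨M, hM0, hM⟩ := hV.exists_bound
  refine Measure.integrableOn_of_bounded (M := M + M) hs.ne
    (measurable_jump A _ hV.measurable).aestronglyMeasurable (.of_forall fun E => ?_)
  have hρ : 0 ≤ A - η := by linarith [hη.2]
  rw [norm_eq_abs]
  rcases le_total |E| (A - η) with h | h
  · have hr := rad_chord hρ h
    have hmem : A - η ∈ Icc (A - L) A := ⟨by linarith [hη.2], by linarith [hη.1]⟩
    exact (abs_sub _ _).trans (add_le_add (Admissible.planar_le hM (hr.symm ▸ hmem))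
      (Admissible.planar_le hM (by rwa [rad_neg, hr])))
  · rw [jump_of_le hρ h, abs_zero]
    linarith

/-- With `E = ρ cos φ`, `0 ≤ φ ≤ π`, the upper and lower ends of the chord have the angles `-φ` and
`φ`, and `dE` supplies the factor `ρ sin φ`. So the total jump is the flux through the circle, up to
sign. -/
lemma integral_jump {A L η : ℝ} {V : ℝ → ℝ → ℝ} (hA : L < A) (hV : Admissible L V)
    (hη : η ∈ Icc 0 L) :
    ∫ E in Ioo (-(A - η)) (A - η), jump A V (A - η) E = -((A - η) * sinMoment V η) := by
  have hρ : 0 < A - η := by linarith [hη.2]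
  have hp := hV.periodic η hη
  have hs : Admissible L (fun η φ => sin φ * V η φ) :=
    (admissible_of_snd (M := 1) measurable_sin sin_periodic abs_sin_le_one).mul hV
  have hi := hs.intervalIntegrable_angle hη
  rw [integral_cos_subst hρ, sinMoment,
    ← intervalIntegral.integral_add_adjacent_intervals (hi (-π) 0) (hi 0 π)]
  have h1 : ∫ φ in (-π)..0, sin φ * V η φ = -∫ φ in (0 : ℝ)..π, sin φ * V η (-φ) := by
    rw [← intervalIntegral.integral_neg, ← neg_zero, ← intervalIntegral.integral_comp_neg, neg_zero]
    refine intervalIntegral.integral_congr fun φ _ => ?_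
    simp [sin_neg]
  have h2 : IntervalIntegrable (fun φ => sin φ * V η (-φ)) volume 0 π := by
    obtain ⟨M, hM⟩ := hV.bounded
    refine intervalIntegrable_of_bounded (M := 1 * M) (measurable_sin.mul
      (hV.measurable.comp (measurable_const.prodMk measurable_neg))) pi_pos.le fun φ _ => ?_
    rw [abs_mul]
    exact mul_le_mul (abs_sin_le_one φ) (hM η hη _) (abs_nonneg _) zero_le_one
  have h3 : ∀ x y : ℝ, -((A - η) * (-x + y)) = (A - η) * (x - y) := fun x y => by ring
  rw [h1, h3, ← intervalIntegral.integral_sub h2 (hi 0 π), ← intervalIntegral.integral_const_mul]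
  refine intervalIntegral.integral_congr fun φ hφ => ?_
  rw [uIcc_of_le pi_pos.le] at hφ
  have hs0 := sin_nonneg_of_nonneg_of_le_pi hφ.1 hφ.2
  have e1 := planar_polar (by linarith [hη.2] : η < A) hp φ
  have e2 := planar_polar (by linarith [hη.2] : η < A) hp (-φ)
  rw [sin_neg, cos_neg, mul_neg, neg_neg] at e2
  simp only [jump, chord_polar hρ.le hs0, e1, e2]
  ring

/-- The integral of the derivative along a line, which crosses the annulus. -/
lemma AlongLines.integral_line {A L η E : ℝ} {V W : ℝ → ℝ → ℝ} (h : AlongLines A L V W)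
    (hA : L < A) (hW : Admissible L W) (hη : η ∈ Icc 0 L) (hE : |E| ≤ A - η) :
    ∫ t, (Icc (A - L) (A - η)).indicator 1 (rad t E) * planar A W t E
      = jump A V (A - η) E - jump A V (A - L) E := by
  have hρ : 0 ≤ A - η := by linarith [hη.2]
  have hρL : 0 ≤ A - L := by linarith
  have hiff : ∀ t, rad t E ∈ Icc (A - L) (A - η) ↔
      chord (A - L) E ≤ |t| ∧ |t| ≤ chord (A - η) E := fun t => by
    rw [mem_Icc, le_rad_iff hρL, rad_le_iff hρ hE]
    rfl
  set b := chord (A - η) E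
  set c := chord (A - L) E
  have hc0 : 0 ≤ c := chord_nonneg _ _
  have hcb : c ≤ b := chord_mono hρL (by linarith [hη.2]) E
  set g : ℝ → ℝ := fun t => (Icc (A - L) (A - η)).indicator 1 (rad t E) * planar A W t E with hg
  have hgin : ∀ t, c ≤ |t| → |t| ≤ b → g t = planar A W t E := fun t h1 h2 => by
    simp only [hg]
    rw [indicator_of_mem ((hiff t).2 ⟨h1, h2⟩), Pi.one_apply, one_mul]
  have hgout : ∀ t, ¬ (c ≤ |t| ∧ |t| ≤ b) → g t = 0 := fun t h1 => by
    simp only [hg]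
    rw [indicator_of_notMem (fun hm => h1 ((hiff t).1 hm)), zero_mul]
  have hr : ∀ t, c ≤ |t| → |t| ≤ b → rad t E ∈ Icc (A - L) A := fun t h1 h2 =>
    Icc_subset_Icc_right (by linarith [hη.1]) ((hiff t).2 ⟨h1, h2⟩)
  have n1 : ∀ t ∈ Icc (-b) (-c), c ≤ |t| ∧ |t| ≤ b := fun t ht => by
    rw [abs_of_nonpos (by linarith [ht.2])]
    exact ⟨by linarith [ht.2], by linarith [ht.1]⟩
  have n2 : ∀ t ∈ Icc c b, c ≤ |t| ∧ |t| ≤ b := fun t ht => by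
    rw [abs_of_nonneg (by linarith [ht.1])]
    exact ht
  have n3 : ∀ t ∈ Ioo (-c) c, g t = 0 := fun t ht => hgout t fun h1 =>
    absurd h1.1 (not_le.2 (abs_lt.2 ht))
  have i1 : IntervalIntegrable g volume (-b) (-c) := by
    refine (hW.intervalIntegrable_planar (A := A) (E := E) (by linarith) fun t ht =>
      hr t (n1 t ht).1 (n1 t ht).2).congr_ae ?_
    refine (ae_restrict_mem measurableSet_uIoc).mono fun t ht => ?_
    rw [uIoc_of_le (by linarith)] at ht
    have := n1 t (Ioc_subset_Icc_self ht)
    exact (hgin t this.1 this.2).symm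
  have i2 : IntervalIntegrable g volume c b := by
    refine (hW.intervalIntegrable_planar (A := A) (E := E) hcb fun t ht =>
      hr t (n2 t ht).1 (n2 t ht).2).congr_ae ?_
    refine (ae_restrict_mem measurableSet_uIoc).mono fun t ht => ?_
    rw [uIoc_of_le hcb] at ht
    have := n2 t (Ioc_subset_Icc_self ht)
    exact (hgin t this.1 this.2).symm
  have i3 : IntervalIntegrable g volume (-c) c := by
    refine (intervalIntegrable_const (c := (0 : ℝ))).congr_ae ?_
    have hne : ∀ᵐ t : ℝ, t ≠ c := by simp [ae_iff]
    rw [uIoc_of_le (by linarith)]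
    filter_upwards [ae_restrict_mem measurableSet_Ioc, ae_restrict_of_ae hne] with t ht ht'
    exact (n3 t ⟨ht.1, lt_of_le_of_ne ht.2 ht'⟩).symm
  have e1 : ∫ t in (-b)..(-c), g t = planar A V (-c) E - planar A V (-b) E := by
    rw [h E (-b) (-c) (by linarith) fun t ht => hr t (n1 t ht).1 (n1 t ht).2]
    refine intervalIntegral.integral_congr fun t ht => ?_
    rw [uIcc_of_le (by linarith)] at ht
    exact hgin t (n1 t ht).1 (n1 t ht).2
  have e2 : ∫ t in c..b, g t = planar A V b E - planar A V c E := by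
    rw [h E c b hcb fun t ht => hr t (n2 t ht).1 (n2 t ht).2]
    refine intervalIntegral.integral_congr fun t ht => ?_
    rw [uIcc_of_le hcb] at ht
    exact hgin t (n2 t ht).1 (n2 t ht).2
  have e3 : ∫ t in (-c)..c, g t = 0 := by
    rw [intervalIntegral.integral_of_le (by linarith), integral_Ioc_eq_integral_Ioo]
    exact setIntegral_eq_zero_of_forall_eq_zero n3
  have e4 : ∫ t, g t = ∫ t in (-b)..b, g t := by
    rw [intervalIntegral.integral_of_le (by linarith), ← integral_Icc_eq_integral_Ioc]
    refine (setIntegral_eq_integral_of_forall_compl_eq_zero fun t ht => hgout t fun h1 => ?_).symm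
    exact ht (abs_le.1 h1.2)
  rw [e4, ← intervalIntegral.integral_add_adjacent_intervals (i1.trans i3) i2,
    ← intervalIntegral.integral_add_adjacent_intervals i1 i3, e1, e2, e3, jump, jump]
  ring

/-- Integration over an annulus in polar coordinates. -/
lemma integral_annulus {A L η : ℝ} {W : ℝ → ℝ → ℝ} (hA : L < A) (hW : Admissible L W)
    (hη : η ∈ Icc 0 L) :
    ∫ E, ∫ t, (Icc (A - L) (A - η)).indicator 1 (rad t E) * planar A W t E
      = ∫ y in η..L, (A - y) * ∫ φ in (-π)..π, W y φ := by
  obtain ⟨M, hM0, hM⟩ := hW.exists_bound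
  -- The integrand is written in the Cartesian coordinates `(E, -t)`, in which the polar angle is
  -- `φ` itself.
  set G : ℝ × ℝ → ℝ := fun p =>
    (Icc (A - L) (A - η)).indicator 1 (rad (-p.2) p.1) * planar A W (-p.2) p.1 with hG
  have hswap : Measurable fun p : ℝ × ℝ => (-p.2, p.1) :=
    measurable_snd.neg.prodMk measurable_fst
  have hGm : Measurable G := by
    refine Measurable.mul ?_ ((measurable_planar A hW.measurable).comp hswap)
    exact (measurable_one.indicator measurableSet_Icc).comp
      (continuous_rad.measurable.comp hswap)
  have hmem : ∀ {r}, r ∈ Icc (A - L) (A - η) → r ∈ Icc (A - L) A := fun hr =>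
    Icc_subset_Icc_right (by linarith [hη.1]) hr
  have hGb : ∀ p, |G p| ≤ M := fun p => by
    by_cases hp : rad (-p.2) p.1 ∈ Icc (A - L) (A - η)
    · simp only [hG]
      rw [indicator_of_mem hp, Pi.one_apply, one_mul]
      exact Admissible.planar_le hM (hmem hp)
    · simp only [hG]
      rw [indicator_of_notMem hp, zero_mul, abs_zero]
      exact hM0
  have hGi : Integrable G (volume.prod volume) := by
    have hon : IntegrableOn G (Icc (-A) A ×ˢ Icc (-A) A) (volume.prod volume) := by
      refine Measure.integrableOn_of_bounded (M := M) ?_ hGm.aestronglyMeasurable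
        (.of_forall hGb)
      rw [Measure.prod_prod, volume_Icc]
      exact (ENNReal.mul_lt_top ENNReal.ofReal_lt_top ENNReal.ofReal_lt_top).ne
    refine (integrableOn_iff_integrable_of_support_subset fun p hp => ?_).1 hon
    have hr : rad (-p.2) p.1 ∈ Icc (A - L) A := by
      by_contra hcon
      refine hp ?_
      simp only [hG]
      rw [indicator_of_notMem (fun hm => hcon (hmem hm)), zero_mul]
    have h1 := abs_le_of_rad_le hr.2
    have h2 := (mem_chord_of_mem (hη.1.trans hη.2) hA hr)
    have h3 := chord_le (by linarith [hη.1, hη.2] : 0 ≤ A) p.1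
    exact ⟨abs_le.1 h1, by linarith [h2.2], by linarith [h2.1]⟩
  have hI1 : ∫ p, G p = ∫ E, ∫ t,
      (Icc (A - L) (A - η)).indicator 1 (rad t E) * planar A W t E := by
    rw [Measure.volume_eq_prod, integral_prod G hGi]
    congr 1
    funext E
    exact integral_neg_eq_self
      (fun t => (Icc (A - L) (A - η)).indicator 1 (rad t E) * planar A W t E) volume
  rw [← hI1, ← integral_comp_polarCoord_symm]
  have hI2 : ∫ p in polarCoord.target, p.1 • G (polarCoord.symm p)
      = ∫ p in Icc (A - L) (A - η) ×ˢ Ioo (-π) π, p.1 * W (A - p.1) p.2 := by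
    have hsub : Icc (A - L) (A - η) ×ˢ Ioo (-π) π ⊆ polarCoord.target := fun p hp =>
      ⟨by change 0 < p.1; linarith [hp.1.1], hp.2⟩
    rw [← inter_eq_self_of_subset_right hsub, ← setIntegral_indicator
      (measurableSet_Icc.prod measurableSet_Ioo)]
    refine setIntegral_congr_fun (polarCoord.open_target.measurableSet) fun p hp => ?_
    have hp1 : 0 < p.1 := hp.1
    have hs : polarCoord.symm p = (p.1 * cos p.2, p.1 * sin p.2) := rfl
    simp only [hs, hG, rad_polar hp1.le, smul_eq_mul]
    by_cases hr : p.1 ∈ Icc (A - L) (A - η)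
    · have hmp : p ∈ Icc (A - L) (A - η) ×ˢ Ioo (-π) π := ⟨hr, hp.2⟩
      rw [indicator_of_mem hr, indicator_of_mem hmp, Pi.one_apply, one_mul]
      have := planar_polar (u := W) (by linarith : A - p.1 < A)
        (hW.periodic _ ⟨by linarith [(hmem hr).2], by linarith [(hmem hr).1]⟩) p.2
      rw [sub_sub_cancel] at this
      rw [this]
    · have hmp : p ∉ Icc (A - L) (A - η) ×ˢ Ioo (-π) π := fun h => hr h.1
      rw [indicator_of_notMem hr, indicator_of_notMem hmp, zero_mul, mul_zero]
  rw [hI2, Measure.volume_eq_prod, setIntegral_prod]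
  · have h3 := intervalIntegral.integral_comp_sub_left
      (fun r => r * ∫ φ in (-π)..π, W (A - r) φ) (a := η) (b := L) A
    simp only [sub_sub_cancel] at h3
    rw [h3, intervalIntegral.integral_of_le (by linarith [hη.2]), integral_Icc_eq_integral_Ioc]
    refine setIntegral_congr_fun measurableSet_Ioc fun r _ => ?_
    simp only
    rw [integral_const_mul, intervalIntegral.integral_of_le (neg_le_self pi_pos.le),
      integral_Ioc_eq_integral_Ioo]
  · refine Measure.integrableOn_of_bounded (M := A * M) ?_ ?_ ?_
    · rw [Measure.prod_prod, volume_Icc, volume_Ioo]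
      exact (ENNReal.mul_lt_top ENNReal.ofReal_lt_top ENNReal.ofReal_lt_top).ne
    · exact (measurable_fst.mul (hW.measurable.comp
        ((measurable_const.sub measurable_fst).prodMk measurable_snd))).aestronglyMeasurable
    · refine (ae_restrict_iff' (measurableSet_Icc.prod measurableSet_Ioo)).2
        (.of_forall fun p hp => ?_)
      have h1 := hmem hp.1
      have h0 : 0 ≤ p.1 := by linarith [h1.1]
      rw [norm_eq_abs, abs_mul, abs_of_nonneg h0]
      exact mul_le_mul h1.2 (hM _ ⟨by linarith [h1.2], by linarith [h1.1]⟩ _) (abs_nonneg _)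
        (by linarith [h1.2])

/-- The divergence theorem on `[η, L] × [-π, π)`. -/
theorem AlongLines.divergence {A L η : ℝ} {V W : ℝ → ℝ → ℝ} (h : AlongLines A L V W)
    (hA : L < A) (hV : Admissible L V) (hW : Admissible L W) (hη : η ∈ Icc 0 L) :
    (A - L) * sinMoment V L - (A - η) * sinMoment V η
      = ∫ y in η..L, (A - y) * ∫ φ in (-π)..π, W y φ := by
  have hL : L ∈ Icc 0 L := ⟨hη.1.trans hη.2, le_rfl⟩
  have hρL : 0 ≤ A - L := by linarith
  have hfin : ∀ r : ℝ, volume (Ioo (-r) r) < ⊤ := fun r => by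
    rw [volume_Ioo]
    exact ENNReal.ofReal_lt_top
  rw [← integral_annulus hA hW hη]
  -- Integration along each line first turns the area integral into jumps over the outer and the
  -- inner chord; the void contributes nothing.
  have h1 : ∫ E, ∫ t, (Icc (A - L) (A - η)).indicator 1 (rad t E) * planar A W t E
      = ∫ E in Ioo (-(A - η)) (A - η), (jump A V (A - η) E - jump A V (A - L) E) := by
    rw [← integral_Icc_eq_integral_Ioo, ← setIntegral_eq_integral_of_forall_compl_eq_zero
      (s := Icc (-(A - η)) (A - η))]
    · exact setIntegral_congr_fun measurableSet_Icc fun E hE =>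
        h.integral_line hA hW hη (abs_le.2 hE)
    · intro E hE
      have : ∀ t, (Icc (A - L) (A - η)).indicator (1 : ℝ → ℝ) (rad t E) = 0 := fun t =>
        indicator_of_notMem (fun hm => hE (abs_le.1 (abs_le_of_rad_le hm.2))) _
      simp [this]
  have h2 : ∫ E in Ioo (-(A - η)) (A - η), jump A V (A - L) E
      = ∫ E in Ioo (-(A - L)) (A - L), jump A V (A - L) E := by
    refine setIntegral_eq_of_subset_of_forall_sdiff_eq_zero measurableSet_Ioo
      (Ioo_subset_Ioo (by linarith [hη.2]) (by linarith [hη.2])) fun E hE => ?_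
    exact jump_of_le hρL (not_lt.1 fun hlt => hE.2 (abs_lt.1 hlt))
  rw [h1, integral_sub (integrableOn_jump hA hV hη (hfin _)) (integrableOn_jump hA hV hL (hfin _)),
    h2, integral_jump hA hV hη, integral_jump hA hV hL]
  ring


/-! ### Angular moments and the multipliers -/

/-- The integral over the angle. -/
def angInt (u : ℝ → ℝ → ℝ) (η : ℝ) : ℝ := ∫ φ in (-π)..π, u η φ

lemma angInt_eq_mean (u : ℝ → ℝ → ℝ) (η : ℝ) : angInt u η = 2 * π * mean u η := by
  rw [mean, mul_inv_cancel_left₀ two_pi_pos.ne']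
  rfl

lemma measurable_angInt {u : ℝ → ℝ → ℝ} (hu : Measurable (Function.uncurry u)) :
    Measurable (angInt u) := by
  have : angInt u = fun η => 2 * π * mean u η := funext (angInt_eq_mean u)
  rw [this]
  exact measurable_const.mul (measurable_mean hu)

section angInt

variable {L η : ℝ} {u v : ℝ → ℝ → ℝ}

lemma angInt_add (hu : Admissible L u) (hv : Admissible L v) (hη : η ∈ Icc 0 L) :
    angInt (fun η φ => u η φ + v η φ) η = angInt u η + angInt v η :=
  intervalIntegral.integral_add (hu.intervalIntegrable_angle hη _ _)
    (hv.intervalIntegrable_angle hη _ _)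

lemma angInt_sub (hu : Admissible L u) (hv : Admissible L v) (hη : η ∈ Icc 0 L) :
    angInt (fun η φ => u η φ - v η φ) η = angInt u η - angInt v η :=
  intervalIntegral.integral_sub (hu.intervalIntegrable_angle hη _ _)
    (hv.intervalIntegrable_angle hη _ _)

lemma angInt_mul_left (c : ℝ → ℝ) (u : ℝ → ℝ → ℝ) (η : ℝ) :
    angInt (fun η φ => c η * u η φ) η = c η * angInt u η :=
  intervalIntegral.integral_const_mul _ _

lemma angInt_fst (c : ℝ → ℝ) (η : ℝ) : angInt (fun η _ => c η) η = 2 * π * c η := by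
  rw [angInt, intervalIntegral.integral_const, smul_eq_mul]
  ring

lemma angInt_mono (hu : Admissible L u) (hv : Admissible L v) (hη : η ∈ Icc 0 L)
    (h : ∀ φ, u η φ ≤ v η φ) : angInt u η ≤ angInt v η :=
  intervalIntegral.integral_mono (neg_le_self pi_pos.le) (hu.intervalIntegrable_angle hη _ _)
    (hv.intervalIntegrable_angle hη _ _) h

lemma angInt_nonneg (h : ∀ φ, 0 ≤ u η φ) : 0 ≤ angInt u η :=
  intervalIntegral.integral_nonneg (neg_le_self pi_pos.le) fun φ _ => h φ

lemma angInt_congr (h : ∀ φ, u η φ = v η φ) : angInt u η = angInt v η :=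
  intervalIntegral.integral_congr fun φ _ => h φ

end angInt

/-- The Cauchy-Schwarz inequality on an interval. -/
lemma sq_integral_mul_le {a b : ℝ} (hab : a ≤ b) {f g : ℝ → ℝ}
    (hf : IntervalIntegrable (fun x => f x ^ 2) volume a b)
    (hg : IntervalIntegrable (fun x => g x ^ 2) volume a b)
    (hfg : IntervalIntegrable (fun x => f x * g x) volume a b) :
    (∫ x in a..b, f x * g x) ^ 2 ≤ (∫ x in a..b, f x ^ 2) * ∫ x in a..b, g x ^ 2 := by
  -- The quadratic polynomial `∫ (y f + g)²` in `y` is nonnegative, so its discriminant is not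
  -- positive.
  have h : ∀ y : ℝ, 0 ≤ (∫ x in a..b, f x ^ 2) * (y * y) + 2 * (∫ x in a..b, f x * g x) * y
      + ∫ x in a..b, g x ^ 2 := by
    intro y
    have h0 : 0 ≤ ∫ x in a..b, (f x * y + g x) ^ 2 :=
      intervalIntegral.integral_nonneg hab fun x _ => sq_nonneg _
    have h1 : ∫ x in a..b, (f x * y + g x) ^ 2
        = ∫ x in a..b, ((y * y) * f x ^ 2 + (2 * y) * (f x * g x) + g x ^ 2) := by
      congr 1
      funext x
      ring
    rw [h1, intervalIntegral.integral_add ((hf.const_mul _).add (hfg.const_mul _)) hg,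
      intervalIntegral.integral_add (hf.const_mul _) (hfg.const_mul _),
      intervalIntegral.integral_const_mul, intervalIntegral.integral_const_mul] at h0
    linarith
  have := discrim_le_zero h
  rw [discrim] at this
  linarith

lemma admissible_sin (L : ℝ) : Admissible L fun _ φ => sin φ :=
  admissible_of_snd measurable_sin sin_periodic abs_sin_le_one

lemma admissible_cos_two (L : ℝ) : Admissible L fun _ φ => cos (2 * φ) := by
  refine admissible_of_snd (by fun_prop) (fun φ => ?_) fun φ => abs_cos_le_one _
  rw [mul_add, show 2 * φ + 2 * (2 * π) = 2 * φ + 2 * π + 2 * π by ring, cos_add_two_pi,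
    cos_add_two_pi]

lemma Admissible.pow_two {L : ℝ} {u : ℝ → ℝ → ℝ} (hu : Admissible L u) :
    Admissible L fun η φ => u η φ ^ 2 := by
  simpa only [sq] using hu.mul hu

lemma Admissible.fluct {L : ℝ} {u : ℝ → ℝ → ℝ} (hu : Admissible L u) :
    Admissible L (fluct u) := hu.sub hu.mean

/-- Cauchy-Schwarz on an interval of length `2π`. Applied to fluctuations and sources, it bounds
every moment used below by the variance `n` or the second moment `e`. -/
lemma sq_angInt_mul_le {L η : ℝ} {k u : ℝ → ℝ → ℝ} (hk : Admissible L k) (hu : Admissible L u)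
    (hη : η ∈ Icc 0 L) (h : ∀ φ, |k η φ| ≤ 1) :
    angInt (fun η φ => k η φ * u η φ) η ^ 2 ≤ 2 * π * angInt (fun η φ => u η φ ^ 2) η := by
  refine (sq_integral_mul_le (neg_le_self pi_pos.le) (hk.pow_two.intervalIntegrable_angle hη _ _)
    (hu.pow_two.intervalIntegrable_angle hη _ _)
    ((hk.mul hu).intervalIntegrable_angle hη _ _)).trans ?_
  refine mul_le_mul_of_nonneg_right ?_ (angInt_nonneg (u := fun η φ => u η φ ^ 2)
    fun φ => sq_nonneg _)
  have := angInt_mono hk.pow_two (admissible_const L 1) hη fun φ => by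
    rw [sq_le_one_iff_abs_le_one]
    exact h φ
  rwa [angInt_fst (fun _ => 1), mul_one] at this

lemma angInt_fluct {L η : ℝ} {u : ℝ → ℝ → ℝ} (hu : Admissible L u) (hη : η ∈ Icc 0 L) :
    angInt (fluct u) η = 0 := by
  rw [show fluct u = fun η φ => u η φ - mean u η from rfl, angInt_sub hu hu.mean hη,
    angInt_fst (mean u), angInt_eq_mean, sub_self]

/-- `sin²` has average `1/2`, which is what lets the average of `u` be read off from this moment. -/
lemma angInt_sin_sq_mul {L η : ℝ} {u : ℝ → ℝ → ℝ} (hu : Admissible L u) (hη : η ∈ Icc 0 L) :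
    angInt (fun η φ => sin φ ^ 2 * u η φ) η
      = π * mean u η + angInt (fun η φ => sin φ ^ 2 * fluct u η φ) η := by
  have hs := (admissible_sin L).pow_two
  have h1 : angInt (fun _ φ => sin φ ^ 2) η = π := by
    rw [angInt, integral_sin_sq]
    simp
  rw [angInt_congr (v := fun η φ => mean u η * sin φ ^ 2 + sin φ ^ 2 * fluct u η φ) fun φ => by
      rw [fluct]; ring,
    angInt_add (hu.mean.mul hs) (hs.mul hu.fluct) hη,
    angInt_mul_left (mean u) (fun _ φ => sin φ ^ 2), h1]
  ring

/-- `cos 2φ` is orthogonal to constants. This keeps the average out of the force term. -/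
lemma angInt_cos_two_mul {L η : ℝ} {u : ℝ → ℝ → ℝ} (hu : Admissible L u) (hη : η ∈ Icc 0 L) :
    angInt (fun η φ => cos (2 * φ) * u η φ) η
      = angInt (fun η φ => cos (2 * φ) * fluct u η φ) η := by
  have hs := admissible_cos_two L
  have h1 : angInt (fun _ φ => cos (2 * φ)) η = 0 := by
    rw [angInt, intervalIntegral.integral_comp_mul_left (fun x => cos x) two_ne_zero]
    simp
  rw [angInt_congr (v := fun η φ => mean u η * cos (2 * φ) + cos (2 * φ) * fluct u η φ)
      fun φ => by rw [fluct]; ring,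
    angInt_add (hu.mean.mul hs) (hs.mul hu.fluct) hη,
    angInt_mul_left (mean u) (fun _ φ => cos (2 * φ)), h1]
  ring

/-- Pythagoras: the fluctuation is orthogonal to functions of `η`. -/
lemma angInt_sub_const_sq {L η c : ℝ} {u : ℝ → ℝ → ℝ} (hu : Admissible L u) (hη : η ∈ Icc 0 L) :
    angInt (fun η φ => (u η φ - c) ^ 2) η
      = angInt (fun η φ => fluct u η φ ^ 2) η + 2 * π * (mean u η - c) ^ 2 := by
  have hm : Admissible L fun η _ => 2 * (mean u η - c) :=
    (hu.mean.sub (admissible_const L c)).const_mul 2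
  have hm2 : Admissible L fun η _ => (mean u η - c) ^ 2 :=
    (hu.mean.sub (admissible_const L c)).pow_two
  rw [angInt_congr (v := fun η φ => fluct u η φ ^ 2 + 2 * (mean u η - c) * fluct u η φ
      + (mean u η - c) ^ 2) fun φ => by rw [fluct]; ring,
    angInt_add (hu.fluct.pow_two.add (hm.mul hu.fluct)) hm2 hη,
    angInt_add hu.fluct.pow_two (hm.mul hu.fluct) hη,
    angInt_mul_left (fun η => 2 * (mean u η - c)) (fluct u), angInt_fluct hu hη,
    angInt_fst (fun η => (mean u η - c) ^ 2)]
  ring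

/-- Coercivity of the collision term: `mean u - u` is minus the fluctuation, and only the
fluctuating part of `u - c` is seen by it. -/
lemma angInt_mul_source {L η c : ℝ} {u S : ℝ → ℝ → ℝ} (hu : Admissible L u) (hS : Admissible L S)
    (hη : η ∈ Icc 0 L) :
    angInt (fun η φ => (u η φ - c) * (mean u η + S η φ - u η φ)) η
      = angInt (fun η φ => S η φ * (u η φ - c)) η - angInt (fun η φ => fluct u η φ ^ 2) η := by
  have hm : Admissible L fun η _ => mean u η - c := hu.mean.sub (admissible_const L c)
  have hc := hS.mul (hu.sub (admissible_const L c))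
  rw [angInt_congr (v := fun η φ => S η φ * (u η φ - c) - fluct u η φ ^ 2
      - (mean u η - c) * fluct u η φ) fun φ => by rw [fluct]; ring,
    angInt_sub (hc.sub hu.fluct.pow_two) (hm.mul hu.fluct) hη,
    angInt_sub hc hu.fluct.pow_two hη, angInt_mul_left (fun η => mean u η - c) (fluct u),
    angInt_fluct hu hη]
  ring

lemma angInt_mul_eq {L η : ℝ} {u S : ℝ → ℝ → ℝ} (hu : Admissible L u) (hS : Admissible L S)
    (hη : η ∈ Icc 0 L) :
    angInt (fun η φ => S η φ * u η φ) η
      = angInt (fun η φ => S η φ * fluct u η φ) η + 2 * π * (mean S η * mean u η) := by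
  rw [angInt_congr (v := fun η φ => S η φ * fluct u η φ + mean u η * S η φ) fun φ => by
      rw [fluct]; ring,
    angInt_add (hS.mul hu.fluct) (hu.mean.mul hS) hη, angInt_mul_left (mean u) S, angInt_eq_mean S]
  ring

lemma angInt_sin_sub {L η : ℝ} {u S : ℝ → ℝ → ℝ} (hu : Admissible L u) (hS : Admissible L S)
    (hη : η ∈ Icc 0 L) :
    angInt (fun η φ => sin φ * (mean u η + S η φ - u η φ)) η = sinMoment S η - sinMoment u η := by
  have hs := admissible_sin L
  have h1 : angInt (fun _ φ => sin φ) η = 0 := by simp [angInt]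
  rw [angInt_congr (v := fun η φ => mean u η * sin φ + sin φ * S η φ - sin φ * u η φ) fun φ => by
      ring,
    angInt_sub ((hu.mean.mul hs).add (hs.mul hS)) (hs.mul hu) hη,
    angInt_add (hu.mean.mul hs) (hs.mul hS) hη, angInt_mul_left (mean u) (fun _ φ => sin φ), h1,
    mul_zero, zero_add]
  rfl

lemma sinMoment_fluct {L η : ℝ} {u : ℝ → ℝ → ℝ} (hu : Admissible L u) (hη : η ∈ Icc 0 L) :
    sinMoment (fluct u) η = sinMoment u η := by
  have hs := admissible_sin L
  have h1 : angInt (fun _ φ => sin φ) η = 0 := by simp [angInt]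
  change angInt (fun η φ => sin φ * fluct u η φ) η = angInt (fun η φ => sin φ * u η φ) η
  rw [angInt_congr (v := fun η φ => sin φ * u η φ - mean u η * sin φ) fun φ => by rw [fluct]; ring,
    angInt_sub (hs.mul hu) (hu.mean.mul hs) hη, angInt_mul_left (mean u) (fun _ φ => sin φ), h1,
    mul_zero, sub_zero]

lemma two_pi_mul_mean_sq_le {L η : ℝ} {u : ℝ → ℝ → ℝ} (hu : Admissible L u) (hη : η ∈ Icc 0 L) :
    2 * π * mean u η ^ 2 ≤ angInt (fun η φ => u η φ ^ 2) η := by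
  have h := sq_angInt_mul_le (admissible_const L 1) hu hη fun φ => by simp
  simp only [one_mul] at h
  rw [angInt_congr (v := u) fun _ => rfl, angInt_eq_mean, mul_pow, sq (2 * π), mul_assoc] at h
  exact le_of_mul_le_mul_left h two_pi_pos

/-- `sin` is odd, so no net flux crosses the reflecting end. -/
lemma sinMoment_eq_zero_of_even {L : ℝ} {u : ℝ → ℝ → ℝ} (h : ∀ φ, u L φ = u L (-φ)) :
    sinMoment u L = 0 := by
  have h1 : sinMoment u L = -sinMoment u L := by
    conv_lhs => rw [sinMoment]
    rw [← neg_neg π, ← intervalIntegral.integral_comp_neg, neg_neg, sinMoment,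
      ← intervalIntegral.integral_neg]
    refine intervalIntegral.integral_congr fun φ _ => ?_
    simp [sin_neg, ← h φ]
  linarith

/-- The function `e^{kη}` along the characteristics. -/
lemma alongLines_exp (A L k : ℝ) (hA : L < A) :
    AlongLines A L (fun η _ => exp (k * η)) (fun η φ => k * (sin φ * exp (k * η))) ∧
      Admissible L (fun η (_ : ℝ) => exp (k * η)) := by
  have hexp : Admissible L (fun η (_ : ℝ) => exp (k * η)) := by
    refine admissible_of_fst (M := exp (|k| * |L|)) (by fun_prop) fun η hη => ?_
    rw [abs_exp, exp_le_exp]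
    refine (le_abs_self _).trans ?_
    rw [abs_mul]
    exact mul_le_mul_of_nonneg_left (abs_le_abs_of_nonneg hη.1 hη.2) (abs_nonneg k)
  refine ⟨alongLines_of_hasDerivAt (((admissible_sin L).mul hexp).const_mul k) fun t E hr => ?_,
    hexp⟩
  have hr0 : 0 < rad t E := by linarith [hr.1]
  have := (((hasDerivAt_rad hr0).const_sub A).const_mul k).exp
  refine this.congr_deriv ?_
  have h1 := rad_mul_sin_arg hr0
  rw [planar]
  have h2 : t / rad t E = -sin (Complex.arg ⟨E, -t⟩) := by
    field_simp
    linarith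
  rw [h2]
  ring

/-- The function `sin φ / (A - η)` along the characteristics. -/
lemma alongLines_sin (A L : ℝ) (hA : L < A) :
    AlongLines A L (fun η φ => (A - η)⁻¹ * sin φ)
        (fun η φ => -((A - η)⁻¹ ^ 2 * cos (2 * φ))) ∧
      Admissible L (fun η (_ : ℝ) => (A - η)⁻¹) := by
  have hinv : Admissible L (fun η (_ : ℝ) => (A - η)⁻¹) := by
    refine admissible_of_fst (M := (A - L)⁻¹) (by fun_prop) fun η hη => ?_
    rw [abs_of_pos (inv_pos.2 (by linarith [hη.2]))]
    exact inv_anti₀ (by linarith) (by linarith [hη.2])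
  have hW : Admissible L (fun η φ => -((A - η)⁻¹ ^ 2 * cos (2 * φ))) := by
    simpa using (hinv.pow_two.mul (admissible_cos_two L)).const_mul (-1)
  refine ⟨alongLines_of_hasDerivAt hW fun t E hr => ?_, hinv⟩
  have hr0 : 0 < rad t E := by linarith [hr.1]
  -- In the plane the function is `-t / rad²`, with derivative `(t² - E²) / rad⁴`, which is `-cos 2φ
  -- / rad²`.
  have hd : HasDerivAt (fun t => -t / (rad t E * rad t E))
      ((-1 * (rad t E * rad t E) - -t * (t / rad t E * rad t E + rad t E * (t / rad t E)))
        / (rad t E * rad t E) ^ 2) t :=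
    (hasDerivAt_neg t).div ((hasDerivAt_rad hr0).mul (hasDerivAt_rad hr0)) (by positivity)
  have hev : (fun t => planar A (fun η φ => (A - η)⁻¹ * sin φ) t E) =ᶠ[nhds t]
      fun t => -t / (rad t E * rad t E) := by
    have hop : {t | 0 < rad t E} ∈ nhds t :=
      (isOpen_lt continuous_const (continuous_rad_left E)).mem_nhds hr0
    filter_upwards [hop] with s hs
    have hs' : 0 < rad s E := hs
    have h := rad_mul_sin_arg hs'
    rw [planar, sub_sub_cancel, eq_div_iff (by positivity)]
    refine Eq.trans ?_ h
    field_simp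
  refine (hd.congr_of_eventuallyEq hev).congr_deriv ?_
  rw [planar, sub_sub_cancel, cos_two_mul]
  have h1 := rad_mul_cos_arg hr0
  have h2 := rad_sq t E
  have h3 : cos (Complex.arg ⟨E, -t⟩) = E / rad t E := by
    field_simp
    linarith
  rw [h3]
  field_simp
  linear_combination (-2) * h2


/-! ### Flux, second moment and energy identities -/

lemma AlongLines.divergence_angInt {A L η : ℝ} {V W : ℝ → ℝ → ℝ} (h : AlongLines A L V W)
    (hA : L < A) (hV : Admissible L V) (hW : Admissible L W) (hη : η ∈ Icc 0 L) :
    (A - L) * sinMoment V L - (A - η) * sinMoment V η = ∫ y in η..L, (A - y) * angInt W y :=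
  h.divergence hA hV hW hη

/-- A bounded solution of the transport equation along the lines of the plane that is symmetric
at `η = L`. -/
structure IsLineSolution (A L : ℝ) (S f : ℝ → ℝ → ℝ) : Prop where
  nonneg : 0 ≤ L
  lt : L < A
  source : Admissible L S
  admissible : Admissible L f
  alongLines : AlongLines A L f (fun η φ => mean f η + S η φ - f η φ)
  even : ∀ φ, f L φ = f L (-φ)

section identities

variable {A L : ℝ} {S f : ℝ → ℝ → ℝ}

lemma IsLineSolution.admissible_rhs (hf : IsLineSolution A L S f) :
    Admissible L (fun η φ => mean f η + S η φ - f η φ) :=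
  (hf.admissible.mean.add hf.source).sub hf.admissible

/-- The flux. -/
lemma IsLineSolution.sinMoment_eq {η : ℝ} (hf : IsLineSolution A L S f) (hη : η ∈ Icc 0 L) :
    (A - η) * sinMoment f η = -∫ y in η..L, (A - y) * (2 * π * mean S y) := by
  have h := hf.alongLines.divergence_angInt hf.lt hf.admissible hf.admissible_rhs hη
  rw [sinMoment_eq_zero_of_even hf.even, mul_zero, zero_sub] at h
  rw [← neg_eq_iff_eq_neg, h]
  -- Collisions conserve the angular integral, so only the average of the source remains.
  refine intervalIntegral.integral_congr fun y hy => ?_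
  rw [uIcc_of_le hη.2] at hy
  have hy' : y ∈ Icc 0 L := ⟨hη.1.trans hy.1, hy.2⟩
  rw [angInt_sub (hf.admissible.mean.add hf.source) hf.admissible hy',
    angInt_add hf.admissible.mean hf.source hy', angInt_fst (mean f), angInt_eq_mean,
    angInt_eq_mean f]
  simp only [add_sub_cancel_left]

/-- The moment with the weight `sin² φ`. -/
lemma IsLineSolution.sin_sq_eq {η : ℝ} (hf : IsLineSolution A L S f) (hη : η ∈ Icc 0 L) :
    angInt (fun η φ => sin φ ^ 2 * f η φ) L - angInt (fun η φ => sin φ ^ 2 * f η φ) η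
      = ∫ y in η..L, (-((A - y)⁻¹ * angInt (fun η φ => cos (2 * φ) * fluct f η φ) y)
          + sinMoment S y - sinMoment f y) := by
  -- The factor `(A - η)⁻¹` cancels the length element `A - η` of the divergence theorem, which
  -- leaves the moment with the pure weight `sin²` at both ends.
  obtain ⟨hal, hinv⟩ := alongLines_sin A L hf.lt
  have hs := admissible_sin L
  have hc := admissible_cos_two L
  have hW : Admissible L (fun η φ => -((A - η)⁻¹ ^ 2 * cos (2 * φ))) := by
    simpa using (hinv.pow_two.mul hc).const_mul (-1)
  have hadm := (hW.mul hf.admissible).add ((hinv.mul hs).mul hf.admissible_rhs)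
  have h := (hal.mul hf.alongLines hW hf.admissible_rhs).divergence_angInt hf.lt
    ((hinv.mul hs).mul hf.admissible) hadm hη
  have hm : ∀ y ∈ Icc 0 L, (A - y) * sinMoment (fun η φ => (A - η)⁻¹ * sin φ * f η φ) y
      = angInt (fun η φ => sin φ ^ 2 * f η φ) y := by
    intro y hy
    have hpos : A - y ≠ 0 := by linarith [hy.2, hf.lt]
    change (A - y) * angInt (fun η φ => sin φ * ((A - η)⁻¹ * sin φ * f η φ)) y = _
    rw [angInt_congr (v := fun η φ => (A - η)⁻¹ * (sin φ ^ 2 * f η φ)) fun φ => by ring,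
      angInt_mul_left (fun η => (A - η)⁻¹) (fun η φ => sin φ ^ 2 * f η φ),
      mul_inv_cancel_left₀ hpos]
  rw [hm L ⟨hη.1.trans hη.2, le_rfl⟩, hm η hη] at h
  rw [h]
  refine intervalIntegral.integral_congr fun y hy => ?_
  rw [uIcc_of_le hη.2] at hy
  have hy' : y ∈ Icc 0 L := ⟨hη.1.trans hy.1, hy.2⟩
  have hpos : A - y ≠ 0 := by linarith [hy.2, hf.lt]
  rw [angInt_add (hW.mul hf.admissible) ((hinv.mul hs).mul hf.admissible_rhs) hy',
    angInt_congr (u := fun η φ => -((A - η)⁻¹ ^ 2 * cos (2 * φ)) * f η φ)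
      (v := fun η φ => -(A - η)⁻¹ ^ 2 * (cos (2 * φ) * f η φ)) (fun φ => by ring),
    angInt_mul_left (fun η => -(A - η)⁻¹ ^ 2) (fun η φ => cos (2 * φ) * f η φ),
    angInt_cos_two_mul hf.admissible hy',
    angInt_congr (u := fun η φ => (A - η)⁻¹ * sin φ * (mean f η + S η φ - f η φ))
      (v := fun η φ => (A - η)⁻¹ * (sin φ * (mean f η + S η φ - f η φ))) (fun φ => by ring),
    angInt_mul_left (fun η => (A - η)⁻¹) (fun η φ => sin φ * (mean f η + S η φ - f η φ)),
    angInt_sin_sub hf.admissible hf.source hy']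
  field_simp
  ring

/-- The energy identity. -/
lemma IsLineSolution.energy_eq (hf : IsLineSolution A L S f) (K c : ℝ) :
    A * sinMoment (fun η φ => (f η φ - c) ^ 2) 0
      = -∫ y in (0 : ℝ)..L, (A - y) * (exp (2 * K * y) *
          (2 * K * angInt (fun η φ => sin φ * (f η φ - c) ^ 2) y
            + 2 * (angInt (fun η φ => S η φ * (f η φ - c)) y
              - angInt (fun η φ => fluct f η φ ^ 2) y))) := by
  -- The identity is the divergence theorem for `e^{2Kη} (f - c)²`. The exponential has slope `2K
  -- sin φ` times itself, and the flux at `η = L` vanishes since `(f - c)²` is even there.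
  obtain ⟨hal, hexp⟩ := alongLines_exp A L (2 * K) hf.lt
  have hs := admissible_sin L
  have hg : Admissible L (fun η φ => f η φ - c) := hf.admissible.sub (admissible_const L c)
  have hgl : AlongLines A L (fun η φ => f η φ - c) _ := hf.alongLines.sub_const c
  have hr := hf.admissible_rhs
  have hW1 := (hs.mul hexp).const_mul (2 * K)
  have hadm2 := (hr.mul hg).add (hg.mul hr)
  have h0 : (0 : ℝ) ∈ Icc 0 L := ⟨le_rfl, hf.nonneg⟩
  have hadm3 := (hW1.mul (hg.mul hg)).add (hexp.mul hadm2)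
  have h := (hal.mul (hgl.mul hgl hr hr) hW1 hadm2).divergence_angInt hf.lt (hexp.mul (hg.mul hg))
    hadm3 h0
  rw [sinMoment_eq_zero_of_even (fun φ => by rw [hf.even φ]), mul_zero, zero_sub, sub_zero] at h
  have hm : sinMoment (fun η φ => exp (2 * K * η) * ((f η φ - c) * (f η φ - c))) 0
      = sinMoment (fun η φ => (f η φ - c) ^ 2) 0 := by
    rw [sinMoment, sinMoment]
    refine intervalIntegral.integral_congr fun φ _ => ?_
    simp only [mul_zero, exp_zero, one_mul]
    ring
  rw [hm] at h
  rw [← neg_eq_iff_eq_neg, h]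
  refine intervalIntegral.integral_congr fun y hy => ?_
  rw [uIcc_of_le hf.nonneg] at hy
  rw [angInt_add (hW1.mul (hg.mul hg)) (hexp.mul hadm2) hy,
    angInt_congr (u := fun η φ => 2 * K * (sin φ * exp (2 * K * η)) * ((f η φ - c) * (f η φ - c)))
      (v := fun η φ => (2 * K * exp (2 * K * η)) * (sin φ * (f η φ - c) ^ 2)) (fun φ => by ring),
    angInt_mul_left (fun η => 2 * K * exp (2 * K * η)) (fun η φ => sin φ * (f η φ - c) ^ 2),
    angInt_congr (u := fun η φ => exp (2 * K * η) * ((mean f η + S η φ - f η φ) * (f η φ - c) +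
        (f η φ - c) * (mean f η + S η φ - f η φ)))
      (v := fun η φ => (exp (2 * K * η) * 2) *
        ((f η φ - c) * (mean f η + S η φ - f η φ))) (fun φ => by ring),
    angInt_mul_left (fun η => exp (2 * K * η) * 2)
      (fun η φ => (f η φ - c) * (mean f η + S η φ - f η φ)),
    angInt_mul_source hf.admissible hf.source hy]
  ring

end identities


/-! ### Estimates for the moments as functions of `η` -/

/-- Measurable bounded functions on `[0, L]`. -/
structure BddOn (L : ℝ) (g : ℝ → ℝ) : Prop where
  aestronglyMeasurable : AEStronglyMeasurable g (volume.restrict (Icc 0 L))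
  bounded : ∃ M, ∀ η ∈ Icc 0 L, |g η| ≤ M

section BddOn

variable {L : ℝ} {g k : ℝ → ℝ}

lemma BddOn.add (hg : BddOn L g) (hk : BddOn L k) : BddOn L fun η => g η + k η := by
  obtain ⟨M, hM⟩ := hg.bounded
  obtain ⟨N, hN⟩ := hk.bounded
  exact ⟨hg.1.add hk.1, M + N, fun η hη => (abs_add_le _ _).trans (add_le_add (hM η hη) (hN η hη))⟩

lemma BddOn.mul (hg : BddOn L g) (hk : BddOn L k) : BddOn L fun η => g η * k η := by
  obtain ⟨M, hM⟩ := hg.bounded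
  obtain ⟨N, hN⟩ := hk.bounded
  refine ⟨hg.1.mul hk.1, M * N, fun η hη => ?_⟩
  rw [abs_mul]
  exact mul_le_mul (hM η hη) (hN η hη) (abs_nonneg _) ((abs_nonneg _).trans (hM η hη))

lemma bddOn_const (L c : ℝ) : BddOn L fun _ => c :=
  ⟨aestronglyMeasurable_const, |c|, fun _ _ => le_rfl⟩

lemma BddOn.const_mul (hg : BddOn L g) (c : ℝ) : BddOn L fun η => c * g η :=
  (bddOn_const L c).mul hg

lemma BddOn.neg (hg : BddOn L g) : BddOn L fun η => -g η := by
  simpa using hg.const_mul (-1)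

lemma BddOn.sub (hg : BddOn L g) (hk : BddOn L k) : BddOn L fun η => g η - k η := by
  simpa only [sub_eq_add_neg] using hg.add hk.neg

lemma BddOn.pow_two (hg : BddOn L g) : BddOn L fun η => g η ^ 2 := by
  simpa only [sq] using hg.mul hg

lemma BddOn.abs (hg : BddOn L g) : BddOn L fun η => |g η| := by
  obtain ⟨M, hM⟩ := hg.bounded
  exact ⟨hg.1.norm, M, fun η hη => by rw [abs_abs]; exact hM η hη⟩

lemma bddOn_of_continuousOn (hg : ContinuousOn g (Icc 0 L)) : BddOn L g := by
  refine ⟨hg.aestronglyMeasurable measurableSet_Icc, ?_⟩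
  obtain ⟨M, hM⟩ := isCompact_Icc.exists_bound_of_continuousOn hg
  exact ⟨M, hM⟩

lemma Admissible.bddOn_angInt {u : ℝ → ℝ → ℝ} (hu : Admissible L u) : BddOn L (angInt u) := by
  obtain ⟨M, hM⟩ := hu.bounded
  refine ⟨(measurable_angInt hu.measurable).aestronglyMeasurable, 2 * π * M, fun η hη => ?_⟩
  rw [angInt_eq_mean, abs_mul, abs_of_pos two_pi_pos]
  exact mul_le_mul_of_nonneg_left (abs_mean_le (hM η hη)) two_pi_pos.le

lemma Admissible.bddOn_mean {u : ℝ → ℝ → ℝ} (hu : Admissible L u) : BddOn L (Milne.mean u) := by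
  obtain ⟨M, hM⟩ := hu.bounded
  exact ⟨(measurable_mean hu.measurable).aestronglyMeasurable, M, fun η hη =>
    abs_mean_le (hM η hη)⟩

lemma Admissible.bddOn_sinMoment {u : ℝ → ℝ → ℝ} (hu : Admissible L u) :
    BddOn L (sinMoment u) := ((admissible_sin L).mul hu).bddOn_angInt

lemma BddOn.intervalIntegrable (hg : BddOn L g) {x y : ℝ} (hx : x ∈ Icc 0 L) (hy : y ∈ Icc 0 L) :
    IntervalIntegrable g volume x y := by
  obtain ⟨M, hM⟩ := hg.bounded
  have h : IntegrableOn g (Icc 0 L) :=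
    IntegrableOn.of_bound (by simp) hg.1 M ((ae_restrict_iff' measurableSet_Icc).2
      (.of_forall hM))
  rw [intervalIntegrable_iff]
  exact h.mono_set (uIoc_subset_uIcc.trans (uIcc_subset_Icc hx hy))

lemma BddOn.tail (hg : BddOn L g) (hL : 0 ≤ L) : BddOn L fun η => ∫ y in η..L, g y := by
  have h0 : (0 : ℝ) ∈ Icc 0 L := ⟨le_rfl, hL⟩
  have hl : L ∈ Icc 0 L := ⟨hL, le_rfl⟩
  refine bddOn_of_continuousOn ?_
  have := intervalIntegral.continuousOn_primitive_interval_left (f := g) (a := 0) (b := L)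
    (μ := volume) (by
      have := (hg.intervalIntegrable h0 hl)
      rwa [intervalIntegrable_iff_integrableOn_Icc_of_le hL, ← uIcc_of_le hL] at this)
  rwa [uIcc_of_le hL] at this

lemma BddOn.integral_mono (hg : BddOn L g) (hk : BddOn L k) {x y : ℝ} (hx : x ∈ Icc 0 L)
    (hy : y ∈ Icc 0 L) (hxy : x ≤ y) (h : ∀ t ∈ Icc 0 L, g t ≤ k t) :
    ∫ t in x..y, g t ≤ ∫ t in x..y, k t :=
  intervalIntegral.integral_mono_on hxy (hg.intervalIntegrable hx hy) (hk.intervalIntegrable hx hy)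
    fun t ht => h t ⟨hx.1.trans ht.1, ht.2.trans hy.2⟩

lemma BddOn.abs_integral_le (hk : BddOn L k) {x y : ℝ} (hx : x ∈ Icc 0 L)
    (hy : y ∈ Icc 0 L) (hxy : x ≤ y) (h : ∀ t ∈ Icc 0 L, |g t| ≤ k t) :
    |∫ t in x..y, g t| ≤ ∫ t in x..y, k t := by
  rw [← norm_eq_abs]
  refine intervalIntegral.norm_integral_le_of_norm_le hxy (.of_forall fun t ht => ?_)
    (hk.intervalIntegrable hx hy)
  exact h t ⟨hx.1.trans ht.1.le, ht.2.trans hy.2⟩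

lemma integral_nonneg_of_Icc {x y : ℝ} (hx : x ∈ Icc 0 L) (hy : y ∈ Icc 0 L) (hxy : x ≤ y)
    (h : ∀ t ∈ Icc 0 L, 0 ≤ g t) : 0 ≤ ∫ t in x..y, g t :=
  intervalIntegral.integral_nonneg hxy fun t ht => h t ⟨hx.1.trans ht.1, ht.2.trans hy.2⟩

lemma BddOn.integral_anti_left (hg : BddOn L g) {x y : ℝ} (hx : x ∈ Icc 0 L) (hy : y ∈ Icc 0 L)
    (hxy : x ≤ y) (h : ∀ t ∈ Icc 0 L, 0 ≤ g t) : ∫ t in y..L, g t ≤ ∫ t in x..L, g t := by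
  have hl : L ∈ Icc 0 L := ⟨hx.1.trans hx.2, le_rfl⟩
  rw [← intervalIntegral.integral_add_adjacent_intervals (hg.intervalIntegrable hx hy)
    (hg.intervalIntegrable hy hl)]
  linarith [integral_nonneg_of_Icc hx hy hxy h]

lemma BddOn.sq_integral_mul_le (hg : BddOn L g) (hk : BddOn L k) {x y : ℝ} (hx : x ∈ Icc 0 L)
    (hy : y ∈ Icc 0 L) (hxy : x ≤ y) :
    (∫ t in x..y, g t * k t) ^ 2 ≤ (∫ t in x..y, g t ^ 2) * ∫ t in x..y, k t ^ 2 :=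
  Milne.sq_integral_mul_le hxy (hg.pow_two.intervalIntegrable hx hy)
    (hk.pow_two.intervalIntegrable hx hy) ((hg.mul hk).intervalIntegrable hx hy)

lemma bddOn_exp (L k : ℝ) : BddOn L fun η => exp (k * η) :=
  bddOn_of_continuousOn (by fun_prop)

end BddOn

/-- The angular moments of a solution: the average `q`, the variance `n`, the flux `J` and the
moments `a`, `d` of the fluctuation with the weights `sin² φ`, `cos 2φ`, together with the average
`p`, the second moment `e` and the first moment `s` of the source. -/
structure Moments (A L β : ℝ) (q n J a d p e s : ℝ → ℝ) : Prop where
  one_le : 1 ≤ L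
  le : 6 * L ≤ A
  bdd_q : BddOn L q
  bdd_n : BddOn L n
  bdd_J : BddOn L J
  bdd_d : BddOn L d
  bdd_p : BddOn L p
  bdd_e : BddOn L e
  bdd_s : BddOn L s
  a_sq : ∀ η ∈ Icc 0 L, a η ^ 2 ≤ 2 * π * n η
  d_sq : ∀ η ∈ Icc 0 L, d η ^ 2 ≤ 2 * π * n η
  s_sq : ∀ η ∈ Icc 0 L, s η ^ 2 ≤ 2 * π * e η
  p_sq : ∀ η ∈ Icc 0 L, 2 * π * p η ^ 2 ≤ e η
  flux : ∀ η ∈ Icc 0 L, (A - η) * J η = -∫ y in η..L, (A - y) * (2 * π * p y)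
  beta : ∀ η ∈ Icc 0 L, β - (π * q η + a η) = ∫ y in η..L, (-((A - y)⁻¹ * d y) + s y - J y)

namespace Moments

variable {A L β : ℝ} {q n J a d p e s : ℝ → ℝ}

lemma nonneg (h : Moments A L β q n J a d p e s) : 0 ≤ L := by linarith [h.one_le]

lemma zero_mem (h : Moments A L β q n J a d p e s) : (0 : ℝ) ∈ Icc 0 L := ⟨le_rfl, h.nonneg⟩

lemma self_mem (h : Moments A L β q n J a d p e s) : L ∈ Icc 0 L := ⟨h.nonneg, le_rfl⟩

lemma n_nonneg (h : Moments A L β q n J a d p e s) : ∀ η ∈ Icc 0 L, 0 ≤ n η := fun η hη =>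
  nonneg_of_mul_nonneg_right ((sq_nonneg _).trans (h.a_sq η hη)) two_pi_pos

lemma bdd_inv (h : Moments A L β q n J a d p e s) : BddOn L fun y => (A - y)⁻¹ := by
  refine bddOn_of_continuousOn (ContinuousOn.inv₀ (by fun_prop) fun y hy => ?_)
  have := h.le
  have := h.one_le
  have := hy.2
  intro h0
  linarith

/-- The decomposition of the average. -/
lemma pi_mul_q (h : Moments A L β q n J a d p e s) {η : ℝ} (hη : η ∈ Icc 0 L) :
    π * q η = β - a η + (∫ y in η..L, (A - y)⁻¹ * d y) - (∫ y in η..L, s y)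
      + ∫ y in η..L, J y := by
  have hb := h.beta η hη
  have hs := h.bdd_s.intervalIntegrable hη h.self_mem
  have hin := (h.bdd_inv.mul h.bdd_d).neg.intervalIntegrable hη h.self_mem
  rw [intervalIntegral.integral_sub (hin.add hs) (h.bdd_J.intervalIntegrable hη h.self_mem),
    intervalIntegral.integral_add hin hs, intervalIntegral.integral_neg] at hb
  linarith

/-- On `[η, L]` the weight satisfies `0 ≤ A - y ≤ A - η`, so the geometric factor can be divided out
of the flux identity. -/
lemma abs_J_le (h : Moments A L β q n J a d p e s) {η : ℝ} (hη : η ∈ Icc 0 L) :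
    |J η| ≤ 2 * π * ∫ y in η..L, |p y| := by
  have hpos : 0 < A - η := by linarith [hη.2, h.le, h.one_le]
  have h1 : |(A - η) * J η| ≤ ∫ y in η..L, (A - η) * (2 * π) * |p y| := by
    rw [h.flux η hη, abs_neg, ← norm_eq_abs]
    refine intervalIntegral.norm_integral_le_of_norm_le hη.2 (.of_forall fun y hy => ?_)
      ((h.bdd_p.abs.const_mul _).intervalIntegrable hη h.self_mem)
    have hy0 : 0 ≤ A - y := by linarith [hy.2, h.le, h.one_le]
    rw [norm_eq_abs, abs_mul, abs_mul, abs_of_nonneg hy0, abs_of_pos two_pi_pos, ← mul_assoc]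
    gcongr
    exact hy.1.le
  rw [intervalIntegral.integral_const_mul, abs_mul, abs_of_pos hpos, mul_assoc] at h1
  exact le_of_mul_le_mul_left h1 hpos

lemma abs_integral_J_le (h : Moments A L β q n J a d p e s) {η : ℝ} (hη : η ∈ Icc 0 L) :
    |∫ y in η..L, J y| ≤ 2 * π * ∫ y in η..L, ∫ z in y..L, |p z| := by
  rw [← intervalIntegral.integral_const_mul]
  exact ((h.bdd_p.abs.tail h.nonneg).const_mul _).abs_integral_le hη h.self_mem hη.2
    fun y hy => h.abs_J_le hy

/-- The contribution of the force is small. -/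
lemma exp_mul_sq_force_le (h : Moments A L β q n J a d p e s) {η K : ℝ} (hK : 0 ≤ K)
    (hη : η ∈ Icc 0 L) :
    exp (2 * K * η) * (∫ y in η..L, (A - y)⁻¹ * d y) ^ 2 * L
      ≤ ∫ y in (0 : ℝ)..L, exp (2 * K * y) * n y := by
  have hL := h.one_le
  have hi := h.bdd_inv.mul h.bdd_d
  have hN := (bddOn_exp L (2 * K)).mul h.bdd_n
  have h1 := hi.sq_integral_mul_le (bddOn_const L 1) hη h.self_mem hη.2
  simp only [mul_one, one_pow, intervalIntegral.integral_const, smul_eq_mul] at h1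
  -- `A ≥ 6L` gives `A - y ≥ 5L`, and `2π ≤ 25`, so `((A - y)⁻¹ d)² ≤ n / L²`. Together with
  -- Cauchy-Schwarz on an interval of length at most `L`, the squared force integral at each `η` is
  -- at most `1/L` times the weighted variance, and integrating over `η` costs only a constant.
  have h2 : exp (2 * K * η) * ∫ y in η..L, ((A - y)⁻¹ * d y) ^ 2
      ≤ (L ^ 2)⁻¹ * ∫ y in η..L, exp (2 * K * y) * n y := by
    rw [← intervalIntegral.integral_const_mul, ← intervalIntegral.integral_const_mul]
    refine intervalIntegral.integral_mono_on hη.2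
      ((hi.pow_two.const_mul _).intervalIntegrable hη h.self_mem)
      ((hN.const_mul _).intervalIntegrable hη h.self_mem) fun y hy => ?_
    have hy' : y ∈ Icc 0 L := ⟨hη.1.trans hy.1, hy.2⟩
    have hn := h.n_nonneg y hy'
    have hA : 5 * L ≤ A - y := by linarith [h.le, hy.2]
    have hexp : exp (2 * K * η) ≤ exp (2 * K * y) := by
      rw [exp_le_exp]
      nlinarith [hy.1]
    have h3 : ((A - y)⁻¹ * d y) ^ 2 ≤ (L ^ 2)⁻¹ * n y := by
      rw [mul_pow, inv_pow, inv_mul_le_iff₀ (by nlinarith)]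
      have h4 : 2 * π * n y ≤ 25 * n y := by
        have := pi_le_four
        nlinarith
      have h5 : 25 * n y ≤ (A - y) ^ 2 * ((L ^ 2)⁻¹ * n y) := by
        rw [← mul_assoc]
        refine mul_le_mul_of_nonneg_right ?_ hn
        rw [← div_eq_mul_inv, le_div_iff₀ (by positivity)]
        nlinarith
      exact (h.d_sq y hy').trans (h4.trans h5)
    calc exp (2 * K * η) * ((A - y)⁻¹ * d y) ^ 2
        ≤ exp (2 * K * y) * ((L ^ 2)⁻¹ * n y) :=
          mul_le_mul hexp h3 (sq_nonneg _) (exp_pos _).le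
      _ = _ := by ring
  have h6 := hN.integral_anti_left h.zero_mem hη hη.1 fun y hy =>
    mul_nonneg (exp_pos _).le (h.n_nonneg y hy)
  have hN0 : 0 ≤ ∫ y in η..L, exp (2 * K * y) * n y :=
    integral_nonneg_of_Icc hη h.self_mem hη.2 fun y hy =>
      mul_nonneg (exp_pos _).le (h.n_nonneg y hy)
  have hint : 0 ≤ ∫ y in η..L, ((A - y)⁻¹ * d y) ^ 2 :=
    integral_nonneg_of_Icc hη h.self_mem hη.2 fun y _ => sq_nonneg _
  have h7 : (∫ y in η..L, (A - y)⁻¹ * d y) ^ 2 ≤ (∫ y in η..L, ((A - y)⁻¹ * d y) ^ 2) * L :=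
    h1.trans (mul_le_mul_of_nonneg_left (by linarith [hη.1]) hint)
  calc exp (2 * K * η) * (∫ y in η..L, (A - y)⁻¹ * d y) ^ 2 * L
      ≤ exp (2 * K * η) * ((∫ y in η..L, ((A - y)⁻¹ * d y) ^ 2) * L) * L := by gcongr
    _ = (exp (2 * K * η) * ∫ y in η..L, ((A - y)⁻¹ * d y) ^ 2) * L ^ 2 := by ring
    _ ≤ ((L ^ 2)⁻¹ * ∫ y in η..L, exp (2 * K * y) * n y) * L ^ 2 := by gcongr
    _ = ∫ y in η..L, exp (2 * K * y) * n y := by field_simp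
    _ ≤ _ := h6

/-- The weighted distance of the average from its limit. -/
lemma weighted_q_le (h : Moments A L β q n J a d p e s) {K : ℝ} (hK : 0 ≤ K) :
    ∫ y in (0 : ℝ)..L, exp (2 * K * y) * (q y - β / π) ^ 2
      ≤ 4 * (∫ y in (0 : ℝ)..L, exp (2 * K * y) * n y)
        + (∫ y in (0 : ℝ)..L, exp (2 * K * y) * (∫ z in y..L, s z) ^ 2)
        + 20 * ∫ y in (0 : ℝ)..L, exp (2 * K * y) * (∫ z in y..L, ∫ x in z..L, |p x|) ^ 2 := by
  have hL := h.one_le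
  have hexp := bddOn_exp L (2 * K)
  have hn := hexp.mul h.bdd_n
  have hσ := hexp.mul (h.bdd_s.tail h.nonneg).pow_two
  have hT := hexp.mul ((h.bdd_p.abs.tail h.nonneg).tail h.nonneg).pow_two
  have hq := hexp.mul (h.bdd_q.sub (bddOn_const L (β / π))).pow_two
  set N := ∫ y in (0 : ℝ)..L, exp (2 * K * y) * n y with hNdef
  -- Here `9 ≤ π²`, the factor `4` comes from squaring a sum of four terms, `28 = 4 · 7` with `2π ≤
  -- 7`, and `160 = 4 · 40` with `(2π)² ≤ 40`. The constant `4N/L` integrates to `4N`; since `28 + 4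
  -- ≤ 9 · 4`, `N` enters with the factor `4`.
  have hpt : ∀ y ∈ Icc 0 L, 9 * (exp (2 * K * y) * (q y - β / π) ^ 2)
      ≤ 28 * (exp (2 * K * y) * n y) + (4 * (exp (2 * K * y) * (∫ z in y..L, s z) ^ 2)
        + (160 * (exp (2 * K * y) * (∫ z in y..L, ∫ x in z..L, |p x|) ^ 2) + 4 * N / L)) := by
    intro y hy
    have h1 := h.pi_mul_q hy
    have h2 := h.exp_mul_sq_force_le hK hy
    have h3 := h.abs_integral_J_le hy
    have ha := h.a_sq y hy
    have hn0 := h.n_nonneg y hy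
    rw [← hNdef, ← le_div_iff₀ (by linarith)] at h2
    rw [show 4 * N / L = 4 * (N / L) by ring]
    set G := ∫ z in y..L, (A - z)⁻¹ * d z
    set U := ∫ z in y..L, s z
    set Y := ∫ z in y..L, J z
    set T := ∫ z in y..L, ∫ x in z..L, |p x|
    have hY : Y ^ 2 ≤ 40 * T ^ 2 := by
      have h4 : Y ^ 2 ≤ (2 * π * T) ^ 2 := sq_le_sq' (by linarith [(abs_le.1 h3).1])
        (abs_le.1 h3).2
      have h5 : (2 * π) ^ 2 ≤ 40 := by nlinarith [pi_lt_d2, pi_pos]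
      nlinarith [sq_nonneg T]
    have ha' : a y ^ 2 ≤ 7 * n y := by nlinarith [pi_lt_d2]
    have h6 : 9 * (q y - β / π) ^ 2 ≤ 4 * (a y ^ 2 + G ^ 2 + U ^ 2 + Y ^ 2) := by
      have h7 : π * (q y - β / π) = -a y + G - U + Y := by
        rw [mul_sub, mul_div_cancel₀ _ pi_pos.ne', h1]
        ring
      have h8 : 9 * (q y - β / π) ^ 2 ≤ (π * (q y - β / π)) ^ 2 := by
        rw [mul_pow]
        exact mul_le_mul_of_nonneg_right (by nlinarith [pi_gt_three]) (sq_nonneg _)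
      rw [h7] at h8
      nlinarith [sq_nonneg (-a y - G), sq_nonneg (-a y + U), sq_nonneg (-a y - Y),
        sq_nonneg (G + U), sq_nonneg (G - Y), sq_nonneg (U + Y)]
    have hE := exp_pos (2 * K * y)
    have h9 : 9 * (q y - β / π) ^ 2 ≤ 4 * (7 * n y + G ^ 2 + U ^ 2 + 40 * T ^ 2) := by linarith
    calc 9 * (exp (2 * K * y) * (q y - β / π) ^ 2)
        = exp (2 * K * y) * (9 * (q y - β / π) ^ 2) := by ring
      _ ≤ exp (2 * K * y) * (4 * (7 * n y + G ^ 2 + U ^ 2 + 40 * T ^ 2)) := by gcongr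
      _ ≤ _ := by linarith
  have hint := (hq.const_mul 9).integral_mono ((hn.const_mul 28).add ((hσ.const_mul 4).add
    ((hT.const_mul 160).add (bddOn_const L (4 * N / L))))) h.zero_mem h.self_mem h.nonneg hpt
  have ii : ∀ {g : ℝ → ℝ}, BddOn L g → IntervalIntegrable g volume 0 L := fun hg =>
    hg.intervalIntegrable h.zero_mem h.self_mem
  rw [intervalIntegral.integral_add (ii (hn.const_mul 28)) (ii ((hσ.const_mul 4).add
      ((hT.const_mul 160).add (bddOn_const L (4 * N / L))))),
    intervalIntegral.integral_add (ii (hσ.const_mul 4)) (ii ((hT.const_mul 160).add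
      (bddOn_const L (4 * N / L)))),
    intervalIntegral.integral_add (ii (hT.const_mul 160)) (ii (bddOn_const L (4 * N / L))),
    intervalIntegral.integral_const_mul, intervalIntegral.integral_const_mul,
    intervalIntegral.integral_const_mul, intervalIntegral.integral_const_mul,
    intervalIntegral.integral_const, smul_eq_mul, sub_zero,
    mul_div_cancel₀ _ (by linarith : L ≠ 0)] at hint
  have p1 : 0 ≤ N := integral_nonneg_of_Icc h.zero_mem h.self_mem h.nonneg fun y hy =>
      mul_nonneg (exp_pos _).le (h.n_nonneg y hy)
  have p2 : 0 ≤ ∫ y in (0 : ℝ)..L, exp (2 * K * y) * (∫ z in y..L, s z) ^ 2 :=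
    integral_nonneg_of_Icc h.zero_mem h.self_mem h.nonneg fun y _ => by positivity
  have p3 : 0 ≤ ∫ y in (0 : ℝ)..L, exp (2 * K * y) * (∫ z in y..L, ∫ x in z..L, |p x|) ^ 2 :=
    integral_nonneg_of_Icc h.zero_mem h.self_mem h.nonneg fun y _ => by positivity
  rw [← hNdef] at hint
  linarith

lemma n_integral_nonneg (h : Moments A L β q n J a d p e s) (K : ℝ) :
    0 ≤ ∫ y in (0 : ℝ)..L, exp (2 * K * y) * n y :=
  integral_nonneg_of_Icc h.zero_mem h.self_mem h.nonneg fun y hy =>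
    mul_nonneg (exp_pos _).le (h.n_nonneg y hy)

/-- The weighted `L²` estimate. -/
lemma weighted_q_le_of_energy (h : Moments A L β q n J a d p e s) {K H E : ℝ} (hK : 0 ≤ K)
    (hK' : K ≤ 1 / 232) (hE : ∫ y in (0 : ℝ)..L, exp (2 * K * y) * n y
      ≤ H + (2 * K + 1 / 116) * ((∫ y in (0 : ℝ)..L, exp (2 * K * y) * n y)
        + 2 * π * ∫ y in (0 : ℝ)..L, exp (2 * K * y) * (q y - β / π) ^ 2) + 116 * E) :
    ∫ y in (0 : ℝ)..L, exp (2 * K * y) * (q y - β / π) ^ 2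
      ≤ 8 * H + 928 * E
        + 2 * (∫ y in (0 : ℝ)..L, exp (2 * K * y) * (∫ z in y..L, s z) ^ 2)
        + 40 * ∫ y in (0 : ℝ)..L, exp (2 * K * y) * (∫ z in y..L, ∫ x in z..L, |p x|) ^ 2 := by
  have h1 := h.weighted_q_le hK
  have p1 := h.n_integral_nonneg K
  have p2 : 0 ≤ ∫ y in (0 : ℝ)..L, exp (2 * K * y) * (∫ z in y..L, s z) ^ 2 :=
    integral_nonneg_of_Icc h.zero_mem h.self_mem h.nonneg fun y _ => by positivity
  have p3 : 0 ≤ ∫ y in (0 : ℝ)..L, exp (2 * K * y) * (∫ z in y..L, ∫ x in z..L, |p x|) ^ 2 :=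
    integral_nonneg_of_Icc h.zero_mem h.self_mem h.nonneg fun y _ => by positivity
  have p4 : 0 ≤ ∫ y in (0 : ℝ)..L, exp (2 * K * y) * (q y - β / π) ^ 2 :=
    integral_nonneg_of_Icc h.zero_mem h.self_mem h.nonneg fun y _ => by positivity
  generalize (∫ y in (0 : ℝ)..L, exp (2 * K * y) * n y) = N at *
  generalize (∫ y in (0 : ℝ)..L, exp (2 * K * y) * (q y - β / π) ^ 2) = m at *
  generalize (∫ y in (0 : ℝ)..L, exp (2 * K * y) * (∫ z in y..L, s z) ^ 2) = Z at *
  generalize (∫ y in (0 : ℝ)..L, exp (2 * K * y) * (∫ z in y..L, ∫ x in z..L, |p x|) ^ 2) = T at *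
  have h2 : 2 * π * m ≤ 7 * m := by nlinarith [pi_lt_d2]
  -- By `h1` and `2π ≤ 7`, `N + 7m ≤ 29N + 7Z + 140T`. Since `29/58 = 1/2`, half of `N` is absorbed;
  -- this fixes `116 = 2 · 58` and `232 = 2 · 116`.
  have h3 : (2 * K + 1 / 116) * (N + 2 * π * m) ≤ 1 / 58 * (N + 7 * m) :=
    mul_le_mul (by linarith) (by linarith) (by positivity) (by norm_num)
  linarith

/-- The total variation of the source is controlled by its local and its weighted size. -/
lemma integral_abs_p_le (h : Moments A L β q n J a d p e s) {D : ℝ} (hD : 0 ≤ D)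
    (he : ∫ y in (0 : ℝ)..L, e y ≤ D ^ 2)
    (hI : ∫ y in (0 : ℝ)..L, ∫ z in y..L, |p z| ≤ D) :
    ∫ y in (0 : ℝ)..L, |p y| ≤ 2 * D := by
  have hL := h.one_le
  have h1 : (1 : ℝ) ∈ Icc 0 L := ⟨zero_le_one, hL⟩
  have hp := h.bdd_p.abs
  have hT := hp.tail h.nonneg
  have he0 : ∀ y ∈ Icc 0 L, 0 ≤ e y := fun y hy =>
    (mul_nonneg two_pi_pos.le (sq_nonneg _)).trans (h.p_sq y hy)
  rw [← intervalIntegral.integral_add_adjacent_intervals (hp.intervalIntegrable h.zero_mem h1)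
    (hp.intervalIntegrable h1 h.self_mem)]
  -- Near the boundary the mass of `p` is controlled by its `L²` norm.
  have e1 : ∫ y in (0 : ℝ)..1, |p y| ≤ D := by
    have h2 := hp.sq_integral_mul_le (bddOn_const L 1) h.zero_mem h1 zero_le_one
    simp only [mul_one, one_pow, intervalIntegral.integral_const, smul_eq_mul, sub_zero] at h2
    have h3 : ∫ y in (0 : ℝ)..1, |p y| ^ 2 ≤ ∫ y in (0 : ℝ)..1, e y :=
      hp.pow_two.integral_mono h.bdd_e h.zero_mem h1 zero_le_one fun y hy => by
        rw [sq_abs]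
        have := h.p_sq y hy
        nlinarith [pi_gt_three, sq_nonneg (p y)]
    have h4 : ∫ y in (0 : ℝ)..1, e y ≤ ∫ y in (0 : ℝ)..L, e y := by
      rw [← intervalIntegral.integral_add_adjacent_intervals
        (h.bdd_e.intervalIntegrable h.zero_mem h1) (h.bdd_e.intervalIntegrable h1 h.self_mem)]
      linarith [integral_nonneg_of_Icc h1 h.self_mem hL he0]
    exact abs_le_of_sq_le_sq' (by linarith) hD |>.2
  -- Beyond `η = 1` it is controlled by the double integral: the tail from `1` is at most the tail
  -- from any `y ≤ 1`.
  have e2 : ∫ y in (1 : ℝ)..L, |p y| ≤ D := by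
    have h2 : ∫ y in (0 : ℝ)..1, ∫ z in (1 : ℝ)..L, |p z| ≤ ∫ y in (0 : ℝ)..1, ∫ z in y..L, |p z| :=
      intervalIntegral.integral_mono_on zero_le_one intervalIntegrable_const
        (hT.intervalIntegrable h.zero_mem h1) fun y hy =>
          hp.integral_anti_left ⟨hy.1, hy.2.trans hL⟩ h1 hy.2 fun z _ => abs_nonneg _
    rw [intervalIntegral.integral_const, smul_eq_mul, sub_zero, one_mul] at h2
    have h3 : ∫ y in (0 : ℝ)..1, ∫ z in y..L, |p z| ≤ ∫ y in (0 : ℝ)..L, ∫ z in y..L, |p z| := by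
      rw [← intervalIntegral.integral_add_adjacent_intervals
        (hT.intervalIntegrable h.zero_mem h1) (hT.intervalIntegrable h1 h.self_mem)]
      have : 0 ≤ ∫ y in (1 : ℝ)..L, ∫ z in y..L, |p z| :=
        integral_nonneg_of_Icc h1 h.self_mem hL fun y hy =>
          integral_nonneg_of_Icc hy h.self_mem hy.2 fun z _ => abs_nonneg _
      linarith
    linarith
  linarith

/-- The interaction of the two parts of the source. -/
lemma abs_integral_source_le (h : Moments A L β q n J a d p e s) {D : ℝ} (hD : 0 ≤ D)
    (he : ∫ y in (0 : ℝ)..L, e y ≤ D ^ 2) (hs : |∫ y in (0 : ℝ)..L, s y| ≤ D)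
    (hI : ∫ y in (0 : ℝ)..L, ∫ z in y..L, |p z| ≤ D) {w : ℝ → ℝ} (hw : BddOn L w)
    (hwp : ∀ y ∈ Icc 0 L, |w y| ≤ |p y|) :
    |∫ y in (0 : ℝ)..L, w y * ∫ z in y..L, s z| ≤ 6 * D ^ 2 := by
  have hL := h.nonneg
  have hQ := h.integral_abs_p_le hD he hI
  have hp := h.bdd_p.abs
  have hT := hp.tail hL
  have hwT := hw.tail hL
  have hprim : ∀ {g : ℝ → ℝ}, BddOn L g →
      IsPrimitiveOn (fun t => ∫ y in t..L, g y) (fun t => -g t) 0 L := by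
    intro g hg
    refine ⟨hg.neg.intervalIntegrable h.zero_mem h.self_mem, fun t ht => ?_⟩
    rw [← intervalIntegral.integral_add_adjacent_intervals (hg.intervalIntegrable h.zero_mem ht)
      (hg.intervalIntegrable ht h.self_mem), intervalIntegral.integral_neg]
    ring
  -- Integration by parts. The data control the tail of `s` only at `η = 0`, so the tail is moved
  -- from `s` to `w`, where the square of the tail of `w` is integrable.
  have hmul := ((hprim hw).mul (hprim h.bdd_s) hL).sub_eq L h.self_mem
  have hA := hw.neg.mul (h.bdd_s.tail hL)
  have hB := hwT.mul h.bdd_s.neg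
  rw [intervalIntegral.integral_add (hA.intervalIntegrable h.zero_mem h.self_mem)
    (hB.intervalIntegrable h.zero_mem h.self_mem)] at hmul
  simp only [intervalIntegral.integral_same, zero_mul, neg_mul, mul_neg,
    intervalIntegral.integral_neg] at hmul
  have h1 : |∫ y in (0 : ℝ)..L, w y| ≤ 2 * D :=
    (hp.abs_integral_le h.zero_mem h.self_mem hL hwp).trans hQ
  have hT0 : ∀ y ∈ Icc 0 L, 0 ≤ ∫ z in y..L, |p z| := fun y hy =>
    integral_nonneg_of_Icc hy h.self_mem hy.2 fun z _ => abs_nonneg _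
  have h2 : ∀ y ∈ Icc 0 L, (∫ z in y..L, w z) ^ 2 ≤ 2 * D * ∫ z in y..L, |p z| := by
    intro y hy
    have h3 := hp.abs_integral_le hy h.self_mem hy.2 hwp
    have h4 := hp.integral_anti_left h.zero_mem hy hy.1 fun z _ => abs_nonneg _
    rw [← sq_abs, sq]
    exact mul_le_mul (h3.trans (h4.trans hQ)) h3 (abs_nonneg _) (by linarith)
  have h3 : ∫ y in (0 : ℝ)..L, (∫ z in y..L, w z) ^ 2 ≤ 2 * D * D := by
    refine (hwT.pow_two.integral_mono (hT.const_mul (2 * D)) h.zero_mem h.self_mem hL h2).trans ?_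
    rw [intervalIntegral.integral_const_mul]
    exact mul_le_mul_of_nonneg_left hI (by linarith)
  have h4 : ∫ y in (0 : ℝ)..L, s y ^ 2 ≤ 8 * D ^ 2 := by
    refine (h.bdd_s.pow_two.integral_mono (h.bdd_e.const_mul 8) h.zero_mem h.self_mem hL
      fun y hy => ?_).trans ?_
    · have he0 : 0 ≤ e y := (mul_nonneg two_pi_pos.le (sq_nonneg _)).trans (h.p_sq y hy)
      have := h.s_sq y hy
      nlinarith [pi_le_four]
    · rw [intervalIntegral.integral_const_mul]
      linarith
  have h5 : |∫ y in (0 : ℝ)..L, (∫ z in y..L, w z) * s y| ≤ 4 * D ^ 2 := by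
    refine abs_le_of_sq_le_sq ?_ (by positivity)
    refine (hwT.sq_integral_mul_le h.bdd_s h.zero_mem h.self_mem hL).trans ?_
    calc _ ≤ (2 * D * D) * (8 * D ^ 2) := mul_le_mul h3 h4
          (integral_nonneg_of_Icc h.zero_mem h.self_mem hL fun y _ => sq_nonneg _) (by positivity)
      _ = _ := by ring
  have h6 : |(∫ y in (0 : ℝ)..L, w y) * ∫ y in (0 : ℝ)..L, s y| ≤ 2 * D * D := by
    rw [abs_mul]
    exact mul_le_mul h1 hs (abs_nonneg _) (by linarith)
  rw [show (∫ y in (0 : ℝ)..L, w y * ∫ z in y..L, s z)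
    = (∫ y in (0 : ℝ)..L, w y) * (∫ y in (0 : ℝ)..L, s y)
      - ∫ y in (0 : ℝ)..L, (∫ z in y..L, w z) * s y by linarith]
  refine (abs_sub _ _).trans ?_
  linarith

/-- The bound of the limit. -/
lemma abs_beta_le (h : Moments A L β q n J a d p e s) {D O H : ℝ} (hD : 0 ≤ D)
    (he : ∫ y in (0 : ℝ)..L, e y ≤ D ^ 2) (hs : |∫ y in (0 : ℝ)..L, s y| ≤ D)
    (hI : ∫ y in (0 : ℝ)..L, ∫ z in y..L, |p z| ≤ D) (hO : 0 ≤ O) (hH : H ≤ D ^ 2)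
    (hb : (π * q 0 + a 0) ^ 2 ≤ 4 * (H + O))
    (hE : O + ∫ y in (0 : ℝ)..L, n y ≤ H + 8 * (∫ y in (0 : ℝ)..L, e y)
      + 1 / 8 * (∫ y in (0 : ℝ)..L, n y)
      + 4 * ∫ y in (0 : ℝ)..L, (1 - y / A) * p y * (π * q y)) :
    |β| ≤ 160 * D := by
  have hL := h.nonneg
  have hL1 := h.one_le
  have hA : 0 < A := by linarith [h.le]
  have hQ := h.integral_abs_p_le hD he hI
  have hp := h.bdd_p.abs
  have hn2 : 0 ≤ ∫ y in (0 : ℝ)..L, n y :=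
    integral_nonneg_of_Icc h.zero_mem h.self_mem hL h.n_nonneg
  set X := √(O + ∫ y in (0 : ℝ)..L, n y) with hX
  have hX0 : 0 ≤ X := sqrt_nonneg _
  have hX2 : X ^ 2 = O + ∫ y in (0 : ℝ)..L, n y := sq_sqrt (by linarith)
  have hG : ∀ y ∈ Icc 0 L, |∫ z in y..L, (A - z)⁻¹ * d z| ≤ X := by
    intro y hy
    refine abs_le_of_sq_le_sq ?_ hX0
    have h1 := h.exp_mul_sq_force_le (K := 0) le_rfl hy
    simp only [mul_zero, zero_mul, exp_zero, one_mul] at h1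
    nlinarith [sq_nonneg (∫ z in y..L, (A - z)⁻¹ * d z)]
  have hJ : ∀ y ∈ Icc 0 L, |∫ z in y..L, J z| ≤ 7 * D := by
    intro y hy
    refine (h.abs_integral_J_le hy).trans ?_
    have h1 := (hp.tail hL).integral_anti_left h.zero_mem hy hy.1 fun z hz =>
      integral_nonneg_of_Icc hz h.self_mem hz.2 fun z _ => abs_nonneg (p z)
    have h2 : 0 ≤ ∫ z in y..L, ∫ x in z..L, |p x| :=
      integral_nonneg_of_Icc hy h.self_mem hy.2 fun z hz =>
        integral_nonneg_of_Icc hz h.self_mem hz.2 fun z _ => abs_nonneg (p z)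
    nlinarith [pi_lt_d2]
  have hβ : |β| ≤ 10 * D + 3 * X := by
    have h1 := h.pi_mul_q h.zero_mem
    have h2 : |π * q 0 + a 0| ≤ 2 * (D + X) := by
      refine abs_le_of_sq_le_sq (hb.trans ?_) (by positivity)
      nlinarith [mul_nonneg hD hX0]
    have h3 := hG 0 h.zero_mem
    have h4 := hJ 0 h.zero_mem
    rw [abs_le] at h2 h3 h4 hs ⊢
    constructor <;> linarith [h2.1, h2.2, h3.1, h3.2, h4.1, h4.2, hs.1, hs.2]
  have hw1 : BddOn L fun y => 1 - y / A := bddOn_of_continuousOn (by fun_prop)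
  have hw := hw1.mul h.bdd_p
  have hwp : ∀ y ∈ Icc 0 L, |(1 - y / A) * p y| ≤ |p y| := by
    intro y hy
    have h1 : y / A ≤ 1 := by rw [div_le_one hA]; linarith [hy.2, h.le]
    have h2 : 0 ≤ y / A := div_nonneg hy.1 hA.le
    rw [abs_mul]
    exact mul_le_of_le_one_left (abs_nonneg _) (abs_le.2 ⟨by linarith, by linarith⟩)
  have ii : ∀ {g : ℝ → ℝ}, BddOn L g → IntervalIntegrable g volume 0 L := fun hg =>
    hg.intervalIntegrable h.zero_mem h.self_mem
  have hσ := hw.mul (h.bdd_s.tail hL)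
  have hbnd : BddOn L fun y => (|β| + X + 7 * D) * |p y| + (10 * e y + 1 / 32 * n y) :=
    (hp.const_mul _).add ((h.bdd_e.const_mul 10).add (h.bdd_n.const_mul _))
  have hmain : ∫ y in (0 : ℝ)..L, (1 - y / A) * p y * (π * q y)
      ≤ (|β| + X + 7 * D) * (2 * D) + (10 * (∫ y in (0 : ℝ)..L, e y)
        + 1 / 32 * ∫ y in (0 : ℝ)..L, n y) + 6 * D ^ 2 := by
    have h1 := (hw.mul (h.bdd_q.const_mul π)).integral_mono
      (hbnd.sub hσ) h.zero_mem h.self_mem hL fun y hy => by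
        have e1 := h.pi_mul_q hy
        have e2 := hG y hy
        have e3 := hJ y hy
        have e4 := hwp y hy
        -- In the product of source and average, `β`, the force integral and the flux integral are
        -- uniformly bounded and pair with `∫ |p| ≤ 2D`. The fluctuation `a` is treated by Young's
        -- inequality, and the tail of `s` by `abs_integral_source_le`.
        have e5 : (1 - y / A) * p y * (β + (∫ z in y..L, (A - z)⁻¹ * d z) + ∫ z in y..L, J z)
            ≤ (|β| + X + 7 * D) * |p y| := by
          refine (le_abs_self _).trans ?_
          rw [abs_mul, mul_comm]
          refine mul_le_mul ?_ e4 (abs_nonneg _) (by positivity)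
          exact (abs_add_three _ _ _).trans (by linarith)
        have e6 : -((1 - y / A) * p y * a y) ≤ 10 * e y + 1 / 32 * n y := by
          refine (neg_le_abs _).trans ?_
          rw [abs_mul]
          have g1 := h.a_sq y hy
          have g2 := h.p_sq y hy
          have g3 := h.n_nonneg y hy
          have g4 : |(1 - y / A) * p y| * |a y| ≤ |p y| * |a y| := by gcongr
          have g5 : |p y| * |a y| ≤ 56 * |p y| ^ 2 + |a y| ^ 2 / 224 := by
            nlinarith [sq_nonneg (112 * |p y| - |a y|)]
          rw [sq_abs, sq_abs] at g5
          nlinarith [pi_gt_three, pi_lt_d2, sq_nonneg (p y)]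
        rw [e1]
        linarith
    rw [intervalIntegral.integral_sub (ii hbnd) (ii hσ),
      intervalIntegral.integral_add (ii (hp.const_mul _))
        (ii ((h.bdd_e.const_mul 10).add (h.bdd_n.const_mul _))),
      intervalIntegral.integral_add (ii (h.bdd_e.const_mul 10)) (ii (h.bdd_n.const_mul _)),
      intervalIntegral.integral_const_mul, intervalIntegral.integral_const_mul,
      intervalIntegral.integral_const_mul] at h1
    have h2 := h.abs_integral_source_le hD he hs hI hw hwp
    have h3 : (|β| + X + 7 * D) * (∫ y in (0 : ℝ)..L, |p y|) ≤ (|β| + X + 7 * D) * (2 * D) :=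
      mul_le_mul_of_nonneg_left hQ (by positivity)
    linarith [(abs_le.1 h2).1]
  have hfin : X ≤ 50 * D := by
    refine abs_le_of_sq_le_sq' ?_ (by positivity) |>.2
    have h1 : |β| * (2 * D) ≤ (10 * D + 3 * X) * (2 * D) := by gcongr
    -- The inequalities amount to `(3/4) X² ≤ 209 D² + 32 D X`. The square absorbs `32 D X` into
    -- `X²/4 + 1024 D²`, whence `X² ≤ 2466 D²`. With `|β| ≤ 10D + 3X` this gives the constant `160`.
    nlinarith [sq_nonneg (X - 64 * D)]
  linarith

end Moments


/-! ### The bounds of the limit and of the weighted average of a solution -/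

section

variable {A L : ℝ} {S f : ℝ → ℝ → ℝ}

lemma integral_neg_pi_pi_eq {u : ℝ → ℝ} (h1 : IntervalIntegrable u volume (-π) 0)
    (h2 : IntervalIntegrable u volume 0 π) :
    ∫ φ in (-π)..π, u φ = (∫ φ in (0 : ℝ)..π, u φ) + ∫ φ in (0 : ℝ)..π, u (-φ) := by
  rw [← intervalIntegral.integral_add_adjacent_intervals h1 h2,
    intervalIntegral.integral_comp_neg, neg_zero, add_comm]

lemma IsLineSolution.moments (hf : IsLineSolution A L S f) (h1 : 1 ≤ L) (h6 : 6 * L ≤ A) :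
    Moments A L (angInt (fun η φ => sin φ ^ 2 * f η φ) L) (mean f)
      (angInt fun η φ => fluct f η φ ^ 2) (sinMoment f)
      (angInt fun η φ => sin φ ^ 2 * fluct f η φ) (angInt fun η φ => cos (2 * φ) * fluct f η φ)
      (mean S) (angInt fun η φ => S η φ ^ 2) (sinMoment S) where
  one_le := h1
  le := h6
  bdd_q := hf.admissible.bddOn_mean
  bdd_n := hf.admissible.fluct.pow_two.bddOn_angInt
  bdd_J := hf.admissible.bddOn_sinMoment
  bdd_d := ((admissible_cos_two L).mul hf.admissible.fluct).bddOn_angInt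
  bdd_p := hf.source.bddOn_mean
  bdd_e := hf.source.pow_two.bddOn_angInt
  bdd_s := hf.source.bddOn_sinMoment
  a_sq := fun η hη => sq_angInt_mul_le (admissible_sin L).pow_two hf.admissible.fluct hη
    fun φ => by rw [abs_of_nonneg (sq_nonneg _)]; exact sin_sq_le_one φ
  d_sq := fun η hη => sq_angInt_mul_le (admissible_cos_two L) hf.admissible.fluct hη
    fun φ => abs_cos_le_one _
  s_sq := fun η hη => sq_angInt_mul_le (admissible_sin L) hf.source hη abs_sin_le_one
  p_sq := fun η hη => two_pi_mul_mean_sq_le hf.source hη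
  flux := fun η hη => hf.sinMoment_eq hη
  beta := fun η hη => by rw [← hf.sin_sq_eq hη, ← angInt_sin_sq_mul hf.admissible hη]

lemma sinMoment_split {η : ℝ} {u : ℝ → ℝ → ℝ} (hu : Admissible L u) (hη : η ∈ Icc 0 L) :
    sinMoment u η = (∫ φ in (0 : ℝ)..π, sin φ * u η φ) - ∫ φ in (0 : ℝ)..π, sin φ * u η (-φ) := by
  have hi := ((admissible_sin L).mul hu).intervalIntegrable_angle hη
  rw [sinMoment, integral_neg_pi_pi_eq (hi _ _) (hi _ _), sub_eq_add_neg,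
    ← intervalIntegral.integral_neg]
  simp only [sin_neg, neg_mul]

lemma integral_sin_mul_sq_nonneg (u : ℝ → ℝ) : 0 ≤ ∫ φ in (0 : ℝ)..π, sin φ * u φ ^ 2 :=
  intervalIntegral.integral_nonneg pi_pos.le fun _ hφ =>
    mul_nonneg (sin_nonneg_of_nonneg_of_le_pi hφ.1 hφ.2) (sq_nonneg _)

lemma Admissible.comp_neg {u : ℝ → ℝ → ℝ} (hu : Admissible L u) :
    Admissible L fun η φ => u η (-φ) := by
  refine ⟨hu.measurable.comp (measurable_fst.prodMk measurable_snd.neg), fun η hη _ => ?_, ?_⟩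
  · rw [neg_add, ← sub_eq_add_neg, (hu.periodic η hη).sub_eq]
  · obtain ⟨M, hM⟩ := hu.bounded
    exact ⟨M, fun η hη φ => hM η hη _⟩

/-- Cauchy-Schwarz for the weight `sin φ`, whose integral over `(0, π)` is `2`. It bounds the `sin²`
moment at `η = 0` by incoming and outgoing energies. -/
lemma sq_integral_sin_sq_mul_le {η : ℝ} {u : ℝ → ℝ → ℝ} (hu : Admissible L u)
    (hη : η ∈ Icc 0 L) :
    (∫ φ in (0 : ℝ)..π, sin φ ^ 2 * u η φ) ^ 2 ≤ 2 * ∫ φ in (0 : ℝ)..π, sin φ * u η φ ^ 2 := by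
  have hs := admissible_sin L
  have hsq : Admissible L fun _ φ => √|sin φ| := by
    refine admissible_of_snd (M := 1) (by fun_prop) (fun φ => by rw [sin_add_two_pi]) fun φ => ?_
    rw [abs_of_nonneg (sqrt_nonneg _), sqrt_le_iff]
    exact ⟨zero_le_one, by rw [one_pow]; exact abs_sin_le_one φ⟩
  -- The weight is split as `√|sin φ| · √|sin φ|`; the absolute value makes both factors bounded and
  -- periodic on the whole line.
  have h1 := sq_integral_mul_le pi_pos.le (f := fun φ => √|sin φ|)
    (g := fun φ => √|sin φ| * (sin φ * u η φ))
    (hsq.pow_two.intervalIntegrable_angle hη _ _)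
    ((hsq.mul (hs.mul hu)).pow_two.intervalIntegrable_angle hη _ _)
    ((hsq.mul (hsq.mul (hs.mul hu))).intervalIntegrable_angle hη _ _)
  have h2 : ∫ φ in (0 : ℝ)..π, √|sin φ| * (√|sin φ| * (sin φ * u η φ))
      = ∫ φ in (0 : ℝ)..π, sin φ ^ 2 * u η φ := by
    refine intervalIntegral.integral_congr fun φ hφ => ?_
    rw [uIcc_of_le pi_pos.le] at hφ
    have h0 := sin_nonneg_of_nonneg_of_le_pi hφ.1 hφ.2
    rw [← mul_assoc, mul_self_sqrt (abs_nonneg _), abs_of_nonneg h0]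
    ring
  have h3 : ∫ φ in (0 : ℝ)..π, √|sin φ| ^ 2 = 2 := by
    rw [show (2 : ℝ) = ∫ φ in (0 : ℝ)..π, sin φ by rw [integral_sin]; norm_num]
    refine intervalIntegral.integral_congr fun φ hφ => ?_
    rw [uIcc_of_le pi_pos.le] at hφ
    rw [sq_sqrt (abs_nonneg _), abs_of_nonneg (sin_nonneg_of_nonneg_of_le_pi hφ.1 hφ.2)]
  rw [h2, h3] at h1
  refine h1.trans (mul_le_mul_of_nonneg_left ?_ zero_le_two)
  refine intervalIntegral.integral_mono_on pi_pos.le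
    ((hsq.mul (hs.mul hu)).pow_two.intervalIntegrable_angle hη _ _)
    ((hs.mul hu.pow_two).intervalIntegrable_angle hη _ _) fun φ hφ => ?_
  have h0 := sin_nonneg_of_nonneg_of_le_pi hφ.1 hφ.2
  rw [mul_pow, sq_sqrt (abs_nonneg _), abs_of_nonneg h0, mul_pow]
  have := sin_sq_le_one φ
  refine mul_le_mul_of_nonneg_left ?_ h0
  exact mul_le_of_le_one_left (sq_nonneg _) this

/-- The bound of the limit of a solution. -/
theorem IsLineSolution.abs_limit_le (hf : IsLineSolution A L S f) (h1 : 1 ≤ L) (h6 : 6 * L ≤ A)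
    {D : ℝ} (hD : 0 ≤ D) (hH : ∫ φ in (0 : ℝ)..π, sin φ * f 0 φ ^ 2 ≤ D ^ 2)
    (he : ∫ y in (0 : ℝ)..L, angInt (fun η φ => S η φ ^ 2) y ≤ D ^ 2)
    (hs : |∫ y in (0 : ℝ)..L, sinMoment S y| ≤ D)
    (hI : ∫ y in (0 : ℝ)..L, ∫ z in y..L, |mean S z| ≤ D) :
    |angInt (fun η φ => sin φ ^ 2 * f η φ) L| ≤ 160 * D := by
  have hm := hf.moments h1 h6
  have h0 := hm.zero_mem
  have hl := hm.self_mem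
  have hA : 0 < A := by linarith
  refine hm.abs_beta_le hD he hs hI (O := ∫ φ in (0 : ℝ)..π, sin φ * f 0 (-φ) ^ 2)
    (integral_sin_mul_sq_nonneg _) hH ?_ ?_
  · rw [← angInt_sin_sq_mul hf.admissible h0]
    have hi := ((admissible_sin L).pow_two.mul hf.admissible).intervalIntegrable_angle h0
    rw [angInt, integral_neg_pi_pi_eq (hi _ _) (hi _ _)]
    simp only [sin_neg, neg_sq]
    have e1 := sq_integral_sin_sq_mul_le hf.admissible h0
    have e2 := sq_integral_sin_sq_mul_le hf.admissible.comp_neg h0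
    refine (add_sq_le).trans ?_
    linarith
  · have hE := hf.energy_eq 0 0
    have hsp := sinMoment_split (hf.admissible.pow_two) h0
    simp only [sub_zero, mul_zero, zero_mul, zero_add, exp_zero, one_mul] at hE
    rw [hsp] at hE
    have hw : BddOn L fun y => 1 - y / A := bddOn_of_continuousOn (by fun_prop)
    have hpq := (hw.mul hm.bdd_p).mul (hm.bdd_q.const_mul π)
    have hlin : BddOn L fun y => A - y := bddOn_of_continuousOn (by fun_prop)
    have hint := hlin.mul ((((hf.source.mul hf.admissible).bddOn_angInt).sub
      hm.bdd_n).const_mul 2)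
    have hbnd : BddOn L fun y => A * (8 * angInt (fun η φ => S η φ ^ 2) y
        + (-(7 / 8) * angInt (fun η φ => fluct f η φ ^ 2) y
          + 4 * ((1 - y / A) * mean S y * (π * mean f y)))) :=
      ((hm.bdd_e.const_mul 8).add ((hm.bdd_n.const_mul _).add (hpq.const_mul 4))).const_mul A
    have hmono := hint.integral_mono hbnd h0 hl hm.nonneg fun y hy => by
      have e1 := angInt_mul_eq hf.admissible hf.source hy
      -- Young's inequality with a small share of the variance. Of the coefficient `2 - 1/8` left
      -- over, `A - y ≥ 5A/6` preserves more than the required `7/8`.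
      have e2 : 2 * angInt (fun η φ => S η φ * fluct f η φ) y
          ≤ 8 * angInt (fun η φ => S η φ ^ 2) y
            + 1 / 8 * angInt (fun η φ => fluct f η φ ^ 2) y := by
        have e3 := angInt_mono ((hf.source.mul hf.admissible.fluct).const_mul 2)
          ((hf.source.pow_two.const_mul 8).add (hf.admissible.fluct.pow_two.const_mul (1 / 8))) hy
          fun φ => by nlinarith [sq_nonneg (8 * S y φ - fluct f y φ)]
        rwa [angInt_add (hf.source.pow_two.const_mul 8)
          (hf.admissible.fluct.pow_two.const_mul (1 / 8)) hy,
          angInt_mul_left (fun _ => 2) (fun η φ => S η φ * fluct f η φ),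
          angInt_mul_left (fun _ => 8) (fun η φ => S η φ ^ 2),
          angInt_mul_left (fun _ => 1 / 8) (fun η φ => fluct f η φ ^ 2)] at e3
      have e4 := hm.n_nonneg y hy
      have e5 : 0 ≤ angInt (fun η φ => S η φ ^ 2) y :=
        angInt_nonneg (u := fun η φ => S η φ ^ 2) fun φ => sq_nonneg _
      have e6 : A * ((1 - y / A) * mean S y * (π * mean f y))
          = (A - y) * (π * (mean S y * mean f y)) := by field_simp
      have e7 : 0 ≤ A - y := by linarith [hy.2]
      have e8 : 5 / 6 * A ≤ A - y := by linarith [hy.2]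
      rw [e1]
      have e9 : (A - y) * (2 * angInt (fun η φ => S η φ * fluct f η φ) y)
          ≤ (A - y) * (8 * angInt (fun η φ => S η φ ^ 2) y
            + 1 / 8 * angInt (fun η φ => fluct f η φ ^ 2) y) := mul_le_mul_of_nonneg_left e2 e7
      have e10 : (A - y) * angInt (fun η φ => S η φ ^ 2) y
          ≤ A * angInt (fun η φ => S η φ ^ 2) y := mul_le_mul_of_nonneg_right (by linarith [hy.1]) e5
      have e11 : 5 / 6 * A * angInt (fun η φ => fluct f η φ ^ 2) y
          ≤ (A - y) * angInt (fun η φ => fluct f η φ ^ 2) y := mul_le_mul_of_nonneg_right e8 e4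
      have e12 : 0 ≤ A * angInt (fun η φ => fluct f η φ ^ 2) y := mul_nonneg hA.le e4
      linear_combination e9 + 8 * e10 + 15 / 8 * e11 + 11 / 16 * e12 - 4 * e6
    have ii : ∀ {g : ℝ → ℝ}, BddOn L g → IntervalIntegrable g volume 0 L := fun hg =>
      hg.intervalIntegrable h0 hl
    rw [intervalIntegral.integral_const_mul,
      intervalIntegral.integral_add (ii (hm.bdd_e.const_mul 8))
        (ii ((hm.bdd_n.const_mul _).add (hpq.const_mul 4))),
      intervalIntegral.integral_add (ii (hm.bdd_n.const_mul _)) (ii (hpq.const_mul 4)),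
      intervalIntegral.integral_const_mul, intervalIntegral.integral_const_mul,
      intervalIntegral.integral_const_mul] at hmono
    refine le_of_mul_le_mul_left (a := A) ?_ hA
    linear_combination hmono - hE

/-- The weighted `L²` estimate of the average of a solution. -/
theorem IsLineSolution.weighted_le (hf : IsLineSolution A L S f) (h1 : 1 ≤ L) (h6 : 6 * L ≤ A)
    {K c : ℝ} (hc : c = angInt (fun η φ => sin φ ^ 2 * f η φ) L / π) (hK : 0 ≤ K)
    (hK' : K ≤ 1 / 232) :
    ∫ y in (0 : ℝ)..L, exp (2 * K * y) * (mean f y - c) ^ 2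
      ≤ 16 * (∫ φ in (0 : ℝ)..π, sin φ * f 0 φ ^ 2) + 32 * c ^ 2
        + 928 * (∫ y in (0 : ℝ)..L, exp (2 * K * y) * angInt (fun η φ => S η φ ^ 2) y)
        + 2 * (∫ y in (0 : ℝ)..L, exp (2 * K * y) * (∫ z in y..L, sinMoment S z) ^ 2)
        + 40 * ∫ y in (0 : ℝ)..L,
            exp (2 * K * y) * (∫ z in y..L, ∫ x in z..L, |mean S x|) ^ 2 := by
  have hm := hf.moments h1 h6
  have h0 := hm.zero_mem
  have hl := hm.self_mem
  have hA : 0 < A := by linarith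
  have hgc : Admissible L (fun η φ => f η φ - c) := hf.admissible.sub (admissible_const L c)
  have hHc : ∫ φ in (0 : ℝ)..π, sin φ * (f 0 φ - c) ^ 2
      ≤ 2 * (∫ φ in (0 : ℝ)..π, sin φ * f 0 φ ^ 2) + 4 * c ^ 2 := by
    have hi := ((admissible_sin L).mul hf.admissible.pow_two).intervalIntegrable_angle h0 0 π
    have hj := (admissible_sin L).intervalIntegrable_angle h0 0 π
    have hk := ((admissible_sin L).mul hgc.pow_two).intervalIntegrable_angle h0 0 π
    have h2 := intervalIntegral.integral_mono_on pi_pos.le hk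
      ((hi.const_mul 2).add (hj.const_mul (2 * c ^ 2))) fun φ hφ => by
        have := sin_nonneg_of_nonneg_of_le_pi hφ.1 hφ.2
        have h3 : (f 0 φ - c) ^ 2 ≤ 2 * f 0 φ ^ 2 + 2 * c ^ 2 := by
          nlinarith [sq_nonneg (f 0 φ + c)]
        have h4 := mul_le_mul_of_nonneg_left h3 this
        linear_combination h4
    rw [intervalIntegral.integral_add (hi.const_mul 2) (hj.const_mul (2 * c ^ 2)),
      intervalIntegral.integral_const_mul, intervalIntegral.integral_const_mul, integral_sin] at h2
    simp only [cos_zero, cos_pi] at h2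
    linarith
  have hE := hf.energy_eq K c
  rw [sinMoment_split hgc.pow_two h0] at hE
  have hO := integral_sin_mul_sq_nonneg (fun φ => f 0 (-φ) - c)
  have hexp := bddOn_exp L (2 * K)
  have hlin : BddOn L fun y => A - y := bddOn_of_continuousOn (by fun_prop)
  have hint := hlin.mul (hexp.mul ((((admissible_sin L).mul hgc.pow_two).bddOn_angInt.const_mul
    (2 * K)).add (((hf.source.mul hgc).bddOn_angInt.sub hm.bdd_n).const_mul 2)))
  have hn := hexp.mul hm.bdd_n
  have hq := hexp.mul (hm.bdd_q.sub (bddOn_const L c)).pow_two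
  have he := hexp.mul hm.bdd_e
  have hbnd : BddOn L fun y => A * (-1 * (exp (2 * K * y) * angInt (fun η φ => fluct f η φ ^ 2) y)
      + ((2 * K + 1 / 116) * (exp (2 * K * y) * angInt (fun η φ => fluct f η φ ^ 2) y)
      + ((2 * K + 1 / 116) * (2 * π) * (exp (2 * K * y) * (mean f y - c) ^ 2)
      + 116 * (exp (2 * K * y) * angInt (fun η φ => S η φ ^ 2) y)))) :=
    ((hn.const_mul (-1)).add ((hn.const_mul _).add ((hq.const_mul _).add
      (he.const_mul 116)))).const_mul A
  have hmono := hint.integral_mono hbnd h0 hl hm.nonneg fun y hy => by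
    have e1 := angInt_sub_const_sq (c := c) hf.admissible hy
    have e2 : angInt (fun η φ => sin φ * (f η φ - c) ^ 2) y
        ≤ angInt (fun η φ => (f η φ - c) ^ 2) y :=
      angInt_mono ((admissible_sin L).mul hgc.pow_two) hgc.pow_two hy fun φ =>
        mul_le_of_le_one_left (sq_nonneg _) (sin_le_one φ)
    -- Young's inequality with the small constant `1/116`, which joins `2K` in the coefficient to be
    -- absorbed by `weighted_q_le_of_energy`.
    have e3 : 2 * angInt (fun η φ => S η φ * (f η φ - c)) y
        ≤ 116 * angInt (fun η φ => S η φ ^ 2) y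
          + 1 / 116 * angInt (fun η φ => (f η φ - c) ^ 2) y := by
      have e3 := angInt_mono ((hf.source.mul hgc).const_mul 2)
        ((hf.source.pow_two.const_mul 116).add (hgc.pow_two.const_mul (1 / 116))) hy
        fun φ => by nlinarith [sq_nonneg (116 * S y φ - (f y φ - c))]
      rwa [angInt_add (hf.source.pow_two.const_mul 116) (hgc.pow_two.const_mul (1 / 116)) hy,
        angInt_mul_left (fun _ => 2) (fun η φ => S η φ * (f η φ - c)),
        angInt_mul_left (fun _ => 116) (fun η φ => S η φ ^ 2),
        angInt_mul_left (fun _ => 1 / 116) (fun η φ => (f η φ - c) ^ 2)] at e3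
    have e4 := hm.n_nonneg y hy
    have e5 : 0 ≤ angInt (fun η φ => S η φ ^ 2) y :=
      angInt_nonneg (u := fun η φ => S η φ ^ 2) fun φ => sq_nonneg _
    have e6 : 0 ≤ angInt (fun η φ => (f η φ - c) ^ 2) y :=
      angInt_nonneg (u := fun η φ => (f η φ - c) ^ 2) fun φ => sq_nonneg _
    have e7 : 0 ≤ A - y := by linarith [hy.2]
    -- The factor `2` in front of the variance pays for replacing `A - y` by `A`.
    have e8 : A ≤ 2 * (A - y) := by linarith [hy.2]
    have hx := exp_pos (2 * K * y)
    generalize angInt (fun η φ => sin φ * (f η φ - c) ^ 2) y = α at *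
    generalize angInt (fun η φ => S η φ * (f η φ - c)) y = τ at *
    generalize angInt (fun η φ => S η φ ^ 2) y = σ at *
    rw [e1] at e2 e3 e6
    generalize angInt (fun η φ => fluct f η φ ^ 2) y = ν at *
    generalize (mean f y - c) ^ 2 = μ at *
    have e9 : 2 * K * α + 2 * τ ≤ (2 * K + 1 / 116) * (ν + 2 * π * μ) + 116 * σ := by
      have := mul_le_mul_of_nonneg_left e2 (by linarith : 0 ≤ 2 * K)
      linarith
    have e10 : 0 ≤ (2 * K + 1 / 116) * (ν + 2 * π * μ) + 116 * σ := by positivity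
    have e11 : (A - y) * (2 * K * α + 2 * τ)
        ≤ A * ((2 * K + 1 / 116) * (ν + 2 * π * μ) + 116 * σ) :=
      (mul_le_mul_of_nonneg_left e9 e7).trans (mul_le_mul_of_nonneg_right (by linarith [hy.1]) e10)
    have e12 : A * ν ≤ 2 * (A - y) * ν := mul_le_mul_of_nonneg_right e8 e4
    calc (A - y) * (exp (2 * K * y) * (2 * K * α + 2 * (τ - ν)))
        = exp (2 * K * y) * ((A - y) * (2 * K * α + 2 * τ) - 2 * (A - y) * ν) := by ring
      _ ≤ exp (2 * K * y) * (A * ((2 * K + 1 / 116) * (ν + 2 * π * μ) + 116 * σ) - A * ν) := by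
          gcongr
      _ = _ := by ring
  have ii : ∀ {g : ℝ → ℝ}, BddOn L g → IntervalIntegrable g volume 0 L := fun hg =>
    hg.intervalIntegrable h0 hl
  rw [intervalIntegral.integral_const_mul, intervalIntegral.integral_add (ii (hn.const_mul _))
      (ii ((hn.const_mul _).add ((hq.const_mul _).add (he.const_mul 116)))),
    intervalIntegral.integral_add (ii (hn.const_mul _))
      (ii ((hq.const_mul _).add (he.const_mul 116))),
    intervalIntegral.integral_add (ii (hq.const_mul _)) (ii (he.const_mul 116)),
    intervalIntegral.integral_const_mul, intervalIntegral.integral_const_mul,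
    intervalIntegral.integral_const_mul, intervalIntegral.integral_const_mul] at hmono
  have hfin : ∫ y in (0 : ℝ)..L, exp (2 * K * y) * angInt (fun η φ => fluct f η φ ^ 2) y
      ≤ (2 * (∫ φ in (0 : ℝ)..π, sin φ * f 0 φ ^ 2) + 4 * c ^ 2) + (2 * K + 1 / 116) *
        ((∫ y in (0 : ℝ)..L, exp (2 * K * y) * angInt (fun η φ => fluct f η φ ^ 2) y)
        + 2 * π * ∫ y in (0 : ℝ)..L, exp (2 * K * y) * (mean f y - c) ^ 2)
        + 116 * ∫ y in (0 : ℝ)..L, exp (2 * K * y) * angInt (fun η φ => S η φ ^ 2) y := by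
    refine le_of_mul_le_mul_left (a := A) ?_ hA
    have h7 := mul_le_mul_of_nonneg_left hHc hA.le
    have h8 := mul_nonneg hA.le hO
    linear_combination hmono - hE + h7 + h8
  rw [hc] at hfin ⊢
  have := hm.weighted_q_le_of_energy hK hK' hfin
  linarith

end


/-! ### Pointwise bounds by the attenuated source -/

lemma abs_rad_sub_le (t s E : ℝ) : |rad t E - rad s E| ≤ |(|t| - |s|)| := by
  have ht := rad_nonneg t E
  have hs := rad_nonneg s E
  have h1 : |t| * |s| + E ^ 2 ≤ rad t E * rad s E := by
    refine abs_le_of_sq_le_sq' ?_ (mul_nonneg ht hs) |>.2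
    rw [mul_pow, rad_sq, rad_sq, ← sq_abs t, ← sq_abs s]
    linarith [mul_nonneg (sq_nonneg E) (sq_nonneg (|t| - |s|))]
  rw [← sq_le_sq, sub_sq, sub_sq, rad_sq, rad_sq, sq_abs, sq_abs]
  linarith

/-- `|t|` agrees at the two ends of the void, and in the annulus it changes at most as fast as the
depth. With `abs_rad_sub_le`, `η` varies by at most the optical depth along a line, even across the
void. -/
lemma abs_abs_sub_le_depth {A L s t E : ℝ} (hL : 0 ≤ L) (hA : L < A) (hst : s ≤ t)
    (hs : rad s E ∈ Icc (A - L) A) (ht : rad t E ∈ Icc (A - L) A) :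
    |(|t| - |s|)| ≤ depth (A - L) t E - depth (A - L) s E := by
  have hE := abs_le_of_rad_le ht.2
  have h1 := ((mem_annulus_iff hL hA hE).1 hs).1
  have h2 := ((mem_annulus_iff hL hA hE).1 ht).1
  have h0 := chord_nonneg (A - L) E
  rcases le_abs'.1 h1 with h1 | h1 <;> rcases le_abs'.1 h2 with h2 | h2
  · rw [depth_of_le_neg h1, depth_of_le_neg h2, abs_of_nonpos (by linarith : t ≤ 0),
      abs_of_nonpos (by linarith : s ≤ 0), abs_le]
    constructor <;> linarith
  · rw [depth_of_le_neg h1, depth_of_le h2, abs_of_nonneg (by linarith : 0 ≤ t),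
      abs_of_nonpos (by linarith : s ≤ 0), abs_le]
    constructor <;> linarith
  · rw [depth_of_le h1, depth_of_le_neg h2, abs_of_nonpos (by linarith : t ≤ 0),
      abs_of_nonneg (by linarith : 0 ≤ s), abs_le]
    constructor <;> linarith
  · rw [depth_of_le h1, depth_of_le h2, abs_of_nonneg (by linarith : 0 ≤ t),
      abs_of_nonneg (by linarith : 0 ≤ s), abs_le]
    constructor <;> linarith

/-- The integral of a nonnegative source along a line up to `t`, attenuated with the rate `1/2`. -/
def attenuated (A L : ℝ) (w : ℝ → ℝ → ℝ) (t E : ℝ) : ℝ :=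
  exp (-(1 / 2 * depth (A - L) t E)) *
    ∫ s in (-chord A E)..t, exp (1 / 2 * depth (A - L) s E) * (ann A L s E * planar A w s E)

section

variable {A L : ℝ}

lemma attenuated_add {u v : ℝ → ℝ → ℝ} (hu : Admissible L u) (hv : Admissible L v) (t E : ℝ) :
    attenuated A L (fun η φ => u η φ + v η φ) t E
      = attenuated A L u t E + attenuated A L v t E := by
  rw [attenuated, attenuated, attenuated, ← mul_add, ← intervalIntegral.integral_add
    (hu.intervalIntegrable_ann _) (hv.intervalIntegrable_ann _)]
  congr 2
  funext s
  simp only [planar]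
  ring

lemma attenuated_le {t E m : ℝ} {u : ℝ → ℝ → ℝ} (hL : 0 ≤ L) (hA : L < A)
    (ht : rad t E ∈ Icc (A - L) A) (hm : 0 ≤ m) (hu : ∀ η ∈ Icc 0 L, ∀ φ, |u η φ| ≤ m) :
    attenuated A L u t E ≤ 2 * m := by
  have h1 := (le_abs_self _).trans (abs_integral_attenuated_le (k := 1 / 2) (m := m) hL hA
    (abs_le_of_rad_le ht.2) (mem_chord_of_mem hL hA ht) one_half_pos
    (w := fun s => planar A u s E) fun s _ hs => Admissible.planar_le hu hs)
  rw [attenuated, exp_neg, inv_mul_le_iff₀ (exp_pos _)]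
  refine h1.trans ?_
  have h2 := mul_nonneg hm (exp_pos (1 / 2 * depth (A - L) (-chord A E) E)).le
  linarith

/-- Pointwise estimate of a solution by the attenuated source. -/
theorem exp_mul_abs_sol_sub_le {K H c η φ : ℝ} {h : ℝ → ℝ} {u w : ℝ → ℝ → ℝ} (hL : 0 ≤ L)
    (hA : L < A) (hK : 0 ≤ K) (hK' : K ≤ 1 / 2) (hu : Admissible L u) (hw : Admissible L w)
    (hh : ∀ φ ∈ Ioo 0 π, |h φ| ≤ H)
    (huw : ∀ η ∈ Icc 0 L, ∀ φ, ¬ (η = 0 ∧ sin φ = 0) → exp (K * η) * |u η φ - c| ≤ w η φ)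
    (hη : η ∈ Icc 0 L) (hg : ¬ (η = 0 ∧ sin φ = 0)) :
    exp (K * η) * |sol A L h u η φ - c| ≤ H + |c|
      + attenuated A L w (-((A - η) * sin φ)) ((A - η) * cos φ) := by
  have hA0 : 0 < A := by linarith
  have hr : rad (-((A - η) * sin φ)) ((A - η) * cos φ) = A - η := rad_polar (by linarith [hη.2]) φ
  have hE := abs_polar_lt hA hη hg
  rw [sol]
  generalize -((A - η) * sin φ) = t at *
  generalize (A - η) * cos φ = E at *
  have ht : rad t E ∈ Icc (A - L) A := by
    rw [hr]
    exact ⟨by linarith [hη.2], by linarith [hη.1]⟩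
  have htb := mem_chord_of_mem hL hA ht
  have hb := chord_nonneg A E
  have hrb : rad (-chord A E) E = A := by rw [rad_neg, rad_chord hA0.le hE.le]
  -- The difference of the positions in `η` is at most the optical depth between the points; this
  -- lets attenuation beat the weight `e^{Kη}`.
  have decay : ∀ s ≤ t, rad s E ∈ Icc (A - L) A →
      η - (A - rad s E) ≤ depth (A - L) t E - depth (A - L) s E := fun s hst hs => by
    have := (le_abs_self _).trans
      ((abs_rad_sub_le s t E).trans_eq (abs_sub_comm _ _))
    have := abs_abs_sub_le_depth hL hA hst hs ht
    linarith
  have hi : ∀ v, Admissible L v → IntervalIntegrable (fun s => exp (depth (A - L) s E) *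
      (ann A L s E * planar A v s E)) volume (-chord A E) t := fun v hv => by
    have := hv.intervalIntegrable_ann (A := A) (E := E) (k := 1) (a := -chord A E) (b := t) (A - L)
    simpa only [one_mul] using this
  have hc := admissible_const L c
  -- A constant source together with the same constant as inflow datum gives back the constant, so
  -- `c` can be subtracted from both.
  have e1 : mild A L h u t E - c = exp (-depth (A - L) t E) * (exp (depth (A - L) (-chord A E) E) *
      (h (arccos (E / A)) - c) + ∫ s in (-chord A E)..t, exp (depth (A - L) s E) *
        (ann A L s E * planar A (fun η φ => u η φ - c) s E)) := by
    have h1 := (isPrimitiveOn_exp_depth hL hA hE.le 1).sub_eq t htb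
    have h2 : ∫ s in (-chord A E)..t, exp (depth (A - L) s E) *
        (ann A L s E * planar A (fun _ _ => c) s E)
        = c * (exp (depth (A - L) t E) - exp (depth (A - L) (-chord A E) E)) := by
      simp only [one_mul] at h1
      rw [h1, ← intervalIntegral.integral_const_mul]
      congr 1
      funext s
      simp only [planar]
      ring
    have h3 : ∫ s in (-chord A E)..t, exp (depth (A - L) s E) *
        (ann A L s E * planar A (fun η φ => u η φ - c) s E)
        = (∫ s in (-chord A E)..t, exp (depth (A - L) s E) * (ann A L s E * planar A u s E))
          - c * (exp (depth (A - L) t E) - exp (depth (A - L) (-chord A E) E)) := by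
      rw [← h2, ← intervalIntegral.integral_sub (hi u hu) (hi _ hc)]
      congr 1
      funext s
      simp only [planar]
      ring
    have h4 : exp (-depth (A - L) t E) * exp (depth (A - L) t E) = 1 := by
      rw [← exp_add, neg_add_cancel, exp_zero]
    rw [mild_eq htb.1, h3]
    linear_combination c * h4
  have hbound : exp (K * η) * exp (-depth (A - L) t E) * exp (depth (A - L) (-chord A E) E) ≤ 1 := by
    rw [← exp_add, ← exp_add, exp_le_one_iff]
    have := decay _ htb.1 (by rw [hrb]; exact ⟨by linarith, le_rfl⟩)
    rw [hrb, sub_self, sub_zero] at this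
    nlinarith [hη.1]
  have hH : |h (arccos (E / A)) - c| ≤ H + |c| := by
    have hE' := abs_lt.1 hE
    have h1 : -1 < E / A := by rw [lt_div_iff₀ hA0]; linarith
    have h2 : E / A < 1 := by rw [div_lt_one hA0]; linarith
    refine (abs_sub _ _).trans (add_le_add_left (hh _ ⟨arccos_pos.2 h2, ?_⟩) _)
    refine lt_of_le_of_ne (arccos_le_pi _) fun h => ?_
    have := arccos_eq_pi.1 h
    linarith
  have hint : exp (K * η) * exp (-depth (A - L) t E) * |∫ s in (-chord A E)..t,
      exp (depth (A - L) s E) * (ann A L s E * planar A (fun η φ => u η φ - c) s E)|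
      ≤ attenuated A L w t E := by
    have hpos : 0 < exp (K * η) * exp (-depth (A - L) t E) := by positivity
    rw [← abs_of_pos hpos, ← abs_mul, attenuated,
      ← intervalIntegral.integral_const_mul, ← intervalIntegral.integral_const_mul,
      ← norm_eq_abs]
    refine intervalIntegral.norm_integral_le_of_norm_le htb.1 (.of_forall fun s hs => ?_)
      ((hw.intervalIntegrable_ann (A - L)).const_mul _)
    have hn := ann_nonneg A L s E
    rw [norm_eq_abs, abs_mul, abs_of_pos hpos, abs_mul, abs_exp, abs_mul, abs_of_nonneg hn]
    by_cases hm : rad s E ∈ Icc (A - L) A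
    · rw [ann_of_mem hm, one_mul, one_mul]
      have hrs : 0 < rad s E := by linarith [hm.1]
      have hX : A - rad s E ∈ Icc 0 L := ⟨by linarith [hm.2], by linarith [hm.1]⟩
      -- A line with `|E| < A` misses the grazing points: there `s = 0`, hence `rad s E = |E| < A`.
      have hgr : ¬ (A - rad s E = 0 ∧ sin (Complex.arg ⟨E, -s⟩) = 0) := by
        rintro ⟨h1, h2⟩
        have h3 := rad_mul_sin_arg hrs
        rw [h2, mul_zero, zero_eq_neg] at h3
        have h4 := rad_sq s E
        rw [h3, show rad 0 E = A by rw [← h3]; linarith] at h4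
        have : E ^ 2 < A ^ 2 := sq_lt_sq.2 (by rwa [abs_of_pos hA0])
        linarith
      have h1 := huw _ hX _ hgr
      have h2 := decay s hs.2 hm
      -- Half of the attenuation pays for `e^{K(η - X)}` with `X = A - rad s E`, since `K ≤ 1/2` and
      -- `η - X` is at most the depth between the points.
      have h3 : exp (K * η) * exp (-depth (A - L) t E) * exp (depth (A - L) s E)
          ≤ exp (-(1 / 2 * depth (A - L) t E)) * exp (1 / 2 * depth (A - L) s E)
            * exp (K * (A - rad s E)) := by
        rw [← exp_add, ← exp_add, ← exp_add, ← exp_add, exp_le_exp]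
        have h4 := depth_mono (A - L) E hs.2
        simp only at h4
        nlinarith
      calc exp (K * η) * exp (-depth (A - L) t E) *
            (exp (depth (A - L) s E) * |planar A (fun η φ => u η φ - c) s E|)
          = exp (K * η) * exp (-depth (A - L) t E) * exp (depth (A - L) s E)
            * |planar A (fun η φ => u η φ - c) s E| := by ring
        _ ≤ exp (-(1 / 2 * depth (A - L) t E)) * exp (1 / 2 * depth (A - L) s E)
            * exp (K * (A - rad s E)) * |planar A (fun η φ => u η φ - c) s E| :=
          mul_le_mul_of_nonneg_right h3 (abs_nonneg _)
        _ = exp (-(1 / 2 * depth (A - L) t E)) * exp (1 / 2 * depth (A - L) s E)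
            * (exp (K * (A - rad s E)) * |planar A (fun η φ => u η φ - c) s E|) := by ring
        _ ≤ exp (-(1 / 2 * depth (A - L) t E)) * exp (1 / 2 * depth (A - L) s E)
            * planar A w s E := mul_le_mul_of_nonneg_left h1 (by positivity)
        _ = _ := by ring
    · simp [ann_of_notMem hm]
  rw [e1, abs_mul, abs_exp, ← mul_assoc]
  refine (mul_le_mul_of_nonneg_left (abs_add_le _ _) (by positivity)).trans ?_
  rw [mul_add]
  refine add_le_add ?_ hint
  rw [abs_mul, abs_exp, ← mul_assoc]
  exact (mul_le_of_le_one_left (abs_nonneg _) hbound).trans hH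

end


section

variable {A L : ℝ}

/-- The substitution `η = A - rad s E` on one half of a line. -/
lemma integral_ann_mul_le {E b : ℝ} {v : ℝ → ℝ} (hL : 0 ≤ L) (hA : L < A) (hb : 0 ≤ b)
    (hv : ∀ η ∈ Icc 0 L, 0 ≤ v η) (hi : IntervalIntegrable v volume 0 L) :
    ∫ s in (0 : ℝ)..b, ann A L s E * (|s| / rad s E * v (A - rad s E)) ≤ ∫ η in (0 : ℝ)..L, v η := by
  set T : Set ℝ := Ioc 0 b ∩ {s | rad s E ∈ Icc (A - L) A} with hT
  have hTm : MeasurableSet T := measurableSet_Ioc.inter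
    ((continuous_rad_left E).measurable measurableSet_Icc)
  have hpos : ∀ s ∈ T, 0 < rad s E := fun s hs => by linarith [hs.2.1]
  -- On the half line `s > 0` the radius determines `s`. The Jacobian `|s| / rad s E` is `|sin φ|`.
  have hinj : InjOn (fun s => A - rad s E) T := fun x hx y hy h => by
    have h1 : rad x E = rad y E := by simpa using h
    have h2 := rad_sq x E
    rw [h1, rad_sq] at h2
    exact (sq_eq_sq₀ hx.1.1.le hy.1.1.le).1 (by linarith)
  have himg : (fun s => A - rad s E) '' T ⊆ Icc 0 L := by
    rintro _ ⟨s, hs, rfl⟩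
    exact ⟨by linarith [hs.2.2], by linarith [hs.2.1]⟩
  have h1 := integral_image_eq_integral_abs_deriv_smul hTm
    (fun s hs => ((hasDerivAt_rad (hpos s hs)).const_sub A).hasDerivWithinAt) hinj v
  rw [intervalIntegrable_iff_integrableOn_Icc_of_le hL] at hi
  calc ∫ s in (0 : ℝ)..b, ann A L s E * (|s| / rad s E * v (A - rad s E))
      = ∫ s in Ioc 0 b, T.indicator (fun s => |(-(s / rad s E))| • v (A - rad s E)) s := by
        rw [intervalIntegral.integral_of_le hb]
        refine setIntegral_congr_fun measurableSet_Ioc fun s hs => ?_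
        by_cases hm : rad s E ∈ Icc (A - L) A
        · have hsT : s ∈ T := ⟨hs, hm⟩
          simp only [indicator_of_mem hsT, ann_of_mem hm, one_mul, smul_eq_mul, abs_neg, abs_div,
            abs_of_pos (hpos s hsT)]
        · have hsT : s ∉ T := fun h => hm h.2
          simp only [indicator_of_notMem hsT, ann_of_notMem hm, zero_mul]
    _ = ∫ η in (fun s => A - rad s E) '' T, v η := by
        rw [h1, setIntegral_indicator hTm, inter_eq_right.2 inter_subset_left]
    _ ≤ ∫ η in Icc 0 L, v η := setIntegral_mono_set hi
        ((ae_restrict_iff' measurableSet_Icc).2 (.of_forall hv)) (.of_forall himg)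
    _ = ∫ η in (0 : ℝ)..L, v η := by
        rw [intervalIntegral.integral_of_le hL, integral_Icc_eq_integral_Ioc]

lemma intervalIntegrable_ann_mul_slope {E a b : ℝ} {v : ℝ → ℝ}
    (hv : Admissible L fun η _ => v η) :
    IntervalIntegrable (fun s => ann A L s E * (|s| / rad s E * v (A - rad s E))) volume a b := by
  obtain ⟨M, hM0, hM⟩ := hv.exists_bound
  have hr := (continuous_rad_left E).measurable
  have hvm : Measurable v := hv.measurable.comp (measurable_id.prodMk (measurable_const (a := 0)))
  rw [intervalIntegrable_iff]
  refine Measure.integrableOn_of_bounded (M := M) (by simp) ?_ (.of_forall fun s => ?_)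
  · exact ((measurable_ann_left A L E).mul ((measurable_id.abs.div hr).mul
      (hvm.comp (measurable_const.sub hr)))).aestronglyMeasurable
  · have h0 : |s| / rad s E ≤ 1 := by
      refine div_le_one_of_le₀ ?_ (rad_nonneg s E)
      rw [rad, ← sqrt_sq_eq_abs]
      exact sqrt_le_sqrt (by nlinarith)
    have h1 := abs_ann_mul_planar_le (A := A) hM0 hM s E
    have h2 : 0 ≤ |s| / rad s E := div_nonneg (abs_nonneg _) (rad_nonneg s E)
    rw [norm_eq_abs, mul_left_comm, abs_mul, abs_of_nonneg h2]
    exact (mul_le_of_le_one_left (abs_nonneg _) h0).trans h1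

/-- Each half of the line passes through each level `η` at most once, whence the factor `2`. -/
lemma integral_ann_mul_slope_le {t E : ℝ} {v : ℝ → ℝ} (hL : 0 ≤ L) (hA : L < A)
    (ht : t ∈ Icc (-chord A E) (chord A E)) (hv : ∀ η ∈ Icc 0 L, 0 ≤ v η)
    (hi : Admissible L fun η _ => v η) :
    ∫ s in (-chord A E)..t, ann A L s E * (|s| / rad s E * v (A - rad s E))
      ≤ 2 * ∫ η in (0 : ℝ)..L, v η := by
  have hb := chord_nonneg A E
  have hg : ∀ x y, IntervalIntegrable (fun s => ann A L s E * (|s| / rad s E * v (A - rad s E)))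
    volume x y := fun x y => intervalIntegrable_ann_mul_slope hi
  have hvi : IntervalIntegrable v volume 0 L := by
    obtain ⟨M, hM⟩ := hi.bounded
    exact intervalIntegrable_of_bounded
      (hi.measurable.comp (measurable_id.prodMk (measurable_const (a := 0)))) hL
      fun η hη => hM η hη 0
  have h0 : ∀ s, 0 ≤ ann A L s E * (|s| / rad s E * v (A - rad s E)) := fun s => by
    by_cases hm : rad s E ∈ Icc (A - L) A
    · exact mul_nonneg (ann_nonneg _ _ _ _) (mul_nonneg (div_nonneg (abs_nonneg _)
        (rad_nonneg s E)) (hv _ ⟨by linarith [hm.2], by linarith [hm.1]⟩))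
    · rw [ann_of_notMem hm, zero_mul]
  have h1 := integral_ann_mul_le (E := E) hL hA hb hv hvi
  have h2 : ∫ s in (-chord A E)..0, ann A L s E * (|s| / rad s E * v (A - rad s E))
      = ∫ s in (0 : ℝ)..(chord A E), ann A L s E * (|s| / rad s E * v (A - rad s E)) := by
    rw [← neg_zero, ← intervalIntegral.integral_comp_neg, neg_zero]
    simp only [ann, rad_neg, abs_neg]
  have h3 := intervalIntegral.integral_nonneg (μ := volume) ht.2 fun s _ => h0 s
  have h4 := intervalIntegral.integral_add_adjacent_intervals (hg (-chord A E) 0) (hg 0 (chord A E))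
  have h5 := intervalIntegral.integral_add_adjacent_intervals (hg (-chord A E) t)
    (hg t (chord A E))
  linarith

/-- The attenuated source at a point that is not nearly grazing. -/
theorem attenuated_le_of_le_abs {t E δ τ θ M : ℝ} {q : ℝ → ℝ} (hL : 0 ≤ L) (hA : L < A)
    (ht : rad t E ∈ Icc (A - L) A) (hδ : 0 < δ) (hδ' : δ ≤ 1) (hτ : 0 ≤ τ)
    (hAτ : 2 * τ ≤ δ * (A - L)) (htδ : 2 * δ * rad t E ≤ |t|) (hθ : 0 < θ)
    (hq : Admissible L fun η _ => q η) (hq0 : ∀ η ∈ Icc 0 L, 0 ≤ q η)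
    (hM : ∀ η ∈ Icc 0 L, q η ≤ M) (hM0 : 0 ≤ M) :
    attenuated A L (fun η _ => q η) t E
      ≤ 2 * θ + (2 * δ * θ)⁻¹ * (∫ η in (0 : ℝ)..L, q η ^ 2) + 4 * exp (-(τ / 4)) * M := by
  have hE := abs_le_of_rad_le ht.2
  have htb := mem_chord_of_mem hL hA ht
  have hleft : -chord A E ∈ Icc (-chord A E) (chord A E) := left_mem_Icc.2 (htb.1.trans htb.2)
  have hprim := fun k => isPrimitiveOn_exp_depth hL hA hE k
  have hq2 : Admissible L fun η _ => q η ^ 2 := by simpa only [sq] using hq.mul hq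
  have hslope := integral_ann_mul_slope_le hL hA htb (fun η _ => sq_nonneg (q η)) hq2
  have i1 := ((hprim (1 / 2)).intervalIntegrable hleft htb).const_mul
    (2 * θ * exp (-(1 / 2 * depth (A - L) t E)))
  have i2 := (intervalIntegrable_ann_mul_slope (A := A) (E := E) (a := -chord A E) (b := t)
    hq2).const_mul (4 * δ * θ)⁻¹
  have i3 := ((hprim (1 / 4)).intervalIntegrable hleft htb).const_mul
    (4 * exp (-(τ / 4)) * M * exp (-(1 / 4 * depth (A - L) t E)))
  have i0 := (hq.intervalIntegrable_ann (A := A) (E := E) (k := 1 / 2) (a := -chord A E) (b := t)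
    (A - L)).const_mul (exp (-(1 / 2 * depth (A - L) t E)))
  -- The integrand is dominated by three terms: a constant `θ`, the square of `q` with the Jacobian,
  -- and the bound `M` with a small factor. The first two serve points within depth `τ`, the last
  -- one the others.
  have hmono := intervalIntegral.integral_mono_on htb.1 i0 ((i1.add i2).add i3) fun s hs => by
    by_cases hm : rad s E ∈ Icc (A - L) A
    · have hX : A - rad s E ∈ Icc 0 L := ⟨by linarith [hm.2], by linarith [hm.1]⟩
      have hrs : 0 < rad s E := by linarith [hm.1]
      have hdep := abs_abs_sub_le_depth hL hA hs.2 hm ht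
      have hrad := abs_rad_sub_le t s E
      have hQ0 := hq0 _ hX
      have hQM := hM _ hX
      rw [ann_of_mem hm]
      simp only [planar, one_mul, mul_one]
      generalize q (A - rad s E) = Q at *
      have e1 : ∀ k, exp (-(k * depth (A - L) t E)) * exp (k * depth (A - L) s E)
          = exp (-(k * (depth (A - L) t E - depth (A - L) s E))) := fun k => by
        rw [← exp_add]
        congr 1
        ring
      rw [← mul_assoc, e1, show 2 * θ * exp (-(1 / 2 * depth (A - L) t E)) *
        (1 / 2 * exp (1 / 2 * depth (A - L) s E)) = θ * (exp (-(1 / 2 * depth (A - L) t E)) *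
        exp (1 / 2 * depth (A - L) s E)) by ring, e1,
        show 4 * exp (-(τ / 4)) * M * exp (-(1 / 4 * depth (A - L) t E)) *
        (1 / 4 * exp (1 / 4 * depth (A - L) s E)) = exp (-(τ / 4)) * M *
        (exp (-(1 / 4 * depth (A - L) t E)) * exp (1 / 4 * depth (A - L) s E)) by ring, e1]
      generalize depth (A - L) t E - depth (A - L) s E = x at *
      have hx : 0 ≤ x := (abs_nonneg _).trans hdep
      have hslope0 : 0 ≤ |s| / rad s E := by positivity
      rcases le_total τ x with hfar | hnear
      · have e2 : exp (-(1 / 2 * x)) ≤ exp (-(τ / 4)) * exp (-(1 / 4 * x)) := by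
          rw [← exp_add, exp_le_exp]
          linarith
        have e3 : exp (-(1 / 2 * x)) * Q ≤ exp (-(τ / 4)) * exp (-(1 / 4 * x)) * M :=
          mul_le_mul e2 hQM hQ0 (by positivity)
        have e4 : 0 ≤ θ * exp (-(1 / 2 * x)) := by positivity
        have e5 : 0 ≤ (4 * δ * θ)⁻¹ * (|s| / rad s E * Q ^ 2) := by positivity
        linarith
      · have e2 : δ ≤ |s| / rad s E := by
          rw [le_div_iff₀ hrs]
          have h1 := (abs_le.1 (hdep.trans hnear)).2
          have h2 := (abs_le.1 (hrad.trans (hdep.trans hnear))).1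
          have h3 : δ * (A - L) ≤ δ * rad t E := mul_le_mul_of_nonneg_left ht.1 hδ.le
          have h4 : δ * rad s E ≤ δ * (rad t E + τ) := mul_le_mul_of_nonneg_left (by linarith) hδ.le
          have h5 : δ * τ ≤ τ := mul_le_of_le_one_left hτ hδ'
          linarith
        -- Young's inequality turns the bound linear in `q` into the square that the substitution
        -- can integrate.
        have e3 : Q ≤ θ + (4 * θ)⁻¹ * Q ^ 2 := by
          have : θ + (4 * θ)⁻¹ * Q ^ 2 - Q = (4 * θ)⁻¹ * (2 * θ - Q) ^ 2 := by
            field_simp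
            ring
          have : 0 ≤ (4 * θ)⁻¹ * (2 * θ - Q) ^ 2 := by positivity
          linarith
        have e4 : exp (-(1 / 2 * x)) ≤ 1 := exp_le_one_iff.2 (by linarith)
        have e5 : exp (-(1 / 2 * x)) * Q ≤ exp (-(1 / 2 * x)) * (θ + (4 * θ)⁻¹ * Q ^ 2) :=
          mul_le_mul_of_nonneg_left e3 (exp_pos _).le
        have e6 : exp (-(1 / 2 * x)) * ((4 * θ)⁻¹ * Q ^ 2) ≤ (4 * θ)⁻¹ * Q ^ 2 :=
          mul_le_of_le_one_left (by positivity) e4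
        have e7 : (4 * θ)⁻¹ * Q ^ 2 ≤ (4 * δ * θ)⁻¹ * (|s| / rad s E * Q ^ 2) := by
          have : (4 * θ)⁻¹ * Q ^ 2 = (4 * δ * θ)⁻¹ * (δ * Q ^ 2) := by
            field_simp
          rw [this]
          gcongr
        have e8 : 0 ≤ exp (-(τ / 4)) * M * exp (-(1 / 4 * x)) := by positivity
        linarith
    · simp [ann_of_notMem hm]
  rw [attenuated, ← intervalIntegral.integral_const_mul]
  refine hmono.trans ?_
  rw [intervalIntegral.integral_add (i1.add i2) i3, intervalIntegral.integral_add i1 i2,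
    intervalIntegral.integral_const_mul (2 * θ * exp (-(1 / 2 * depth (A - L) t E))),
    intervalIntegral.integral_const_mul (4 * δ * θ)⁻¹,
    intervalIntegral.integral_const_mul
      (4 * exp (-(τ / 4)) * M * exp (-(1 / 4 * depth (A - L) t E))),
    ← (hprim (1 / 2)).sub_eq t htb,
    ← (hprim (1 / 4)).sub_eq t htb]
  have c1 : ∀ k, exp (-(k * depth (A - L) t E)) * (exp (k * depth (A - L) t E)
      - exp (k * depth (A - L) (-chord A E) E)) ≤ 1 := fun k => by
    rw [mul_sub, ← exp_add, neg_add_cancel, exp_zero]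
    linarith [mul_pos (exp_pos (-(k * depth (A - L) t E)))
      (exp_pos (k * depth (A - L) (-chord A E) E))]
  have c2 := mul_le_mul_of_nonneg_left (c1 (1 / 2)) (by positivity : 0 ≤ 2 * θ)
  have c3 := mul_le_mul_of_nonneg_left (c1 (1 / 4))
    (by positivity : 0 ≤ 4 * exp (-(τ / 4)) * M)
  have c4 := mul_le_mul_of_nonneg_left hslope (by positivity : 0 ≤ (4 * δ * θ)⁻¹)
  have c5 : (4 * δ * θ)⁻¹ * (2 * ∫ η in (0 : ℝ)..L, q η ^ 2)
      = (2 * δ * θ)⁻¹ * ∫ η in (0 : ℝ)..L, q η ^ 2 := by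
    field_simp
    ring
  linarith

end


/-! ### From the weighted `L²` bound to the supremum -/

lemma integral_one_sub_abs_sin_sq : ∫ φ in (-π)..π, (1 - |sin φ|) ^ 2 = 3 * π - 8 := by
  have hc : Continuous fun φ : ℝ => (1 - |sin φ|) ^ 2 := by fun_prop
  have h1 : ∫ φ in (0 : ℝ)..π, (1 - |sin φ|) ^ 2 = π - 4 + π / 2 := by
    have h2 : ∫ φ in (0 : ℝ)..π, (1 - |sin φ|) ^ 2
        = ∫ φ in (0 : ℝ)..π, (1 - 2 * sin φ + sin φ ^ 2) := by
      refine intervalIntegral.integral_congr fun φ hφ => ?_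
      rw [uIcc_of_le pi_pos.le] at hφ
      simp only [abs_of_nonneg (sin_nonneg_of_nonneg_of_le_pi hφ.1 hφ.2)]
      ring
    rw [h2, intervalIntegral.integral_add (by apply Continuous.intervalIntegrable; fun_prop)
      (by apply Continuous.intervalIntegrable; fun_prop), intervalIntegral.integral_sub (by simp)
      (by apply Continuous.intervalIntegrable; fun_prop), intervalIntegral.integral_const_mul,
      integral_sin, integral_sin_sq]
    simp
    norm_num
  rw [integral_neg_pi_pi_eq (hc.intervalIntegrable _ _) (hc.intervalIntegrable _ _)]
  simp only [sin_neg, abs_neg, h1]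
  ring

lemma abs_mean_le_of_ae_le {u : ℝ → ℝ → ℝ} {v : ℝ → ℝ} {η : ℝ}
    (hv : IntervalIntegrable v volume (-π) π)
    (h : ∀ᵐ φ, φ ∈ uIoc (-π) π → |u η φ| ≤ v φ) :
    |mean u η| ≤ (2 * π)⁻¹ * ∫ φ in (-π)..π, v φ := by
  have hle := neg_le_self pi_pos.le
  rw [uIoc_of_le hle] at h
  rw [mean, abs_mul, abs_of_pos (inv_pos.2 two_pi_pos)]
  have h1 : ‖∫ φ in (-π)..π, u η φ‖ ≤ ∫ φ in (-π)..π, v φ :=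
    intervalIntegral.norm_integral_le_of_norm_le hle h hv
  exact mul_le_mul_of_nonneg_left h1 (inv_pos.2 two_pi_pos).le

lemma exp_neg_three_le : exp (-3) ≤ 1 / 16 := by
  have h1 := exp_one_gt_d9
  have h2 : exp 3 = exp 1 ^ 3 := by rw [← exp_nat_mul]; norm_num
  have h3 : (2.7 : ℝ) ^ 3 ≤ exp 1 ^ 3 := pow_le_pow_left₀ (by norm_num) (by linarith) 3
  rw [exp_neg, one_div, inv_le_inv₀ (exp_pos 3) (by norm_num), h2]
  refine le_trans (by norm_num) h3

section

variable {A L : ℝ}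

/-- Angles with `|sin φ| ≥ 1/64` see the `L²` norm and a quarter of `M`; the others only the trivial
bound `2M`. The factor `(1 - |sin φ|)²` is a continuous majorant for the latter with an explicit
mean: at least `(63/64)²` on small `|sin φ|`, and `1/4 + (207/100) (63/64)² ≥ 2`. -/
lemma attenuated_le_split {η φ Z M : ℝ} {q : ℝ → ℝ} (hL : 0 ≤ L) (hA : 3072 ≤ A - L)
    (hη : η ∈ Icc 0 L) (hZ : 0 < Z) (hq : Admissible L fun η _ => q η)
    (hq0 : ∀ η ∈ Icc 0 L, 0 ≤ q η) (hM : ∀ η ∈ Icc 0 L, q η ≤ M)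
    (hqZ : ∫ η in (0 : ℝ)..L, q η ^ 2 ≤ Z ^ 2) :
    attenuated A L (fun η _ => q η) (-((A - η) * sin φ)) ((A - η) * cos φ)
      ≤ 66 * Z + M / 4 + 207 / 100 * M * (1 - |sin φ|) ^ 2 := by
  have hA' : L < A := by linarith
  have hr := rad_polar (by linarith [hη.2] : 0 ≤ A - η) φ
  have ht := rad_polar_mem hA' hη φ
  have hM0 : 0 ≤ M := (hq0 _ hη).trans (hM _ hη)
  rcases le_total (1 / 64) |sin φ| with h | h
  · have h1 := attenuated_le_of_le_abs (δ := 1 / 128) (τ := 12) (θ := Z) hL hA' ht (by norm_num)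
      (by norm_num) (by norm_num) (by linarith)
      (by
        rw [hr, abs_neg, abs_mul, abs_of_nonneg (by linarith [hη.2] : 0 ≤ A - η)]
        nlinarith [hη.2]) hZ hq hq0 hM hM0
    have h2 : (2 * (1 / 128) * Z)⁻¹ * (∫ η in (0 : ℝ)..L, q η ^ 2) ≤ 64 * Z := by
      rw [inv_mul_le_iff₀ (by positivity)]
      linarith
    have h3 : 4 * exp (-(12 / 4)) * M ≤ M / 4 := by
      have := mul_le_mul_of_nonneg_right exp_neg_three_le hM0
      norm_num at this ⊢
      linarith
    have h4 : 0 ≤ 207 / 100 * M * (1 - |sin φ|) ^ 2 := by positivity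
    linarith
  · have h1 := attenuated_le hL hA' ht hM0 (u := fun η _ => q η) fun η hη _ => by
      rw [abs_of_nonneg (hq0 η hη)]
      exact hM η hη
    have h2 : (63 / 64 : ℝ) ^ 2 ≤ (1 - |sin φ|) ^ 2 :=
      pow_le_pow_left₀ (by norm_num) (by linarith) 2
    have h3 := mul_le_mul_of_nonneg_left h2 hM0
    linarith

/-- The supremum of a solution is controlled by the data and the `L²` norm of its average. -/
theorem exp_mul_abs_sub_le {K H c σ Z η φ : ℝ} {h : ℝ → ℝ} {S f : ℝ → ℝ → ℝ} (hL : 0 ≤ L)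
    (hA : 3072 ≤ A - L) (hK : 0 ≤ K) (hK' : K ≤ 1 / 2) (hf : Admissible L f) (hS : Admissible L S)
    (hsol : ∀ η ∈ Icc 0 L, ∀ φ, ¬ (η = 0 ∧ sin φ = 0) →
      f η φ = sol A L h (fun η φ => mean f η + S η φ) η φ)
    (hh : ∀ φ ∈ Ioo 0 π, |h φ| ≤ H) (hσ0 : 0 ≤ σ)
    (hσ : ∀ η ∈ Icc 0 L, ∀ φ, ¬ (η = 0 ∧ sin φ = 0) → exp (K * η) * |S η φ| ≤ σ) (hZ : 0 < Z)
    (hfZ : ∫ η in (0 : ℝ)..L, exp (2 * K * η) * (mean f η - c) ^ 2 ≤ Z ^ 2)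
    (hη : η ∈ Icc 0 L) (hg : ¬ (η = 0 ∧ sin φ = 0)) :
    exp (K * η) * |f η φ - c| ≤ 9 * (H + |c| + 2 * σ) + 528 * Z := by
  have hA' : L < A := by linarith
  set q : ℝ → ℝ := fun η => exp (K * η) * |mean f η - c| with hq
  have hq0 : ∀ η, 0 ≤ q η := fun η => by positivity
  have hqm : Measurable q := (measurable_exp.comp (measurable_id.const_mul K)).mul
    ((measurable_mean hf.measurable).sub_const c).abs
  obtain ⟨N, hN⟩ := ((bddOn_exp L K).mul
    (hf.bddOn_mean.sub (bddOn_const L c)).abs).bounded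
  have hqa : Admissible L fun η _ => q η := admissible_of_fst hqm hN
  have hqZ : ∫ η in (0 : ℝ)..L, q η ^ 2 ≤ Z ^ 2 := by
    refine le_of_eq_of_le ?_ hfZ
    congr 1
    funext η
    simp only [hq]
    rw [mul_pow, sq_abs, ← exp_nat_mul]
    congr 2
    push_cast
    ring
  have hbdd : BddAbove (q '' Icc 0 L) := ⟨N, by
    rintro _ ⟨η, hη, rfl⟩
    exact (le_abs_self _).trans (hN η hη)⟩
  set M := sSup (q '' Icc 0 L) with hMdef
  have hM : ∀ η ∈ Icc 0 L, q η ≤ M := fun η hη => le_csSup hbdd ⟨η, hη, rfl⟩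
  have hpt : ∀ η ∈ Icc 0 L, ∀ φ, ¬ (η = 0 ∧ sin φ = 0) → exp (K * η) * |f η φ - c|
      ≤ H + |c| + 2 * σ
        + attenuated A L (fun η _ => q η) (-((A - η) * sin φ)) ((A - η) * cos φ) := by
    intro η hη φ hg
    rw [hsol η hη φ hg]
    have h1 := exp_mul_abs_sol_sub_le (c := c) (w := fun η _ => q η + σ) hL hA' hK hK'
      (hf.mean.add hS) (hqa.add (admissible_const L σ)) hh (fun η hη φ hg => by
        have h1 : mean f η + S η φ - c = (mean f η - c) + S η φ := by ring
        rw [h1]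
        refine (mul_le_mul_of_nonneg_left (abs_add_le _ _) (exp_pos _).le).trans ?_
        rw [mul_add]
        exact add_le_add le_rfl (hσ η hη φ hg)) hη hg
    rw [attenuated_add hqa (admissible_const L σ)] at h1
    have h2 := attenuated_le hL hA' (rad_polar_mem hA' hη φ) hσ0 (u := fun _ _ => σ)
      fun _ _ _ => (abs_of_nonneg hσ0).le
    linarith
  -- The mean of `(1 - |sin φ|)²` is `3/2 - 4/π ≤ 6/25`, and `1/4 + (207/100)(6/25) ≤ 3/4`: a factor
  -- below `1`, so `M` can be absorbed.
  have hqle : ∀ η ∈ Icc 0 L, q η ≤ H + |c| + 2 * σ + 66 * Z + 3 / 4 * M := by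
    intro η hη
    have hM0 : 0 ≤ M := (hq0 η).trans (hM η hη)
    have hci : IntervalIntegrable (fun φ : ℝ => (1 - |sin φ|) ^ 2) volume (-π) π := by
      apply Continuous.intervalIntegrable
      fun_prop
    have h1 := abs_mean_le_of_ae_le (u := fun η φ => exp (K * η) * (f η φ - c)) (η := η)
      (v := fun φ => H + |c| + 2 * σ + (66 * Z + M / 4) + 207 / 100 * M * (1 - |sin φ|) ^ 2)
      (intervalIntegrable_const.add (hci.const_mul _)) (by
        filter_upwards [ae_sin_ne_zero] with φ h1 h2
        have h3 := hpt η hη φ fun h => h1 h2 h.2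
        have h4 := attenuated_le_split (φ := φ) hL hA hη hZ hqa (fun η _ => hq0 η) hM hqZ
        rw [abs_mul, abs_exp]
        linarith)
    have h2 : mean (fun η φ => exp (K * η) * (f η φ - c)) η = exp (K * η) * (mean f η - c) := by
      have h3 := mean_sub hf (admissible_const L c) hη
      have h4 : mean (fun _ _ => c) η = c := by
        rw [mean, intervalIntegral.integral_const, smul_eq_mul]
        field_simp
        ring
      rw [h4] at h3
      rw [h3, mean, mean, intervalIntegral.integral_const_mul]
      ring
    rw [h2, abs_mul, abs_exp, intervalIntegral.integral_add intervalIntegrable_const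
      (hci.const_mul _), intervalIntegral.integral_const, intervalIntegral.integral_const_mul,
      integral_one_sub_abs_sin_sq, smul_eq_mul] at h1
    have h5 : (2 * π)⁻¹ * ((π - -π) * (H + |c| + 2 * σ + (66 * Z + M / 4))
        + 207 / 100 * M * (3 * π - 8))
        = H + |c| + 2 * σ + (66 * Z + M / 4) + 207 / 100 * M * (3 / 2 - 4 / π) := by
      field_simp
      ring
    rw [h5] at h1
    have h6 : (126 / 100 : ℝ) ≤ 4 / π := by
      rw [le_div_iff₀ pi_pos]
      linarith [pi_lt_d2]
    have h7 := mul_le_mul_of_nonneg_left h6 hM0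
    change exp (K * η) * |mean f η - c| ≤ _
    linarith
  have hM4 : M ≤ 4 * (H + |c| + 2 * σ + 66 * Z) := by
    have h1 : M ≤ H + |c| + 2 * σ + 66 * Z + 3 / 4 * M :=
      csSup_le ⟨_, 0, left_mem_Icc.2 hL, rfl⟩ (by
        rintro _ ⟨η, hη, rfl⟩
        exact hqle η hη)
    linarith
  -- The pointwise bound is used once more, now with the trivial estimate `2M` and `M ≤ 4 (H + |c| +
  -- 2σ + 66 Z)`. This gives the factors `9 = 1 + 8` and `528 = 8 · 66`.
  have h1 := hpt η hη φ hg
  have h2 := attenuated_le hL hA' (rad_polar_mem hA' hη φ) ((hq0 η).trans (hM η hη))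
    (u := fun η _ => q η) fun η hη _ => by
      rw [abs_of_nonneg (hq0 η)]
      exact hM η hη
  linarith

end


/-! ### Translation into the norms of the statement -/

lemma IsSolution.isLineSolution {ε R : ℝ} {h : ℝ → ℝ} {S f : ℝ → ℝ → ℝ} (hε : 0 < ε)
    (hL : len ε < R / ε) (hf : IsSolution ε R h S f) (hS : Admissible (len ε) S) :
    IsLineSolution (R / ε) (len ε) S f :=
  ⟨(len_pos hε).le, hL, hS, hf.admissible, hf.alongLines hε hL hS, hf.reflection⟩

/-- The inflow condition is not imposed at `φ = 0` and `φ = π`, but the weight `sin φ` vanishes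
there. -/
lemma IsSolution.inflowL2Norm_sq {ε R : ℝ} {h : ℝ → ℝ} {S f : ℝ → ℝ → ℝ}
    (hf : IsSolution ε R h S f) :
    inflowL2Norm h ^ 2 = ∫ φ in (0 : ℝ)..π, sin φ * f 0 φ ^ 2 := by
  have h1 : ∫ φ in (0 : ℝ)..π, |h φ| ^ 2 * sin φ = ∫ φ in (0 : ℝ)..π, sin φ * f 0 φ ^ 2 := by
    refine intervalIntegral.integral_congr fun φ hφ => ?_
    rw [uIcc_of_le pi_pos.le] at hφ
    rcases hφ.1.eq_or_lt with h0 | h0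
    · simp [← h0]
    rcases hφ.2.eq_or_lt with h2 | h2
    · simp [h2]
    · simp only [sq_abs, hf.inflow φ ⟨h0, h2⟩]
      ring
  rw [inflowL2Norm, h1, sq_sqrt (integral_sin_mul_sq_nonneg _)]

section norms

variable {L : ℝ} {u : ℝ → ℝ → ℝ}

lemma l2Norm_sq (hL : 0 ≤ L) :
    l2Norm L u ^ 2 = ∫ η in (0 : ℝ)..L, angInt (fun η φ => u η φ ^ 2) η := by
  rw [l2Norm, sq_sqrt]
  · simp only [sq_abs]
    rfl
  · exact intervalIntegral.integral_nonneg hL fun η _ =>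
      angInt_nonneg (u := fun η φ => |u η φ| ^ 2) fun φ => by positivity

lemma l2Norm_expWeight_sq (hL : 0 ≤ L) (K : ℝ) :
    l2Norm L (expWeight K u) ^ 2
      = ∫ η in (0 : ℝ)..L, exp (2 * K * η) * angInt (fun η φ => u η φ ^ 2) η := by
  rw [l2Norm_sq hL]
  congr 1
  funext η
  rw [← angInt_mul_left (fun η => exp (2 * K * η)) (fun η φ => u η φ ^ 2)]
  refine angInt_congr fun φ => ?_
  rw [expWeight, mul_pow, ← exp_nat_mul]
  congr 2
  push_cast
  ring

lemma expL2_sq (hL : 0 ≤ L) (K : ℝ) (w : ℝ → ℝ) :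
    expL2 K L w ^ 2 = ∫ η in (0 : ℝ)..L, exp (2 * K * η) * w η ^ 2 :=
  sq_sqrt (intervalIntegral.integral_nonneg hL fun _ _ => by positivity)

lemma l2Norm_le_expWeight (hL : 0 ≤ L) {K : ℝ} (hK : 0 ≤ K) (hu : Admissible L u) :
    l2Norm L u ≤ l2Norm L (expWeight K u) := by
  have h0 : (0 : ℝ) ∈ Icc 0 L := left_mem_Icc.2 hL
  have hl : L ∈ Icc 0 L := right_mem_Icc.2 hL
  refine le_of_sq_le_sq ?_ (sqrt_nonneg _)
  rw [l2Norm_sq hL, l2Norm_expWeight_sq hL]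
  refine hu.pow_two.bddOn_angInt.integral_mono ((bddOn_exp L (2 * K)).mul
    hu.pow_two.bddOn_angInt) h0 hl hL fun η hη => ?_
  refine le_mul_of_one_le_left (angInt_nonneg (u := fun η φ => u η φ ^ 2) fun φ => sq_nonneg _) ?_
  exact one_le_exp (mul_nonneg (by linarith) hη.1)

lemma supNorm_nonneg (L : ℝ) (u : ℝ → ℝ → ℝ) : 0 ≤ supNorm L u :=
  Real.iSup_nonneg fun _ => abs_nonneg _

lemma Admissible.expWeight (hu : Admissible L u) (K : ℝ) : Admissible L (Milne.expWeight K u) := by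
  obtain ⟨M, hM⟩ := (bddOn_exp L K).bounded
  exact (admissible_of_fst (by fun_prop) hM).mul hu

/-- The supremum runs over angles in `[-π, π)`. Any other angle is reduced by periodicity, which
also preserves being away from grazing. -/
lemma Admissible.abs_le_supNorm (hu : Admissible L u) {η φ : ℝ} (hη : η ∈ Icc 0 L)
    (hg : ¬ (η = 0 ∧ sin φ = 0)) : |u η φ| ≤ supNorm L u := by
  obtain ⟨M, hM⟩ := hu.bounded
  have hbdd : BddAbove (range fun p : phaseSpace L => |u p.1.1 p.1.2|) :=
    ⟨M, by rintro _ ⟨p, rfl⟩; exact hM _ p.2.1 _⟩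
  have hper : ∀ g : ℝ → ℝ, Function.Periodic g (2 * π) →
      g (toIcoMod two_pi_pos (-π) φ) = g φ := fun g hg => by
    rw [toIcoMod]
    exact hg.sub_zsmul_eq _
  have hmem : ((η, toIcoMod two_pi_pos (-π) φ) : ℝ × ℝ) ∈ phaseSpace L := by
    refine ⟨hη, ?_, by simpa only [hper sin sin_periodic] using hg⟩
    have := toIcoMod_mem_Ico two_pi_pos (-π) φ
    rwa [show -π + 2 * π = π by ring] at this
  have : |u η (toIcoMod two_pi_pos (-π) φ)| ≤ supNorm L u := le_ciSup hbdd ⟨_, hmem⟩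
  rw [hper (u η) (hu.periodic η hη)] at this
  exact this

lemma IsData.abs_le_inflowSupNorm {h : ℝ → ℝ} (hd : IsData L h u) {φ : ℝ} (hφ : φ ∈ Ioo 0 π) :
    |h φ| ≤ inflowSupNorm h := by
  obtain ⟨M, hM⟩ := hd.bounded_inflow
  exact le_ciSup (f := fun φ : Ioo (0 : ℝ) π => |h φ|)
    ⟨M, by rintro _ ⟨p, rfl⟩; exact hM _ p.2⟩ ⟨φ, hφ⟩

lemma integral_sinMoment_fluct (hu : Admissible L u) {x y : ℝ} (hx : x ∈ Icc 0 L)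
    (hy : y ∈ Icc 0 L) :
    ∫ η in x..y, sinMoment (fluct u) η = ∫ η in x..y, sinMoment u η :=
  intervalIntegral.integral_congr fun _ hη => sinMoment_fluct hu (uIcc_subset_Icc hx hy hη)

end norms

/-- `√ε ≤ 1/615` gives `L ≥ 615`, and `√ε ≤ Rmin/6` gives `A ≥ 6L`. Then `A - L ≥ 5 · 615`, which
exceeds the `3072` needed for the pointwise bound. -/
lemma len_bounds {ε R Rmin : ℝ} (hR : 0 < Rmin) (hε : 0 < ε)
    (hε' : ε ≤ min (1 / 615) (Rmin / 6) ^ 2) (h : Rmin ≤ R) :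
    615 ≤ len ε ∧ 6 * len ε ≤ R / ε := by
  have hs : 0 < √ε := sqrt_pos.2 hε
  have h1 : √ε ≤ min (1 / 615) (Rmin / 6) := sqrt_le_iff.2 ⟨by positivity, hε'⟩
  have h2 := h1.trans (min_le_left _ _)
  have h3 := h1.trans (min_le_right _ _)
  have h4 : √ε * √ε = ε := mul_self_sqrt hε.le
  constructor
  · rw [len, le_inv_comm₀ (by norm_num) hs]
    linarith
  · rw [len, le_div_iff₀ hε, ← div_eq_mul_inv, div_mul_eq_mul_div, div_le_iff₀ hs]
    nlinarith

theorem IsSolution.abs_limit_le {ε R : ℝ} {h : ℝ → ℝ} {S f : ℝ → ℝ → ℝ} (hε : 0 < ε)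
    (hf : IsSolution ε R h S f) (hS : Admissible (len ε) S) (h1 : 1 ≤ len ε)
    (h6 : 6 * len ε ≤ R / ε) :
    |angInt (fun η φ => sin φ ^ 2 * f η φ) (len ε) / π| ≤ 160 * (inflowL2Norm h + l2Norm (len ε) S
      + |∫ y in (0 : ℝ)..(len ε), sinMoment (fluct S) y|
      + |∫ η in (0 : ℝ)..(len ε), (∫ y in η..(len ε), |mean S y|)|) := by
  have hl := hf.isLineSolution hε (by linarith) hS
  have h0 : 0 ≤ len ε := by linarith
  have e1 : 0 ≤ inflowL2Norm h := sqrt_nonneg _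
  have e2 : 0 ≤ l2Norm (len ε) S := sqrt_nonneg _
  have e3 := abs_nonneg (∫ y in (0 : ℝ)..(len ε), sinMoment (fluct S) y)
  have e4 := abs_nonneg (∫ η in (0 : ℝ)..(len ε), (∫ y in η..(len ε), |mean S y|))
  rw [integral_sinMoment_fluct hS (left_mem_Icc.2 h0) (right_mem_Icc.2 h0)] at *
  rw [abs_div, abs_of_pos pi_pos, div_le_iff₀ pi_pos]
  have hD := hl.abs_limit_le h1 h6 (D := inflowL2Norm h + l2Norm (len ε) S
      + |∫ y in (0 : ℝ)..(len ε), sinMoment S y|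
      + |∫ η in (0 : ℝ)..(len ε), (∫ y in η..(len ε), |mean S y|)|) (by positivity)
    (by rw [← hf.inflowL2Norm_sq]; exact pow_le_pow_left₀ e1 (by linarith) 2)
    (by rw [← l2Norm_sq h0]; exact pow_le_pow_left₀ e2 (by linarith) 2)
    (by linarith) ((le_abs_self _).trans (by linarith))
  refine hD.trans (le_mul_of_one_le_right (by positivity) ?_)
  linarith [pi_gt_three]

theorem IsSolution.supNorm_le {ε R K : ℝ} {h : ℝ → ℝ} {S f : ℝ → ℝ → ℝ} (hε : 0 < ε)
    (hf : IsSolution ε R h S f) (hd : IsData (len ε) h S) (h1 : 615 ≤ len ε)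
    (h6 : 6 * len ε ≤ R / ε) (hK : 0 ≤ K) (hK' : K ≤ 1 / 232) {c : ℝ}
    (hc : c = angInt (fun η φ => sin φ ^ 2 * f η φ) (len ε) / π) :
    supNorm (len ε) (expWeight K fun η φ => f η φ - c) ≤
      9 * (inflowSupNorm h + |c| + 2 * supNorm (len ε) (expWeight K S))
      + 528 * (4 * inflowL2Norm h + 6 * |c| + 31 * l2Norm (len ε) (expWeight K S)
        + 2 * expL2 K (len ε) (fun η => ∫ y in η..(len ε), sinMoment (fluct S) y)
        + 7 * expL2 K (len ε)
            (fun η => ∫ y in η..(len ε), ∫ z in y..(len ε), |mean S z|)) := by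
  have hS := hd.admissible
  have hL : len ε < R / ε := by linarith
  have hl := hf.isLineSolution hε hL hS
  have h0 : 0 ≤ len ε := by linarith
  have hw := hl.weighted_le (by linarith) h6 hc hK hK'
  rw [← hf.inflowL2Norm_sq, ← l2Norm_expWeight_sq h0,
    ← expL2_sq h0 K (fun η => ∫ y in η..(len ε), ∫ z in y..(len ε), |mean S z|)] at hw
  have e0 : ∫ y in (0 : ℝ)..(len ε), exp (2 * K * y) * (∫ z in y..(len ε), sinMoment S z) ^ 2
      = expL2 K (len ε) (fun η => ∫ y in η..(len ε), sinMoment (fluct S) y) ^ 2 := by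
    rw [expL2_sq h0]
    refine intervalIntegral.integral_congr fun y hy => ?_
    rw [uIcc_of_le h0] at hy
    simp only [integral_sinMoment_fluct hS hy (right_mem_Icc.2 h0)]
  rw [e0, ← sq_abs c] at hw
  have n1 : 0 ≤ inflowL2Norm h := sqrt_nonneg _
  have n2 : 0 ≤ l2Norm (len ε) (expWeight K S) := sqrt_nonneg _
  have n3 : 0 ≤ expL2 K (len ε) (fun η => ∫ y in η..(len ε), sinMoment (fluct S) y) :=
    sqrt_nonneg _
  have n4 : 0 ≤ expL2 K (len ε)
      (fun η => ∫ y in η..(len ε), ∫ z in y..(len ε), |mean S z|) := sqrt_nonneg _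
  have n5 := abs_nonneg c
  have hne : Nonempty (phaseSpace (len ε)) :=
    ⟨⟨(len ε, 0), right_mem_Icc.2 h0, ⟨by simpa using pi_pos.le, pi_pos⟩,
      fun h => by linarith [h.1]⟩⟩
  refine ciSup_le fun p => ?_
  rw [expWeight, abs_mul, abs_exp]
  generalize inflowL2Norm h = x1 at *
  generalize l2Norm (len ε) (expWeight K S) = x2 at *
  generalize expL2 K (len ε) (fun η => ∫ y in η..(len ε), sinMoment (fluct S) y) = x3 at *
  generalize expL2 K (len ε)
      (fun η => ∫ y in η..(len ε), ∫ z in y..(len ε), |mean S z|) = x4 at *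
  -- The pointwise bound needs `Z > 0`, while all norms may vanish; the slack `t / 528` is
  -- multiplied by `528` there and then tends to zero.
  refine le_of_forall_pos_le_add fun t ht => ?_
  have hb := exp_mul_abs_sub_le (A := R / ε) (K := K) (c := c)
    (Z := 4 * x1 + 6 * |c| + 31 * x2 + 2 * x3 + 7 * x4 + t / 528) h0 (by linarith) hK
    (by linarith) hf.admissible hS (fun η hη φ hg => hf.eq_sol hε hL hS hη hg)
    (fun φ hφ => hd.abs_le_inflowSupNorm hφ) (supNorm_nonneg (len ε) (expWeight K S))
    (fun η hη φ hg => by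
      have := (hS.expWeight K).abs_le_supNorm hη hg
      rwa [expWeight, abs_mul, abs_exp] at this)
    (by positivity) (hw.trans (by
      -- The factors `4, 6, 31, 2, 7` are the square roots of `16, 32, 928, 2, 40`, rounded up to
      -- integers.
      have s1 : 16 * x1 ^ 2 + 32 * |c| ^ 2 + 928 * x2 ^ 2 + 2 * x3 ^ 2 + 40 * x4 ^ 2
          ≤ (4 * x1) ^ 2 + (6 * |c|) ^ 2 + (31 * x2) ^ 2 + (2 * x3) ^ 2 + (7 * x4) ^ 2 := by
        linarith [sq_nonneg x2, sq_nonneg x3, sq_nonneg x4, sq_nonneg |c|]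
      have s2 : ∀ a b : ℝ, 0 ≤ a → 0 ≤ b → a ^ 2 + b ^ 2 ≤ (a + b) ^ 2 := fun a b ha hb => by
        linarith [mul_nonneg ha hb, add_sq a b]
      have q1 := s2 (4 * x1) (6 * |c|) (by positivity) (by positivity)
      have q2 := s2 (4 * x1 + 6 * |c|) (31 * x2) (by positivity) (by positivity)
      have q3 := s2 (4 * x1 + 6 * |c| + 31 * x2) (2 * x3) (by positivity) (by positivity)
      have q4 := s2 (4 * x1 + 6 * |c| + 31 * x2 + 2 * x3) (7 * x4) (by positivity) (by positivity)
      have q5 := s2 (4 * x1 + 6 * |c| + 31 * x2 + 2 * x3 + 7 * x4) (t / 528) (by positivity)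
        (by positivity)
      have q6 := sq_nonneg (t / 528)
      linarith)) p.2.1 p.2.2.2
  linarith

end Milne

end

theorem mainTheorem7 (Rmin : ℝ) (hRmin : 0 < Rmin) :
    ∃ ε₀ > 0, ∃ Kmax > 0, ∃ C > 0,
      ∀ ε R : ℝ, 0 < ε → ε ≤ ε₀ → Rmin ≤ R →
      ∀ (h : ℝ → ℝ) (S : ℝ → ℝ → ℝ), Milne.IsData (Milne.len ε) h S →
      ∃ f : ℝ → ℝ → ℝ, Milne.IsSolution ε R h S f ∧
        (∀ g : ℝ → ℝ → ℝ, Milne.IsSolution ε R h S g →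
          ∀ p ∈ Milne.phaseSpace (Milne.len ε), g p.1 p.2 = f p.1 p.2) ∧
        ∃ fL : ℝ,
          |fL| ≤ C * (Milne.inflowL2Norm h + Milne.l2Norm (Milne.len ε) S)
            + C * |∫ y in (0 : ℝ)..(Milne.len ε), Milne.sinMoment (Milne.fluct S) y|
            + C * |∫ η in (0 : ℝ)..(Milne.len ε), (∫ y in η..(Milne.len ε), |Milne.mean S y|)| ∧
          ∀ K₀ : ℝ, 0 < K₀ → K₀ ≤ Kmax →
            Milne.supNorm (Milne.len ε) (Milne.expWeight K₀ (fun η φ => f η φ - fL)) ≤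
              C * (Milne.inflowL2Norm h + Milne.l2Norm (Milne.len ε) (Milne.expWeight K₀ S)
                + Milne.inflowSupNorm h + Milne.supNorm (Milne.len ε) (Milne.expWeight K₀ S))
              + C * Milne.expL2 K₀ (Milne.len ε)
                  (fun η => ∫ y in η..(Milne.len ε), Milne.sinMoment (Milne.fluct S) y)
              + C * |∫ y in (0 : ℝ)..(Milne.len ε), Milne.sinMoment (Milne.fluct S) y|
              + C * |∫ η in (0 : ℝ)..(Milne.len ε), (∫ y in η..(Milne.len ε), |Milne.mean S y|)|
              + C * Milne.expL2 K₀ (Milne.len ε)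
                  (fun η => ∫ y in η..(Milne.len ε), |Milne.mean S y|)
              + C * Milne.expL2 K₀ (Milne.len ε)
                  (fun η => ∫ y in η..(Milne.len ε), ∫ z in y..(Milne.len ε), |Milne.mean S z|) := by
  -- The decay rate `1/232` comes from the absorption in the energy estimate. The constant `600000`
  -- covers the largest coefficient `(9 + 528 · 6) · 160 + 528 · 31`, which arises from inserting
  -- the bound of the limit into the supremum bound.
  refine ⟨min (1 / 615) (Rmin / 6) ^ 2, by positivity, 1 / 232, by norm_num, 600000, by norm_num,
    fun ε R hε hε' hR h S hd => ?_⟩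
  obtain ⟨h1, h6⟩ := Milne.len_bounds hRmin hε hε' hR
  have hL : Milne.len ε < R / ε := by linarith
  have h0 : 0 ≤ Milne.len ε := by linarith
  have hS := hd.admissible
  obtain ⟨f, hf⟩ := Milne.exists_isSolution hε hL hd
  have hlim := hf.abs_limit_le hε hS (by linarith) h6
  refine ⟨f, hf, fun g hg p hp => hf.unique hε hL hg hS hp, _, hlim.trans ?_, fun K hK hK' => ?_⟩
  · have e1 : 0 ≤ Milne.inflowL2Norm h := sqrt_nonneg _
    have e2 : 0 ≤ Milne.l2Norm (Milne.len ε) S := sqrt_nonneg _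
    have e3 := abs_nonneg (∫ y in (0 : ℝ)..(Milne.len ε), Milne.sinMoment (Milne.fluct S) y)
    have e4 := abs_nonneg
      (∫ η in (0 : ℝ)..(Milne.len ε), (∫ y in η..(Milne.len ε), |Milne.mean S y|))
    linarith
  · have hsup := hf.supNorm_le hε hd h1 h6 hK.le hK' rfl
    have hle := Milne.l2Norm_le_expWeight h0 hK.le hS
    refine hsup.trans ?_
    have e1 : 0 ≤ Milne.inflowL2Norm h := sqrt_nonneg _
    have e2 : 0 ≤ Milne.l2Norm (Milne.len ε) S := sqrt_nonneg _
    have e3 := abs_nonneg (∫ y in (0 : ℝ)..(Milne.len ε), Milne.sinMoment (Milne.fluct S) y)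
    have e4 := abs_nonneg
      (∫ η in (0 : ℝ)..(Milne.len ε), (∫ y in η..(Milne.len ε), |Milne.mean S y|))
    have e5 : 0 ≤ Milne.inflowSupNorm h := Real.iSup_nonneg fun _ => abs_nonneg _
    have e6 := Milne.supNorm_nonneg (Milne.len ε) (Milne.expWeight K S)
    have e7 : 0 ≤ Milne.expL2 K (Milne.len ε)
      (fun η => ∫ y in η..(Milne.len ε), Milne.sinMoment (Milne.fluct S) y) := sqrt_nonneg _
    -- The weighted norm of the single tail of `|mean S|` enters only as a nonnegative summand; the
    -- preceding estimates need the double tail alone.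
    have e8 : 0 ≤ Milne.expL2 K (Milne.len ε)
      (fun η => ∫ y in η..(Milne.len ε), |Milne.mean S y|) := sqrt_nonneg _
    have e9 : 0 ≤ Milne.expL2 K (Milne.len ε)
      (fun η => ∫ y in η..(Milne.len ε), ∫ z in y..(Milne.len ε), |Milne.mean S z|) :=
      sqrt_nonneg _
    linarith
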